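/- Conventions. A pro-$3$ group is a compact, totally disconnected topological group in which every open normal subgroup has $3$-power index. All subgroups $G^{(n)}$ in the derived series of a pro-$3$ group $G$ are formed with closed commutator subgroups ($G^{(0)}=G$, $G^{(n)}=\overline{[G^{(n-1)},G^{(n-1)}]}$), $G^{ab}=G/G^{(1)}$, and $G$ has derived length $n$ if $G^{(n)}=1\neq G^{(n-1)}$. We write $[n_1,\dots,n_k]$ for the direct product of cyclic groups of orders $n_1,\dots,n_k$. A Schur $\sigma$-group (for the prime $3$) is a pro-$3$ group $G$ such that (1) the minimal number of topological generators of $G$ equals the relation rank $\dim_{\mathbb F_3}H^2(G,\mathbb F_3)$ (continuous cohomology, trivial action), (2) $G^{ab}$ is finite, and (3) $G$ has a (continuous) automorphism $\sigma$ of order $2$ which induces $x\mapsto x^{-1}$ on $G^{ab}$. For an open maximal subgroup $M$ of $G$ let $V_M:G^{ab}\to M^{ab}$ be the transfer map. **Theorem.** For $e\in\{0,2\}$ let $\Gamma_e$ be the group with generators $g_1,\dots,g_8$ and relations $$g_1^3=g_5g_6^2g_8^e,\quad g_2^3=g_4g_8,\quad g_3^3=g_6^2g_7g_8,\quad g_4^3=g_7^2,\quad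 g_5^3=g_8^2,$$ $$[g_2,g_1]=g_3,\ [g_3,g_1]=g_4,\ [g_3,g_2]=g_5,\ [g_5,g_1]=g_7,\ [g_5,g_2]=g_6,\ [g_5,g_3]=g_7,\ [g_6,g_1]=g_7,\ [g_6,g_2]=g_8,$$ together with $g_i^3=1$ and $[g_j,g_i]=1$ for all remaining $i$, respectively all remaining pairs $i<j$, where $[x,y]=x^{-1}y^{-1}xy$. Consider the following conditions on a Schur $\sigma$-group $G$ (for the prime $3$): (i) $G^{ab}\cong[3,3]$; (ii) $G$ has exactly four open maximal subgroups, and they can be ordered as $M_1,\dots,M_4$ such that $M_i^{ab}\cong[3,9]$ for $i=1,2,3$ and $M_4^{ab}\cong[9,27]$ (transfer target type $\{[3,9]^3,[9,27]\}$); (iii) the four open maximal subgroups can be ordered (possibly differently) as $M_1,\dots,M_4$ such that $\ker V_{M_1}$, $\ker V_{M_2}$, $\ker V_{M_3}$, $\ker V_{M_4}$ are the images in $G^{ab}$ of $M_1$, $M_4$, $M_3$, $M_1$ respectively (transfer kernel type equivalent to $(1,4,3,1)$). Then $\Gamma_0$ and $\Gamma_2$ are finite groups of order $3^8$ and derived length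 $3$; they are not isomorphic to each other; with the discrete topology both are Schur $\sigma$-groups satisfying (i), (ii) and (iii); and every Schur $\sigma$-group $G$ satisfying (i), (ii) and (iii) is isomorphic, as a topological group, to $\Gamma_0$ or to $\Gamma_2$. In particular, up to isomorphism there are exactly two such $G$. -/

import Mathlib

section ProPGroups

variable (p : ℕ) (G : Type*) [Group G] [TopologicalSpace G]

/-- A pro-`p` group: a compact, totally disconnected topological group all of whose open normal
subgroups have index a power of `p`. -/
structure IsProP [IsTopologicalGroup G] : Prop where
  compact : CompactSpace G
  totallyDisconnected : TotallyDisconnectedSpace G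
  index_eq_pow : ∀ U : Subgroup G, U.Normal → IsOpen (U : Set G) → ∃ n : ℕ, U.index = p ^ n

/-- The generator rank `d` of a pro-`p` group: the least cardinality of a subset which converges
to `1` (every open subgroup contains all but finitely many of its elements; this is automatic for
finite subsets) and generates `G` topologically. -/
noncomputable def generatorRank [IsTopologicalGroup G] : Cardinal :=
  sInf {c | ∃ S : Set G, Cardinal.mk S = c ∧
    (∀ U : Subgroup G, IsOpen (U : Set G) → (S \ (U : Set G)).Finite) ∧
    (Subgroup.closure S).topologicalClosure = ⊤}

/-- Continuous (inhomogeneous) `2`-cocycles of `G` with values in the trivial discrete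
`G`-module `ZMod p`. -/
def contCocycles₂ [IsTopologicalGroup G] : Submodule (ZMod p) (G × G → ZMod p) where
  carrier := {f | Continuous f ∧
    ∀ g h k : G, f (h, k) - f (g * h, k) + f (g, h * k) - f (g, h) = 0}
  zero_mem' := ⟨continuous_const, fun g h k => by simp⟩
  add_mem' := by
    rintro a b ⟨ha, ha'⟩ ⟨hb, hb'⟩
    refine ⟨ha.add hb, fun g h k => ?_⟩
    have h1 := ha' g h k
    have h2 := hb' g h k
    simp only [Pi.add_apply]
    linear_combination h1 + h2
  smul_mem' := by
    rintro c a ⟨ha, ha'⟩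
    refine ⟨continuous_const.mul ha, fun g h k => ?_⟩
    have h1 := ha' g h k
    simp only [Pi.smul_apply, smul_eq_mul]
    linear_combination c * h1

/-- `2`-coboundaries of continuous functions `G → ZMod p` (trivial action). -/
def contCoboundaries₂ [IsTopologicalGroup G] : Submodule (ZMod p) (G × G → ZMod p) where
  carrier := {f | ∃ φ : G → ZMod p, Continuous φ ∧
    ∀ g h : G, f (g, h) = φ h - φ (g * h) + φ g}
  zero_mem' := ⟨0, continuous_const, fun g h => by simp⟩
  add_mem' := by
    rintro a b ⟨φ, hφ, ha⟩ ⟨ψ, hψ, hb⟩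
    refine ⟨φ + ψ, hφ.add hψ, fun g h => ?_⟩
    simp only [Pi.add_apply, ha, hb]
    ring
  smul_mem' := by
    rintro c a ⟨φ, hφ, ha⟩
    refine ⟨c • φ, continuous_const.mul hφ, fun g h => ?_⟩
    simp only [Pi.smul_apply, smul_eq_mul, ha]
    ring

/-- The continuous cohomology group `H²(G, ZMod p)` (trivial action): continuous `2`-cocycles
modulo coboundaries of continuous `1`-cochains. -/
abbrev ContH2 [IsTopologicalGroup G] : Type _ :=
  contCocycles₂ p G ⧸ (contCoboundaries₂ p G).submoduleOf (contCocycles₂ p G)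

/-- The relation rank `r(G) = dim H²(G, 𝔽_p)` of a pro-`p` group. -/
noncomputable def relationRank [IsTopologicalGroup G] : Cardinal :=
  Module.rank (ZMod p) (ContH2 p G)

/-- Schur `σ`-groups. `TopologicalAbelianization G` is the quotient of `G` by the closure of its
commutator subgroup. -/
structure IsSchurSigmaGroup [IsTopologicalGroup G] : Prop where
  isProP : IsProP p G
  generatorRank_eq_relationRank : generatorRank G = relationRank p G
  finite_abelianization : Finite (TopologicalAbelianization G)
  exists_sigma : ∃ σ : G ≃ₜ* G, (∃ x, σ x ≠ x) ∧ (∀ x, σ (σ x) = x) ∧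
    ∀ x, (QuotientGroup.mk (σ x) : TopologicalAbelianization G) = (QuotientGroup.mk x)⁻¹

/-- The derived series of a topological group, formed with closed commutator subgroups. -/
def closedDerivedSeries [IsTopologicalGroup G] : ℕ → Subgroup G
  | 0 => ⊤
  | n + 1 => (⁅closedDerivedSeries n, closedDerivedSeries n⁆ : Subgroup G).topologicalClosure

/-- `G` has derived length exactly `n`. -/
def HasDerivedLength [IsTopologicalGroup G] (n : ℕ) : Prop :=
  closedDerivedSeries G n = ⊥ ∧ ∀ m < n, closedDerivedSeries G m ≠ ⊥

end ProPGroups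

section Transfer

/-- The abelian group written `[n₁, …, n_k]`: the direct product of cyclic groups of orders
`n₁, …, n_k`. -/
abbrev AbelianOfType (l : List ℕ) : Type :=
  Multiplicative (∀ i : Fin l.length, ZMod (l.get i))

variable {G : Type*} [Group G] [TopologicalSpace G] [IsTopologicalGroup G]

/-- The transfer from `G` to the abelianization of an open subgroup of finite index is
continuous. -/
theorem continuous_transfer (H : Subgroup G) [H.FiniteIndex] (hH : IsOpen (H : Set G)) :
    Continuous (MonoidHom.transfer
      (QuotientGroup.mk' (commutator H).topologicalClosure : H →* TopologicalAbelianization H)) := by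
  classical
  set ϕ : H →* TopologicalAbelianization H := QuotientGroup.mk' (commutator H).topologicalClosure
  have hϕ : Continuous ϕ := continuous_quotient_mk'
  let _ := H.fintypeQuotientOfFiniteIndex
  let T : H.LeftTransversal := default
  let t : G ⧸ H → G := fun q => (T.2.leftQuotientEquiv q : G)
  have ht : ∀ q, (t q : G ⧸ H) = q := fun q => T.2.leftQuotientEquiv.symm_apply_apply q
  have hconj : ∀ q, Continuous fun g : G => (t q)⁻¹ * g * t q := fun q => by fun_prop
  let ψ : G → TopologicalAbelianization H := fun x => if h : x ∈ H then ϕ ⟨x, h⟩ else 1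
  have hψ : ContinuousAt ψ 1 := by
    have h1 : Continuous ((H : Set G).domRestrict ψ) := by
      have : (H : Set G).domRestrict ψ = ϕ := by
        funext x
        exact dif_pos x.2
      rw [this]
      exact hϕ
    exact (continuousOn_iff_continuous_domRestrict.2 h1).continuousAt (hH.mem_nhds H.one_mem)
  have key : ∀ᶠ g in nhds (1 : G), ∏ q, ψ ((t q)⁻¹ * g * t q) = MonoidHom.transfer ϕ g := by
    have hev : ∀ᶠ g in nhds (1 : G), ∀ q, (t q)⁻¹ * g * t q ∈ H := by
      rw [Filter.eventually_all]
      intro q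
      exact (hconj q).continuousAt.eventually_mem (hH.mem_nhds (by simp [H.one_mem]))
    filter_upwards [hev] with g hg
    rw [MonoidHom.transfer_def ϕ T, Subgroup.leftTransversals.diff]
    refine Finset.prod_congr (by congr) fun q _ => ?_
    have hq : g⁻¹ • q = q := by
      rw [inv_smul_eq_iff]
      conv_lhs => rw [← ht q]
      conv_rhs => rw [← ht q]
      change ((t q : G) : G ⧸ H) = ((g * t q : G) : G ⧸ H)
      rw [QuotientGroup.eq, ← mul_assoc]
      exact hg q
    rw [show ψ ((t q)⁻¹ * g * t q) = ϕ ⟨_, hg q⟩ from dif_pos (hg q)]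
    congr 1
    rw [Subtype.ext_iff]
    simp only [Subgroup.smul_apply_eq_smul_apply_inv_smul, smul_eq_mul, hq, mul_assoc, t]
  refine continuous_of_continuousAt_one _ (ContinuousAt.congr ?_ key)
  refine tendsto_finsetProd _ fun q _ => ?_
  have h2 : ContinuousAt ψ ((t q)⁻¹ * 1 * t q) := by simpa using hψ
  exact ContinuousAt.comp (f := fun g : G => (t q)⁻¹ * g * t q) h2 (hconj q).continuousAt

/-- The transfer map `G^ab → H^ab` for an open subgroup `H` of finite index, induced by Mathlib's
`MonoidHom.transfer`. -/
noncomputable def transferAb (H : Subgroup G) [H.FiniteIndex] (hH : IsOpen (H : Set G)) :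
    TopologicalAbelianization G →* TopologicalAbelianization H :=
  QuotientGroup.lift (commutator G).topologicalClosure
    (MonoidHom.transfer
      (QuotientGroup.mk' (commutator H).topologicalClosure : H →* TopologicalAbelianization H))
    (by
      intro g hg
      have hc := continuous_transfer H hH
      have hcl : IsClosed ((MonoidHom.transfer (QuotientGroup.mk' (commutator H).topologicalClosure :
          H →* TopologicalAbelianization H)).ker : Set G) := by
        have : IsClosed ((commutator H).topologicalClosure : Set H) :=
          Subgroup.isClosed_topologicalClosure _
        exact isClosed_singleton.preimage hc
      exact Subgroup.topologicalClosure_minimal _ (Abelianization.commutator_subset_ker _) hcl hg)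

variable (G)

/-- The maximal subgroups of a profinite group: the maximal proper subgroups that are open.
(Finiteness of the index is automatic when `G` is compact.) -/
structure MaximalOpenSubgroup where
  toSubgroup : Subgroup G
  isOpen : IsOpen (toSubgroup : Set G)
  finiteIndex : toSubgroup.FiniteIndex
  isCoatom : IsCoatom toSubgroup

variable {G}

/-- The abelianization `M^ab` of a maximal subgroup `M`. -/
abbrev MaximalOpenSubgroup.Ab (M : MaximalOpenSubgroup G) : Type _ :=
  TopologicalAbelianization M.toSubgroup

/-- The transfer map `G^ab → M^ab`. -/
noncomputable def MaximalOpenSubgroup.transfer (M : MaximalOpenSubgroup G) :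
    TopologicalAbelianization G →* M.Ab :=
  haveI := M.finiteIndex
  transferAb M.toSubgroup M.isOpen

/-- The image of `M` in `G^ab`. -/
def MaximalOpenSubgroup.image (M : MaximalOpenSubgroup G) :
    Subgroup (TopologicalAbelianization G) :=
  M.toSubgroup.map (QuotientGroup.mk' (commutator G).topologicalClosure)

variable (G)

/-- `G` has exactly `m` maximal subgroups, and they can be ordered as `M₁, …, M_m` so that the
sequence of abelianizations `M₁^ab, …, M_m^ab` is of type `τ`. -/
def HasTransferTargetType {m : ℕ} (τ : Fin m → List ℕ) : Prop :=
  ∃ M : Fin m ≃ MaximalOpenSubgroup G, ∀ i, Nonempty ((M i).Ab ≃* AbelianOfType (τ i))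

variable {G} in
/-- The subgroup of `G^ab` with a given label: `0` labels the whole group, `1, …, m` label the
images of the maximal subgroups `M₁, …, M_m`. -/
def labelledSubgroup {m : ℕ} (M : Fin m ≃ MaximalOpenSubgroup G) :
    Fin (m + 1) → Subgroup (TopologicalAbelianization G) :=
  Fin.cons ⊤ fun i => (M i).image

/-- `G` has exactly `m` maximal subgroups, and they can be ordered as `M₁, …, M_m` so that, for
each `i`, the kernel of the transfer `G^ab → M_i^ab` is the subgroup labelled `κ i`. In other
words, the transfer kernel type of `G` is equivalent to `κ`. -/
def HasTransferKernelType {m : ℕ} (κ : Fin m → Fin (m + 1)) : Prop :=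
  ∃ M : Fin m ≃ MaximalOpenSubgroup G, ∀ i, (M i).transfer.ker = labelledSubgroup M (κ i)

end Transfer

/-- Schur `σ`-groups (for `p = 3`) with abelianization `[3,3]`, transfer target type
`{[3,9]³, [9,27]}` and transfer kernel type equivalent to `(1,4,3,1)`. -/
structure SatisfiesConditions (G : Type*) [Group G] [TopologicalSpace G]
    [IsTopologicalGroup G] : Prop where
  isSchurSigmaGroup : IsSchurSigmaGroup 3 G
  abelianization : Nonempty (TopologicalAbelianization G ≃* AbelianOfType [3, 3])
  transferTargetType : HasTransferTargetType G ![[3, 9], [3, 9], [3, 9], [9, 27]]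
  transferKernelType : HasTransferKernelType G ![1, 4, 3, 1]

namespace PowerCommutator

/-- The generators `g₁, …, g₈`, as elements of the free group on eight letters. -/
abbrev g₁ : FreeGroup (Fin 8) := FreeGroup.of 0
abbrev g₂ : FreeGroup (Fin 8) := FreeGroup.of 1
abbrev g₃ : FreeGroup (Fin 8) := FreeGroup.of 2
abbrev g₄ : FreeGroup (Fin 8) := FreeGroup.of 3
abbrev g₅ : FreeGroup (Fin 8) := FreeGroup.of 4
abbrev g₆ : FreeGroup (Fin 8) := FreeGroup.of 5
abbrev g₇ : FreeGroup (Fin 8) := FreeGroup.of 6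
abbrev g₈ : FreeGroup (Fin 8) := FreeGroup.of 7

/-- The commutator with the convention `[x, y] = x⁻¹ y⁻¹ x y`. -/
def comm {F : Type*} [Group F] (x y : F) : F := x⁻¹ * y⁻¹ * x * y

/-- The right-hand sides of the power relations `g_i ^ 3 = …`. -/
def powerWord (e : ℕ) : Fin 8 → FreeGroup (Fin 8) :=
  ![g₅ * g₆ ^ 2 * g₈ ^ e, g₄ * g₈, g₆ ^ 2 * g₇ * g₈, g₇ ^ 2, g₈ ^ 2, 1, 1, 1]

/-- The right-hand sides of the commutator relations `[g_j, g_i] = …` for `i < j`; note that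
`g_k` is the generator with index `k - 1`. -/
def commWord : Fin 8 → Fin 8 → FreeGroup (Fin 8)
  | 1, 0 => g₃
  | 2, 0 => g₄
  | 2, 1 => g₅
  | 4, 0 => g₇
  | 4, 1 => g₆
  | 4, 2 => g₇
  | 5, 0 => g₇
  | 5, 1 => g₈
  | _, _ => 1

/-- The relators. -/
def rels (e : ℕ) : Set (FreeGroup (Fin 8)) :=
  {r | ∃ i : Fin 8, r = FreeGroup.of i ^ 3 * (powerWord e i)⁻¹} ∪
  {r | ∃ i j : Fin 8, i < j ∧
    r = comm (FreeGroup.of j) (FreeGroup.of i) * (commWord j i)⁻¹}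

end PowerCommutator

/-- The group with generators `g₁, …, g₈` and relations
`g₁³ = g₅ g₆² g₈ᵉ`, `g₂³ = g₄ g₈`, `g₃³ = g₆² g₇ g₈`, `g₄³ = g₇²`, `g₅³ = g₈²`,
`[g₂,g₁] = g₃`, `[g₃,g₁] = g₄`, `[g₃,g₂] = g₅`, `[g₅,g₁] = g₇`, `[g₅,g₂] = g₆`, `[g₅,g₃] = g₇`,
`[g₆,g₁] = g₇`, `[g₆,g₂] = g₈`, all other `g_i³` and `[g_j, g_i]` (`i < j`) being trivial. -/
def PCGroup (e : ℕ) : Type := PresentedGroup (PowerCommutator.rels e)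

instance (e : ℕ) : Group (PCGroup e) :=
  inferInstanceAs (Group (PresentedGroup (PowerCommutator.rels e)))

instance (e : ℕ) : TopologicalSpace (PCGroup e) := ⊥

instance (e : ℕ) : DiscreteTopology (PCGroup e) := ⟨rfl⟩

/-! The central notion is `CocyclesLift`: every continuous `ℤ/3`-valued 2-cocycle becomes a
coboundary over `ℤ/9`. If the abelianization is `[3,3]`, the coefficient sequence `0 → ℤ/3 → ℤ/9 →
ℤ/3 → 0` shows that the Bockstein `H¹ → H²` is injective, with image the kernel of `H²(ℤ/3) →
H²(ℤ/9)`. Hence the relation rank is at least 2, and it equals the generator rank 2 exactly when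
`CocyclesLift` holds (`Frame.span_bocksteinClass_iff`). For extensions this means
(`CocyclesLift.exists_lift`): given a central extension `E → Q` by an elementary abelian 3-group, a
homomorphism `G → Q` lifts to a central enlargement `W` of `E`, and the elements of `W` over `1` are
central with cubes in the kernel of `E → Q`. Commutators do not see central factors, so only the
cubes of the two generators of `G` remain unknown.

The groups `Γ_e`. Number the generators from 0 and let `N_k` be generated by those of index at least
`k` (`chain`); this is a central series. All finite computations are identities between words,
proved by a verified collection algorithm that the kernel runs. The order `3^8` comes from the
series and two permutation representations. The consistency equations show that in a central
extension by `ℤ/3` every relation lifts except the first two power relations; over `ℤ/9` these are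
repaired by central factors, which gives `CocyclesLift`. The transfer to a maximal subgroup `M`
sends `n ∉ M` to the class of `n³`, so transfer kernels are read off from cubes. `Γ_0` and `Γ_2`
differ because the maximal subgroup `M` with `M^ab = [9,27]` is characteristic: with `D` the action
of `g_1` on `M^ab` minus 1, the relation for `g_0³` says that `3 + D² + 2D³ + eD⁴` kills the class
of `g_0`, and the operator for `e = 2` kills no corresponding class in `Γ_0`.

Uniqueness. A group `G` as in the theorem is mapped to `Γ_0/N_k` for `k = 2, 3, 5, 6`. To pass from
`N_k` to `N_l`, lift to a cover `W` of `Γ_0/N_l`. The image of `G` in `W` has the order of `Γ_0/N_l`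
and the same commutators, and differs from it only by the cubes of two central factors, recorded by
a few exponents mod 3. The transfer data restrict these exponents in two ways. If `N_l ≤ M_i'` in
`Γ_0`, then `M_i^ab` is already visible in `W` and the triviality of the transfer is decided there
(`Cover.cubeTrivial_iff`). Otherwise the cubes of all elements outside `M_i` must fall into the
image of `M_i'` in `W` (`Cover.pow_three_mem`, resting on `pow_three_mem_of_abelian_index_three`).
Up to `N_6` this forces all exponents to vanish; at the last level the image of `G` has order `3^8`
and satisfies `pcData a b c d` with `b ≠ 1` and `d ≠ 2`, and a change of generators makes it `Γ_b`.

So `G` maps onto `Γ_b`. A nontrivial kernel would produce a central extension `E` of `Γ_b` by a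
group of order 3 with an abelianization of the same order. Its kernel lies in `E'`, but by
`CocyclesLift` for `Γ_b` the embedding of `E` in some `W` agrees on `E'` with a map factoring
through `Γ_b`, a contradiction (`IsProP.injective_of_cocyclesLift`). -/

/-- Data of a power-commutator presentation of exponent-`3` type: the words `w i` with
`g i ^ 3 = w i` and the words `w j i`, `i < j`, with `g j * g i = g i * g j * w j i`. -/
structure PCData where
  pw : ℕ → List ℕ
  cw : ℕ → ℕ → List ℕ

/-! ### Collection of words and its soundness. -/

namespace PCData

/-- One step of collection from the left: multiply a collected word by the letter `a` on the left;
`f` performs the recursive calls. The second component records the relations that were used. -/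
def step (R : PCData) (f : ℕ → List ℕ × List (ℕ × ℕ) → List ℕ × List (ℕ × ℕ)) (a : ℕ)
    (s : List ℕ × List (ℕ × ℕ)) : List ℕ × List (ℕ × ℕ) :=
  -- Recursors, `Nat.blt` and `Nat.beq` are used directly so that the kernel can run the collection
  -- by reduction in `decide +kernel`.
  s.rec fun l T => l.rec ([a], T) fun b l _ =>
    (Nat.blt a b).rec
      ((Nat.blt b a).rec
        (l.rec ([a, b], T) fun c l' _ =>
          (Nat.beq a b && Nat.beq a c).rec (a :: b :: c :: l', T)
            ((R.pw a).foldr f (l', (a, a) :: T)))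
        (f b (f a ((R.cw a b).foldr f (l, (a, b) :: T)))))
      (a :: b :: l, T)

/-- Insertion of a letter on the left of a collected word, with bounded recursion depth. -/
def insert (R : PCData) (n : ℕ) : ℕ → List ℕ × List (ℕ × ℕ) → List ℕ × List (ℕ × ℕ) :=
  n.rec (fun a s => (a :: s.1, s.2)) (fun _ f => R.step f)

/-- The collected form of a word, and the list of the relations used. -/
def collectTail (R : PCData) (w : List ℕ) : List ℕ × List (ℕ × ℕ) :=
  -- 60 only bounds the recursion depth. At depth 0 a letter is prepended without collecting, which
  -- leaves the value of the word correct, so soundness holds for any bound.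
  w.foldr (R.insert 60) ([], [])

def collect (R : PCData) (w : List ℕ) : List ℕ := (R.collectTail w).1

/-- The value of a word. -/
def ev {E : Type*} [Monoid E] (g : ℕ → E) (w : List ℕ) : E := (w.map g).prod

section ev
variable {E : Type*} [Monoid E] (g : ℕ → E)

@[simp] theorem ev_nil : ev g [] = 1 := rfl
@[simp] theorem ev_cons (a : ℕ) (w : List ℕ) : ev g (a :: w) = g a * ev g w := by simp [ev]
@[simp] theorem ev_append (v w : List ℕ) : ev g (v ++ w) = ev g v * ev g w := by simp [ev]
@[simp] theorem ev_replicate (n a : ℕ) : ev g (List.replicate n a) = g a ^ n := by simp [ev]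

theorem map_ev {F : Type*} [Monoid F] (φ : E →* F) (w : List ℕ) :
    φ (ev g w) = ev (fun i => φ (g i)) w := by
  simp [ev, map_list_prod, Function.comp_def]

theorem ev_congr {g h : ℕ → E} {w : List ℕ} (H : ∀ i ∈ w, g i = h i) : ev g w = ev h w := by
  simp only [ev]
  rw [List.map_congr_left H]

theorem ev_flatMap (f : ℕ → List ℕ) (w : List ℕ) :
    ev g (w.flatMap f) = ev (fun i => ev g (f i)) w := by
  induction w with
  | nil => rfl
  | cons a w ih => simp [ih]

end ev

/-- The elements `g i` satisfy the relations of `R` up to the central elements `τ`. -/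
structure SatTail (R : PCData) {E : Type*} [Group E] (g : ℕ → E) (τ : ℕ → ℕ → E) : Prop where
  pow : ∀ i, g i ^ 3 = ev g (R.pw i) * τ i i
  comm : ∀ i j, i < j → g j * g i = g i * g j * ev g (R.cw j i) * τ j i
  central : ∀ j i x, x * τ j i = τ j i * x

/-- The elements `g i` satisfy the relations of `R`. -/
structure Sat (R : PCData) {E : Type*} [Group E] (g : ℕ → E) : Prop where
  pow : ∀ i, g i ^ 3 = ev g (R.pw i)
  comm : ∀ i j, i < j → g j * g i = g i * g j * ev g (R.cw j i)

/-- The product of the central elements attached to a list of relations. -/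
def evTail {E : Type*} [Monoid E] (τ : ℕ → ℕ → E) (T : List (ℕ × ℕ)) : E :=
  (T.map fun p => τ p.1 p.2).prod

section soundness
variable {R : PCData} {E : Type*} [Group E] {g : ℕ → E} {τ : ℕ → ℕ → E}

theorem evTail_cons (p : ℕ × ℕ) (T : List (ℕ × ℕ)) :
    evTail τ (p :: T) = τ p.1 p.2 * evTail τ T := by simp [evTail]

/-- The value of a partially collected word. -/
def val (g : ℕ → E) (τ : ℕ → ℕ → E) (s : List ℕ × List (ℕ × ℕ)) : E := ev g s.1 * evTail τ s.2

theorem val_foldr {f : ℕ → List ℕ × List (ℕ × ℕ) → List ℕ × List (ℕ × ℕ)}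
    (hf : ∀ a s, val g τ (f a s) = g a * val g τ s) (w : List ℕ) (s : List ℕ × List (ℕ × ℕ)) :
    val g τ (w.foldr f s) = ev g w * val g τ s := by
  induction w with
  | nil => simp
  | cons a w ih => rw [List.foldr_cons, hf, ih, ev_cons, mul_assoc]

theorem val_step (h : R.SatTail g τ)
    {f : ℕ → List ℕ × List (ℕ × ℕ) → List ℕ × List (ℕ × ℕ)}
    (hf : ∀ a s, val g τ (f a s) = g a * val g τ s) (a : ℕ) (s : List ℕ × List (ℕ × ℕ)) :
    val g τ (R.step f a s) = g a * val g τ s := by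
  obtain ⟨l, T⟩ := s
  have hc := h.central
  rcases l with _ | ⟨b, l⟩
  · simp [step, val]
  · rcases hab : Nat.blt a b with _ | _
    · rcases hba : Nat.blt b a with _ | _
      · rcases l with _ | ⟨c, l⟩
        · simp [step, val, hab, hba, mul_assoc]
        · rcases hac : (Nat.beq a b && Nat.beq a c) with _ | _
          · simp [step, val, hab, hba, hac, mul_assoc]
          · obtain ⟨h1, h2⟩ := Bool.and_eq_true_iff.1 hac
            obtain rfl := Nat.eq_of_beq_eq_true h1
            obtain rfl := Nat.eq_of_beq_eq_true h2
            have : R.step f a (a :: a :: l, T) = (R.pw a).foldr f (l, (a, a) :: T) := by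
              simp [step, hab]
            rw [this, val_foldr hf]
            simp only [val, evTail_cons, ev_cons]
            rw [← mul_assoc (ev g l), hc, mul_assoc (τ a a), ← mul_assoc, ← h.pow a]
            simp only [pow_succ, pow_zero, one_mul, mul_assoc]
      · have hlt : b < a := by simpa [Nat.blt_eq] using hba
        have : R.step f a (b :: l, T) =
            f b (f a ((R.cw a b).foldr f (l, (a, b) :: T))) := by
          simp [step, hab, hba]
        rw [this, hf, hf, val_foldr hf]
        simp only [val, evTail_cons, ev_cons]
        rw [← mul_assoc (ev g l), hc, mul_assoc (τ a b), ← mul_assoc, ← mul_assoc, ← mul_assoc,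
          ← h.comm b a hlt]
        simp only [mul_assoc]
    · simp [step, val, hab, mul_assoc]

theorem val_insert (h : R.SatTail g τ) (n a : ℕ) (s : List ℕ × List (ℕ × ℕ)) :
    val g τ (R.insert n a s) = g a * val g τ s := by
  induction n generalizing a s with
  | zero => simp [insert, val, mul_assoc]
  | succ n ih => exact val_step h ih a s

/-- Every rewriting applies one relation and leaves one central factor, which can be moved to the
end. Nothing is asserted about uniqueness or even reducedness of the result. -/
theorem SatTail.collect_eq (h : R.SatTail g τ) (w : List ℕ) :
    ev g w = ev g (R.collect w) * evTail τ (R.collectTail w).2 := by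
  have := val_foldr (fun a s => val_insert h 60 a s) w ([], [])
  rw [show val g τ ([], []) = 1 by simp [val, evTail], mul_one] at this
  exact this.symm

theorem Sat.satTail (h : R.Sat g) : R.SatTail g fun _ _ => 1 :=
  ⟨fun i => by simpa using h.pow i, fun i j hij => by simpa using h.comm i j hij, by simp⟩

theorem Sat.collect_eq (h : R.Sat g) (w : List ℕ) : ev g w = ev g (R.collect w) := by
  have := h.satTail.collect_eq w
  rwa [show evTail (fun _ _ => (1 : E)) (R.collectTail w).2 = 1 by simp [evTail], mul_one] at this

/-- This is how computations enter the proof: the kernel compares two collected forms, and the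
resulting identity holds in every group satisfying the relations. Inequalities need other arguments,
based on the order of the group. -/
theorem Sat.ev_eq (h : R.Sat g) {v w : List ℕ} (H : R.collect v = R.collect w) :
    ev g v = ev g w := by
  rw [h.collect_eq, H, ← h.collect_eq]

theorem Sat.map {F : Type*} [Group F] (h : R.Sat g) (φ : E →* F) : R.Sat fun i => φ (g i) :=
  ⟨fun i => by rw [← map_pow, h.pow, map_ev],
    fun i j hij => by rw [← map_mul, h.comm i j hij, map_mul, map_mul, map_ev]⟩

theorem Sat.of_map {F : Type*} [Group F] {φ : E →* F} (hφ : Function.Injective φ)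
    (h : R.Sat fun i => φ (g i)) : R.Sat g :=
  ⟨fun i => hφ (by rw [map_pow, h.pow, map_ev]),
    fun i j hij => hφ (by rw [map_mul, h.comm i j hij, map_mul, map_mul, map_ev])⟩

end soundness

/-- The relations of `S`, on eight generators, hold for the values of the words `u i` as a
consequence of the relations of `R`, by collection. -/
def checkSubst (R S : PCData) (u : ℕ → List ℕ) : Bool :=
  (List.range 8).all fun j =>
    (R.collect (u j ++ u j ++ u j) == R.collect ((S.pw j).flatMap u)) &&
    (List.range j).all fun i =>
      R.collect (u j ++ u i) == R.collect (u i ++ u j ++ (S.cw j i).flatMap u)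

/-- Only the first eight generators of `S` are nontrivial. -/
structure Bounded (S : PCData) : Prop where
  pw : ∀ i, 8 ≤ i → S.pw i = []
  cw : ∀ j i, 8 ≤ j → S.cw j i = []

/-- Combined with `PCGroup.lift` this produces homomorphisms out of `Γ_e` from a finite check: the
involution and the final change of generators. -/
theorem Sat.subst {R S : PCData} {E : Type*} [Group E] {g : ℕ → E} (h : R.Sat g)
    (hS : S.Bounded) {u : ℕ → List ℕ} (hu : ∀ i, 8 ≤ i → u i = [])
    (H : R.checkSubst S u = true) : S.Sat fun i => ev g (u i) := by
  simp only [checkSubst, List.all_eq_true, List.mem_range, Bool.and_eq_true, beq_iff_eq] at H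
  constructor
  · intro i
    by_cases hi : i < 8
    · have := h.ev_eq (H i hi).1
      rw [ev_flatMap] at this
      rw [← this]
      simp [pow_succ, mul_assoc]
    · simp [hu i (not_lt.1 hi), hS.pw i (not_lt.1 hi)]
  · intro i j hij
    by_cases hj : j < 8
    · have := h.ev_eq ((H j hj).2 i hij)
      simpa [ev_flatMap, mul_assoc] using this
    · simp [hu j (not_lt.1 hj), hS.cw j i (not_lt.1 hj)]

end PCData

/-! ### The presentations and their universal property. -/

/-- The relations of `Γ_e`, with the first two power relations modified by central words:
`g₀³ = g₄ g₅² g₆ᵃ g₇ᵇ` and `g₁³ = g₃ g₇ g₆ᶜ g₇ᵈ` (the generators are numbered from `0`). -/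
def pcData (a b c d : ℕ) : PCData where
  pw := fun i => match i with
    | 0 => [4, 5, 5] ++ (List.replicate a 6 ++ List.replicate b 7)
    | 1 => [3, 7] ++ (List.replicate c 6 ++ List.replicate d 7)
    | 2 => [5, 5, 6, 7]
    | 3 => [6, 6]
    | 4 => [7, 7]
    | _ => []
  cw := fun j i => match j with
    | 1 => match i with | 0 => [2] | _ => []
    | 2 => match i with | 0 => [3] | 1 => [4] | _ => []
    | 4 => match i with | 0 => [6] | 1 => [5] | 2 => [6] | _ => []
    | 5 => match i with | 0 => [6] | 1 => [7] | _ => []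
    | _ => []

theorem pcData_bounded (a b c d : ℕ) : (pcData a b c d).Bounded where
  pw i hi := by
    obtain ⟨k, rfl⟩ := Nat.exists_eq_add_of_le' hi
    rfl
  cw j i hj := by
    obtain ⟨k, rfl⟩ := Nat.exists_eq_add_of_le' hj
    rfl

/-- Right-hand sides involve later generators only; this is what makes the chain of subgroups below
a central series. -/
theorem lt_of_mem_pw {a b c d i k : ℕ} (h : k ∈ (pcData a b c d).pw i) : i < k ∧ k < 8 := by
  rcases i with _ | _ | _ | _ | _ | i <;> simp [pcData] at h <;> rcases h with h | h <;> omega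

theorem lt_of_mem_cw {a b c d i j k : ℕ} (h : k ∈ (pcData a b c d).cw j i) (hij : i < j) :
    j < k ∧ k < 8 := by
  rcases lt_or_ge j 6 with hj | hj
  · interval_cases j <;> interval_cases i <;> simp [pcData] at h <;> omega
  · obtain ⟨k, rfl⟩ := Nat.exists_eq_add_of_le' hj
    simp [pcData] at h

namespace PCGroup

/-- The canonical projection from the free group. -/
def proj (e : ℕ) : FreeGroup (Fin 8) →* PCGroup e := PresentedGroup.mk (PowerCommutator.rels e)

/-- The generators of `Γ_e`, numbered from `0`. -/
def gen (e i : ℕ) : PCGroup e :=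
  if h : i < 8 then proj e (FreeGroup.of ⟨i, h⟩) else 1

theorem lift_powerWord {E : Type*} [Group E] (h : ℕ → E) (e : ℕ) (i : Fin 8) :
    FreeGroup.lift (fun i : Fin 8 => h i) (PowerCommutator.powerWord e i) =
      PCData.ev h ((pcData 0 e 0 0).pw i) := by
  fin_cases i <;>
    simp [PowerCommutator.powerWord, pcData, pow_succ, mul_assoc]

theorem lift_commWord {E : Type*} [Group E] (h : ℕ → E) (e : ℕ) (i j : Fin 8) (hij : i < j) :
    FreeGroup.lift (fun i : Fin 8 => h i) (PowerCommutator.commWord j i) =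
      PCData.ev h ((pcData 0 e 0 0).cw j i) := by
  fin_cases j <;> fin_cases i <;> first
    | exact absurd hij (by decide)
    | exact (mul_one _).symm
    | rfl

theorem comm_eq_iff {E : Type*} [Group E] (x y w : E) :
    x⁻¹ * y⁻¹ * x * y * w⁻¹ = 1 ↔ x * y = y * x * w := by
  rw [mul_inv_eq_one, ← mul_right_inj (y * x)]
  simp [mul_assoc]

theorem lift_rels_iff {E : Type*} [Group E] (h : ℕ → E) (e : ℕ) (h1 : ∀ i, 8 ≤ i → h i = 1) :
    (∀ r ∈ PowerCommutator.rels e, FreeGroup.lift (fun i : Fin 8 => h i) r = 1) ↔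
      (pcData 0 e 0 0).Sat h := by
  constructor
  · intro H
    constructor
    · intro i
      by_cases hi : i < 8
      · have := H _ (Or.inl ⟨⟨i, hi⟩, rfl⟩)
        rw [map_mul, map_inv, map_pow, lift_powerWord, mul_inv_eq_one] at this
        simpa using this
      · simp [h1 i (not_lt.1 hi), (pcData_bounded 0 e 0 0).pw i (not_lt.1 hi)]
    · intro i j hij
      by_cases hj : j < 8
      · have := H _ (Or.inr ⟨⟨i, hij.trans hj⟩, ⟨j, hj⟩, hij, rfl⟩)
        rw [map_mul, map_inv, lift_commWord _ _ _ _ hij] at this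
        simp only [PowerCommutator.comm, map_mul, map_inv, FreeGroup.lift_apply_of] at this
        exact (comm_eq_iff _ _ _).1 this
      · simp [h1 j (not_lt.1 hj), (pcData_bounded 0 e 0 0).cw j i (not_lt.1 hj)]
  · rintro H r (⟨i, rfl⟩ | ⟨i, j, hij, rfl⟩)
    · rw [map_mul, map_inv, map_pow, lift_powerWord, mul_inv_eq_one]
      simpa using H.pow i
    · rw [map_mul, map_inv, lift_commWord _ _ _ _ hij]
      simp only [PowerCommutator.comm, map_mul, map_inv, FreeGroup.lift_apply_of]
      exact (comm_eq_iff _ _ _).2 (H.comm i j hij)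

theorem gen_of_le (e : ℕ) {i : ℕ} (hi : 8 ≤ i) : gen e i = 1 := dif_neg (not_lt.2 hi)

theorem sat_gen (e : ℕ) : (pcData 0 e 0 0).Sat (gen e) := by
  rw [← lift_rels_iff _ _ fun i hi => gen_of_le e hi]
  intro r hr
  have : FreeGroup.lift (fun i : Fin 8 => gen e i) = proj e := by
    ext i
    simp [gen]
  rw [this]
  exact PresentedGroup.one_of_mem hr

/-- The homomorphism from `Γ_e` given by elements which satisfy its relations. -/
def lift {E : Type*} [Group E] {e : ℕ} {h : ℕ → E} (h1 : ∀ i, 8 ≤ i → h i = 1)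
    (H : (pcData 0 e 0 0).Sat h) : PCGroup e →* E :=
  PresentedGroup.toGroup (rels := PowerCommutator.rels e) (f := fun i : Fin 8 => h i)
    ((lift_rels_iff h e h1).2 H)

theorem lift_gen {E : Type*} [Group E] {e : ℕ} {h : ℕ → E} (h1 : ∀ i, 8 ≤ i → h i = 1)
    (H : (pcData 0 e 0 0).Sat h) (i : ℕ) : lift h1 H (gen e i) = h i := by
  by_cases hi : i < 8
  · rw [gen, dif_pos hi]
    exact PresentedGroup.toGroup.of ((lift_rels_iff h e h1).2 H)
  · rw [gen_of_le e (not_lt.1 hi), map_one, h1 i (not_lt.1 hi)]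

theorem closure_gen (e : ℕ) : Subgroup.closure (Set.range (gen e)) = ⊤ := by
  rw [eq_top_iff]
  refine (PresentedGroup.closure_range_of (PowerCommutator.rels e)).symm.le.trans ?_
  refine Subgroup.closure_mono ?_
  rintro _ ⟨i, rfl⟩
  exact ⟨i, dif_pos i.2⟩

end PCGroup

/-! ### The central series of a group with such generators, and its order. -/

open PCData

/-- Generators `h` of a group `T` which satisfy the relations `pcData a b c d`. -/
structure PCModel (a b c d : ℕ) {T : Type*} [Group T] (h : ℕ → T) : Prop where
  sat : (pcData a b c d).Sat h
  one : ∀ i, 8 ≤ i → h i = 1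
  closure : Subgroup.closure (Set.range h) = ⊤

theorem PCGroup.model (e : ℕ) : PCModel 0 e 0 0 (PCGroup.gen e) :=
  ⟨PCGroup.sat_gen e, fun _ => PCGroup.gen_of_le e, PCGroup.closure_gen e⟩

/-- The subgroup generated by the `h i` with `k ≤ i`. -/
def chain {T : Type*} [Group T] (h : ℕ → T) (k : ℕ) : Subgroup T :=
  Subgroup.closure (h '' Set.Ici k)

section chain
variable {T : Type*} [Group T] {h : ℕ → T}

theorem mem_chain {k i : ℕ} (hi : k ≤ i) : h i ∈ chain h k :=
  Subgroup.subset_closure ⟨i, hi, rfl⟩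

theorem chain_anti {k l : ℕ} (hkl : k ≤ l) : chain h l ≤ chain h k :=
  Subgroup.closure_mono (Set.image_mono (Set.Ici_subset_Ici.2 hkl))

theorem ev_mem {S : Subgroup T} {w : List ℕ} (hw : ∀ i ∈ w, h i ∈ S) : ev h w ∈ S := by
  refine Subgroup.list_prod_mem _ ?_
  simpa using hw

theorem ev_mem_chain {k : ℕ} {w : List ℕ} (hw : ∀ i ∈ w, k ≤ i) : ev h w ∈ chain h k :=
  ev_mem fun i hi => mem_chain (hw i hi)

end chain

namespace PCModel
variable {a b c d : ℕ} {T : Type*} [Group T] {h : ℕ → T}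

theorem chain_eq_bot (H : PCModel a b c d h) {k : ℕ} (hk : 8 ≤ k) : chain h k = ⊥ := by
  rw [chain, Subgroup.closure_eq_bot_iff]
  rintro _ ⟨i, hi, rfl⟩
  exact H.one i (hk.trans hi)

theorem chain_zero (H : PCModel a b c d h) : chain h 0 = ⊤ := by
  rw [chain, ← H.closure]
  congr 1
  ext t
  simp

/-- Generators in the quotient by the next term are central. -/
theorem mk_central (H : PCModel a b c d h) (k : ℕ) [(chain h (k + 1)).Normal] (t : T) :
    (t * h k : T ⧸ chain h (k + 1)) = h k * t := by
  have ht : t ∈ Subgroup.closure (Set.range h) := by rw [H.closure]; trivial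
  have hev : ∀ w : List ℕ, (∀ i ∈ w, k + 1 ≤ i) →
      ((ev h w : T) : T ⧸ chain h (k + 1)) = 1 := fun w hw =>
    (QuotientGroup.eq_one_iff _).2 (ev_mem_chain hw)
  induction ht using Subgroup.closure_induction with
  | mem x hx =>
    obtain ⟨m, rfl⟩ := hx
    rcases lt_trichotomy m k with hm | rfl | hm
    · have := congrArg (QuotientGroup.mk (s := chain h (k + 1))) (H.sat.comm m k hm)
      simp only [QuotientGroup.mk_mul] at this
      rw [hev _ fun i hi => (lt_of_mem_cw hi hm).1, mul_one] at this
      exact this.symm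
    · rfl
    · have : ((h m : T) : T ⧸ chain h (k + 1)) = 1 :=
        (QuotientGroup.eq_one_iff _).2 (mem_chain hm)
      rw [this, one_mul, mul_one]
  | one => simp
  | mul x y _ _ hx hy =>
    rw [QuotientGroup.mk_mul, mul_assoc, hy, ← mul_assoc, hx, mul_assoc]
  | inv x _ hx =>
    rw [QuotientGroup.mk_inv, inv_mul_eq_iff_eq_mul, ← mul_assoc, hx, mul_inv_cancel_right]

theorem map_chain (h : ℕ → T) (k : ℕ) [(chain h (k + 1)).Normal] :
    (chain h k).map (QuotientGroup.mk' (chain h (k + 1))) =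
      Subgroup.zpowers (h k : T ⧸ chain h (k + 1)) := by
  rw [show chain h k = Subgroup.closure (h '' Set.Ici k) from rfl, MonoidHom.map_closure]
  apply le_antisymm
  · rw [Subgroup.closure_le]
    rintro _ ⟨_, ⟨i, hi, rfl⟩, rfl⟩
    rcases eq_or_lt_of_le (Set.mem_Ici.1 hi) with rfl | hi
    · exact Subgroup.mem_zpowers _
    · have : ((h i : T) : T ⧸ chain h (k + 1)) = 1 :=
        (QuotientGroup.eq_one_iff _).2 (mem_chain hi)
      change ((h i : T) : T ⧸ chain h (k + 1)) ∈ _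
      rw [this]
      exact one_mem _
  · rw [Subgroup.zpowers_le]
    exact Subgroup.subset_closure ⟨_, ⟨k, Set.self_mem_Ici, rfl⟩, rfl⟩

theorem chain_eq_comap (h : ℕ → T) (k : ℕ) [(chain h (k + 1)).Normal] :
    chain h k = (Subgroup.zpowers (h k : T ⧸ chain h (k + 1))).comap
      (QuotientGroup.mk' (chain h (k + 1))) := by
  rw [← map_chain, Subgroup.comap_map_eq, QuotientGroup.ker_mk',
    sup_of_le_left (chain_anti (Nat.le_succ k))]

/-- Descending induction from `N_8 = 1`: once `N_{k+1}` is normal, `N_k` is the preimage of the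
cyclic subgroup generated by the image of `h k`, which is central by `mk_central`. -/
theorem chain_normal (H : PCModel a b c d h) (k : ℕ) : (chain h k).Normal := by
  rcases le_or_gt 8 k with hk | hk
  · rw [H.chain_eq_bot hk]
    infer_instance
  · refine Nat.decreasingInduction' (P := fun k => (chain h k).Normal) (n := 8) ?_ hk.le ?_
    · intro k _ _ hk
      rw [chain_eq_comap h k]
      refine Subgroup.Normal.comap ⟨fun x hx g => ?_⟩ _
      obtain ⟨n, rfl⟩ := Subgroup.mem_zpowers_iff.1 hx
      obtain ⟨g, rfl⟩ := QuotientGroup.mk_surjective g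
      have : Commute ((g : T) : T ⧸ chain h (k + 1)) (h k) := H.mk_central k g
      rw [(this.zpow_right n).eq, mul_inv_cancel_right]
      exact hx
    · rw [H.chain_eq_bot le_rfl]
      infer_instance

theorem commutator_mem (H : PCModel a b c d h) {k : ℕ} {n : T} (hn : n ∈ chain h k) (t : T) :
    n⁻¹ * t⁻¹ * n * t ∈ chain h (k + 1) := by
  have := H.chain_normal (k + 1)
  rw [chain_eq_comap h k] at hn
  obtain ⟨m, hm⟩ := Subgroup.mem_zpowers_iff.1 hn
  have hc : Commute ((t : T) : T ⧸ chain h (k + 1)) (n : T ⧸ chain h (k + 1)) := by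
    have : Commute ((t : T) : T ⧸ chain h (k + 1)) (h k) := H.mk_central k t
    have h2 := this.zpow_right m
    rw [hm] at h2
    exact h2
  rw [← QuotientGroup.eq_one_iff]
  simp only [QuotientGroup.mk_mul, QuotientGroup.mk_inv]
  rw [mul_assoc, ← hc.eq, mul_assoc]
  simp

theorem mk_pow (H : PCModel a b c d h) (k : ℕ) [(chain h (k + 1)).Normal] :
    (h k : T ⧸ chain h (k + 1)) ^ 3 = 1 := by
  rw [← QuotientGroup.mk_pow, H.sat.pow, QuotientGroup.eq_one_iff]
  exact ev_mem_chain fun i hi => (lt_of_mem_pw hi).1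

/-- The factor `N_k / N_{k+1}` is generated by the image of `h k`, whose cube is trivial. So `3^8`
bounds the order, and it is attained precisely when no `h k` lies in `N_{k+1}`. -/
theorem card_chain_eq (H : PCModel a b c d h) (k : ℕ) :
    ∃ r, Nat.card (chain h k) = r * Nat.card (chain h (k + 1)) ∧
      (r = 1 ∧ h k ∈ chain h (k + 1) ∨ r = 3 ∧ h k ∉ chain h (k + 1)) := by
  have := H.chain_normal (k + 1)
  refine ⟨orderOf (h k : T ⧸ chain h (k + 1)), ?_, ?_⟩
  · have h1 := Subgroup.relIndex_comap (⊥ : Subgroup (T ⧸ chain h (k + 1)))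
      (QuotientGroup.mk' (chain h (k + 1))) (chain h k)
    rw [MonoidHom.comap_bot, QuotientGroup.ker_mk', map_chain, Subgroup.relIndex_bot_left,
      Nat.card_zpowers] at h1
    rw [← h1, mul_comm]
    have h2 := Subgroup.relIndex_mul_relIndex ⊥ (chain h (k + 1)) (chain h k) bot_le
      (chain_anti (Nat.le_succ k))
    simpa only [Subgroup.relIndex_bot_left] using h2.symm
  · have h3 : orderOf (h k : T ⧸ chain h (k + 1)) ∣ 3 := orderOf_dvd_of_pow_eq_one (H.mk_pow k)
    rcases (Nat.dvd_prime Nat.prime_three).1 h3 with h1 | h1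
    · exact Or.inl ⟨h1, (QuotientGroup.eq_one_iff _).1 (orderOf_eq_one_iff.1 h1)⟩
    · refine Or.inr ⟨h1, fun hk => ?_⟩
      rw [(QuotientGroup.eq_one_iff _).2 hk, orderOf_one] at h1
      omega

theorem card_chain_le (H : PCModel a b c d h) (k : ℕ) (hk : k ≤ 8) :
    0 < Nat.card (chain h k) ∧ Nat.card (chain h k) ≤ 3 ^ (8 - k) := by
  refine Nat.decreasingInduction' (P := fun k => 0 < Nat.card (chain h k) ∧
    Nat.card (chain h k) ≤ 3 ^ (8 - k)) (n := 8) ?_ hk ?_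
  · intro k hk _ ⟨h0, h1⟩
    obtain ⟨r, hr, hr'⟩ := H.card_chain_eq k
    rw [hr, show 8 - k = 8 - (k + 1) + 1 by omega, pow_succ']
    have : r ≤ 3 ∧ 0 < r := by rcases hr' with ⟨rfl, _⟩ | ⟨rfl, _⟩ <;> simp
    exact ⟨Nat.mul_pos this.2 h0, Nat.mul_le_mul this.1 h1⟩
  · rw [H.chain_eq_bot le_rfl]
    simp

theorem finite (H : PCModel a b c d h) : Finite T := by
  have := (H.card_chain_le 0 (by norm_num)).1
  rw [H.chain_zero, Subgroup.card_top] at this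
  exact (Nat.card_pos_iff.1 this).2

/-- If the order is as large as possible, then so is that of each term of the chain. -/
theorem notMem_chain (H : PCModel a b c d h) (hT : Nat.card T = 3 ^ 8) {k : ℕ} (hk : k < 8) :
    h k ∉ chain h (k + 1) := by
  intro hmem
  have key : ∀ m, m ≤ k → Nat.card (chain h m) ≤ 3 ^ (7 - m) := by
    intro m hm
    refine Nat.decreasingInduction' (P := fun m => Nat.card (chain h m) ≤ 3 ^ (7 - m))
      (n := k) ?_ hm ?_
    · intro m hm _ h1
      obtain ⟨r, hr, hr'⟩ := H.card_chain_eq m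
      rw [hr, show 7 - m = 7 - (m + 1) + 1 by omega, pow_succ']
      have : r ≤ 3 := by rcases hr' with ⟨rfl, _⟩ | ⟨rfl, _⟩ <;> simp
      exact Nat.mul_le_mul this h1
    · obtain ⟨r, hr, ⟨rfl, _⟩ | ⟨rfl, h2⟩⟩ := H.card_chain_eq k
      · rw [hr, one_mul]
        have := (H.card_chain_le (k + 1) (by omega)).2
        rwa [show 8 - (k + 1) = 7 - k by omega] at this
      · exact absurd hmem h2
  have := key 0 (Nat.zero_le _)
  rw [H.chain_zero, Subgroup.card_top, hT] at this
  norm_num at this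

theorem card_chain (H : PCModel a b c d h) (hT : Nat.card T = 3 ^ 8) {k : ℕ} (hk : k ≤ 8) :
    Nat.card (chain h k) = 3 ^ (8 - k) := by
  refine Nat.decreasingInduction' (P := fun k => Nat.card (chain h k) = 3 ^ (8 - k))
    (n := 8) ?_ hk ?_
  · intro k hk _ h1
    obtain ⟨r, hr, ⟨_, h2⟩ | ⟨rfl, _⟩⟩ := H.card_chain_eq k
    · exact absurd h2 (H.notMem_chain hT hk)
    · rw [hr, h1, show 8 - k = 8 - (k + 1) + 1 by omega, pow_succ']
  · rw [H.chain_eq_bot le_rfl]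
    simp

theorem exists_pow_mul (H : PCModel a b c d h) {k : ℕ} {t : T} (ht : t ∈ chain h k) :
    ∃ e < 3, ∃ n ∈ chain h (k + 1), t = h k ^ e * n := by
  have := H.chain_normal (k + 1)
  rw [chain_eq_comap h k] at ht
  obtain ⟨m, hm⟩ := Subgroup.mem_zpowers_iff.1 ht
  refine ⟨(m % 3).toNat, by omega, (h k ^ (m % 3).toNat)⁻¹ * t, ?_, by simp⟩
  rw [← QuotientGroup.eq, QuotientGroup.mk_pow, ← zpow_natCast, Int.toNat_of_nonneg (by omega)]
  change _ = QuotientGroup.mk' _ t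
  rw [← hm, ← Int.emod_add_mul_ediv m 3, zpow_add, zpow_mul]
  have := H.mk_pow k
  norm_cast
  rw [this]
  simp

/-- If `z ≡ h k ^ e` modulo `N_{k+1}` with `e ≠ 0`, then `h k` is `z` or its inverse times an
element of `N_{k+1}`. As `z` commutes with `t`, the commutator of `h k` with `t` would be one of an
element of `N_{k+1}`, hence in `N_{k+2}`. -/
theorem mem_chain_succ_of_commute (H : PCModel a b c d h) {k : ℕ} {z t : T} (hz : z ∈ chain h k)
    (hzt : z * t = t * z) (hk : (h k)⁻¹ * t⁻¹ * h k * t ∉ chain h (k + 2)) :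
    z ∈ chain h (k + 1) := by
  obtain ⟨e, he, n, hn, rfl⟩ := H.exists_pow_mul hz
  have key : ∀ n ∈ chain h (k + 1), ∀ z, z * t = t * z → h k = z * n → False := by
    intro n hn z hz hk'
    refine hk ?_
    have h1 : (h k)⁻¹ * t⁻¹ * h k * t = n⁻¹ * t⁻¹ * n * t := by
      rw [hk', mul_inv_rev]
      have : z⁻¹ * t⁻¹ * z = t⁻¹ := by
        rw [← mul_inv_rev, ← hz, mul_inv_rev, inv_mul_cancel_right]
      simp only [mul_assoc] at this ⊢
      rw [← mul_assoc t⁻¹ z, ← mul_assoc z⁻¹, this]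
    rw [h1]
    exact H.commutator_mem hn t
  interval_cases e
  · simpa using hn
  · refine (key n⁻¹ (inv_mem hn) _ hzt ?_).elim
    simp
  · have h3 : h k ^ 3 ∈ chain h (k + 1) := by
      rw [H.sat.pow]
      exact ev_mem_chain fun i hi => (lt_of_mem_pw hi).1
    have hN := H.chain_normal (k + 1)
    set z := h k ^ 2 * n with hz'
    have hzt' : z⁻¹ * t = t * z⁻¹ := by
      rw [inv_mul_eq_iff_eq_mul, ← mul_assoc, hzt, mul_inv_cancel_right]
    refine (key (z * (h k ^ 3 * n) * z⁻¹) ?_ z⁻¹ hzt' ?_).elim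
    · exact hN.conj_mem _ (mul_mem h3 hn) _
    · rw [hz']
      group

theorem card_of_notMem (H : PCModel a b c d h) (hn : ∀ k < 8, h k ∉ chain h (k + 1)) :
    Nat.card T = 3 ^ 8 := by
  rw [← Subgroup.card_top, ← H.chain_zero]
  refine Nat.decreasingInduction' (P := fun k => Nat.card (chain h k) = 3 ^ (8 - k))
    (n := 8) ?_ (Nat.zero_le 8) ?_
  · intro k hk _ h1
    obtain ⟨r, hr, ⟨_, h2⟩ | ⟨rfl, _⟩⟩ := H.card_chain_eq k
    · exact absurd h2 (hn k hk)
    · rw [hr, h1, show 8 - k = 8 - (k + 1) + 1 by omega, pow_succ']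
  · rw [H.chain_eq_bot le_rfl]
    simp

theorem conj_eq (H : PCModel a b c d h) {i j : ℕ} (hij : i < j) :
    (h j)⁻¹ * (h i)⁻¹ * h j * h i = ev h ((pcData a b c d).cw j i) := by
  rw [mul_assoc, H.sat.comm i j hij]
  group

/-- If the last two generators are independent then the order is `3 ^ 8`. -/
theorem card_eq (H : PCModel a b c d h)
    (hind : ∀ i j : ℕ, i < 3 → j < 3 → h 6 ^ i * h 7 ^ j = 1 → i = 0 ∧ j = 0) :
    Nat.card T = 3 ^ 8 := by
  have h8 : chain h 8 = ⊥ := H.chain_eq_bot le_rfl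
  have p7 : h 7 ^ 3 = 1 := H.sat.pow 7
  have k7 : h 7 ∉ chain h 8 := fun h7 => by
    rw [h8, Subgroup.mem_bot] at h7
    simpa using hind 0 1 (by norm_num) (by norm_num) (by simp [h7])
  have k6 : h 6 ∉ chain h 7 := fun h6 => by
    obtain ⟨e, he, n, hn, h6⟩ := H.exists_pow_mul h6
    rw [h8, Subgroup.mem_bot] at hn
    have := hind 1 ((3 - e) % 3) (by norm_num) (Nat.mod_lt _ (by norm_num)) (by
      rw [h6, hn]
      interval_cases e
      · simp
      · simpa [pow_succ, mul_assoc] using p7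
      · simpa [pow_succ, mul_assoc] using p7)
    simp at this
  -- When `h (k+1)` is a commutator of `h k`, a membership `h k ∈ N_{k+1}` would push `h (k+1)` into
  -- `N_{k+2}`. So independence spreads from the last generators to the earlier ones.
  have step : ∀ {k i l : ℕ}, i < k → (pcData a b c d).cw k i = [l] → l = k + 1 →
      h (k + 1) ∉ chain h (k + 2) → h k ∉ chain h (k + 1) := by
    intro k i l hik hl hlk hk hmem
    have := H.commutator_mem hmem (h i)
    rw [H.conj_eq hik, hl] at this
    subst hlk
    exact hk (by simpa using this)
  have k5 : h 5 ∉ chain h 6 := step (i := 0) (by norm_num) rfl rfl k6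
  have k4 : h 4 ∉ chain h 5 := step (i := 1) (by norm_num) rfl rfl k5
  -- No commutator of `h 3` is available. Instead, `h 3` commutes with `h 0` and `h 1`, while `[h 4,
  -- h 1] = h 5` and `[h 5, h 0] = h 6`; so from `N_4` it would descend to `N_6 = ⟨h 6, h 7⟩`, which
  -- has exponent 3, contradicting `h 3 ^ 3 = h 6 ^ 2 ≠ 1`.
  have k3 : h 3 ∉ chain h 4 := fun hmem => by
    have c1 : h 3 * h 1 = h 1 * h 3 := by simpa [pcData] using H.sat.comm 1 3 (by norm_num)
    have c0 : h 3 * h 0 = h 0 * h 3 := by simpa [pcData] using H.sat.comm 0 3 (by norm_num)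
    have m5 := H.mem_chain_succ_of_commute hmem c1 (by
      rw [H.conj_eq (by norm_num)]; simpa [pcData] using k5)
    have m6 := H.mem_chain_succ_of_commute m5 c0 (by
      rw [H.conj_eq (by norm_num)]; simpa [pcData] using k6)
    obtain ⟨e, _, n, hn, h3⟩ := H.exists_pow_mul m6
    obtain ⟨f, _, m, hm, rfl⟩ := H.exists_pow_mul hn
    rw [h8, Subgroup.mem_bot] at hm
    have p6 : h 6 ^ 3 = 1 := H.sat.pow 6
    have p3 : h 3 ^ 3 = h 6 * h 6 := by simpa [pcData] using H.sat.pow 3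
    have c67 : Commute (h 6) (h 7) := by
      have : h 7 * h 6 = h 6 * h 7 := by simpa [pcData] using H.sat.comm 6 7 (by norm_num)
      exact this.symm
    rw [hm, mul_one] at h3
    rw [h3, ((c67.pow_left e).pow_right f).mul_pow, ← pow_mul, ← pow_mul, mul_comm e, mul_comm f,
      pow_mul, pow_mul, p6, p7] at p3
    have := hind 2 0 (by norm_num) (by norm_num) (by rw [pow_two, ← p3]; simp)
    simp at this
  have k2 : h 2 ∉ chain h 3 := step (i := 0) (by norm_num) rfl rfl k3
  have k1 : h 1 ∉ chain h 2 := step (i := 0) (by norm_num) rfl rfl k2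
  -- If `h 0` were a power of `h 1` modulo `N_2`, then `h 2`, the commutator of `h 1` and `h 0`,
  -- would lie in `N_3`.
  have k0 : h 0 ∉ chain h 1 := fun hmem => by
    obtain ⟨e, _, n, hn, h0⟩ := H.exists_pow_mul hmem
    have h1 := H.commutator_mem hn (h 1)
    have h2 : (h 1)⁻¹ * (h 0)⁻¹ * h 1 * h 0 = h 2 := by
      simpa [pcData] using H.conj_eq (i := 0) (j := 1) (by norm_num)
    refine k2 ?_
    have h3 : h 2 = (n⁻¹ * (h 1)⁻¹ * n * h 1)⁻¹ := by
      rw [← h2, h0]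
      group
    rw [h3]
    exact inv_mem h1
  refine H.card_of_notMem fun k hk => ?_
  interval_cases k <;> assumption

end PCModel

/-! ### Permutation representations showing that the order is `3^8`. -/

/-- The function on `Fin n` whose values are the base-`256` digits of `t`. -/
def digitMap (n : ℕ) [NeZero n] (t : ℕ) (x : Fin n) : Fin n := Fin.ofNat n (t >>> (8 * x.1) % 256)

/-- The action of a word in the functions `f i`. -/
def actWord {α : Type*} (f : ℕ → α → α) (w : List ℕ) (x : α) : α := w.foldr f x

theorem bijective_of_iterate {α : Type*} {f : α → α} {n : ℕ} (h : ∀ x, f^[n + 1] x = x) :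
    Function.Bijective f :=
  ⟨fun x y hxy => by
    rw [← h x, ← h y, Function.iterate_succ_apply, Function.iterate_succ_apply, hxy],
   fun x => ⟨f^[n] x, by rw [← Function.iterate_succ_apply' f, h]⟩⟩

/-- Checks that functions on `Fin n` satisfy the relations of `R`. -/
def checkAction (R : PCData) {n : ℕ} (f : ℕ → Fin n → Fin n) : Bool :=
  (List.range 8).all fun j =>
    (decide (∀ x, actWord f [j, j, j] x = actWord f (R.pw j) x)) &&
    (List.range j).all fun i =>
      decide (∀ x, actWord f [j, i] x = actWord f ([i, j] ++ R.cw j i) x)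

theorem exists_perm_sat {R : PCData} (hR : R.Bounded) {n : ℕ} {f : ℕ → Fin n → Fin n}
    (h8 : ∀ i, 8 ≤ i → f i = id) (hf : ∀ i < 8, ∀ x, (f i)^[27] x = x)
    (H : checkAction R f = true) :
    ∃ g : ℕ → Equiv.Perm (Fin n), R.Sat g ∧ (∀ i, 8 ≤ i → g i = 1) ∧ ∀ i, ⇑(g i) = f i := by
  have hb : ∀ i, Function.Bijective (f i) := fun i => by
    by_cases hi : i < 8
    · exact bijective_of_iterate (hf i hi)
    · rw [h8 i (not_lt.1 hi)]
      exact Function.bijective_id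
  let g : ℕ → Equiv.Perm (Fin n) := fun i => Equiv.ofBijective (f i) (hb i)
  have hg1 : ∀ i, 8 ≤ i → g i = 1 := fun i hi => by
    ext x
    simp [g, h8 i hi]
  have hev : ∀ w x, ev g w x = actWord f w x := by
    intro w x
    induction w with
    | nil => rfl
    | cons a w ih =>
      rw [ev_cons, Equiv.Perm.mul_apply, ih]
      rfl
  have heq : ∀ v w, (∀ x, actWord f v x = actWord f w x) → ev g v = ev g w := fun v w hvw =>
    Equiv.ext fun x => by rw [hev, hev, hvw]
  simp only [checkAction, List.all_eq_true, List.mem_range, Bool.and_eq_true,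
    decide_eq_true_eq] at H
  refine ⟨g, ⟨fun i => ?_, fun i j hij => ?_⟩, hg1, fun _ => rfl⟩
  · by_cases hi : i < 8
    · rw [← heq _ _ (H i hi).1]
      simp [pow_succ, mul_assoc]
    · simp [hg1 i (not_lt.1 hi), hR.pw i (not_lt.1 hi)]
  · by_cases hj : j < 8
    · have := heq _ _ ((H j hj).2 i hij)
      simpa [mul_assoc] using this
    · simp [hg1 j (not_lt.1 hj), hR.cw j i (not_lt.1 hj)]

namespace PCGroup

/-- An action of `Γ_e` on the `243` cosets of a subgroup containing `g₇`. -/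
def actionBig : ℕ → Fin 243 → Fin 243
  | 0 => digitMap 243 462359832299046738485917336187327017747068160705779317493095441248257152282086902198905151774666579695890025176626489887376005400712454091887872914162635568249248363698977684717956136695188285884636650080425404835346153389595547828988099678522885863752847628022546523896382588179860137235597952121672524941759770440893736994725480831367642339062174867309156340184112940060864029138322444735623446170013886546920772333161917641864958078169746454151038882515550916690335248296589699261004739201652472327640246646581187661926977778620878419692012191234867447330569649839760084935153766993
  | 1 => digitMap 243 1174681638288674735710956930504524490833072589117965157309089664693583424780185540844551648414314696130151776307293213389894260738188034970634267884952343864470976905832084780049399837747421429695263148701305259150827025338859873698512270589260131817375917573154959424953713303106949719796782197943338671896280073653595981973372729911675814669303240234731999963568833204011910845561133356077298632823656367322193485173552678226759060097064095206333703080449482254185185486166992495023236764973949590741609378593708592029670617177845545322768715182767308802353896057686997558458985552923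
  | 2 => digitMap 243 1393377216403008320833322426796077024045095091335405839459015686128664093762529599937667535541675260568118061680713250317276498232897306386358244489052623484268287258698692963329823731788898754621749601227736615671875931255842511188166310238762738585535147066882101789599765824803016439924248948242384346879378648150697742948084198734753070148299382190007178580308647053846805719734855405136360944893023018066210797683753841100234041054125373639504948740183401679025653160914711099384953595709755165597583648555050258340728128983720178554908568256108234144279432000817124248904273368343
  | 3 => digitMap 243 1393377216030589483682050703769522153974621711921819742563640809449075201904106088574627286022879678203225974595525083565423373587101089735199150028942502738982977452197621383212839842849523574182754601891198035001125116381470205260570057806983383158223111470030533656565659231674139641301390388333647853290753101275237903514127809484550251554709103061003539065236208024484114758140281969214868669664176900918848657600998232028406725844027653715387667222954271989198682598352616552181177858715553776130463004570492371177437115174737789815151488032134028458924370782684904480002611546633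
  | 4 => digitMap 243 1468358462510298535983459042929476637638724360518107092682158213210130234310683642769477009615078756069130876572753252636528085521686623296025844885860953197242802653686060846934943824198269786029523951478869433789808486694305098838084102287925085648034437748584291954961799549272292364071374853334357892227822168717689529280067633828055001343304600242180278655734476185603708388782973232334775801600949940199736077038258710749263732008602106485093341057298484450049363961446739235345930221309657970549374813251143180091240157731699891180015818613339256314880329889363631012345939297283
  | 5 => digitMap 243 1505849080722268905504186230797978313692034058334906504301248205794282892493653024010772659446736842138871500056572499179004394989058262306313765290299975076297726454279693728260052405633052245599620793743081578351758462225106590111968203132445349781930249689547159332402493125717207058332546377845836333069042568618009339592443359119958642376235560582112510658722118461545046131487660541705744066058943370427684691688146446604535794947338285478663345700552893568174565453155274394951965232179925292341701332733402044303857645840507940727645378370950698777285758925212461022196468416768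
  | 6 => digitMap 243 1499673581638799662403360938918862188641720526193189282554668889411263077938869180621661028442817454651831399296194938046410174792965570964437635818629201505594222838412805126869510523262640097191895281044073367388774423517702405256367391911518828214703412926109600442954018667416474295660707237586018983987322292136092734219468468041540765801253207040368653648296483293554426687607692028262304650112484756015409267410909287091073533792464379557953432641083783105834063639123918140182644952312947440710264995874151835059677954602546742352182394110530262651702087029851831582164883866113
  | _ => id

/-- An action of `Γ_e` on the `81` cosets of a subgroup containing `g₆`. -/
def actionSmall (e : ℕ) : ℕ → Fin 81 → Fin 81
  | 0 => if e = 0 then digitMap 81 91588690658121863401364268519655100531111954432561949454997688263871615901824674847644815508906125145662704514541432816881722986651607813557879605475565965579407862326069174352076708142999477275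
    else digitMap 81 87008567784293981938940089772751024745344652237738137869425856016617814236375405255816351362077449427189949570904536515317277654303134789698151310564555371731813963133421846768120099329495866395
  | 1 => digitMap 81 274855665364517768027860193371479410782244253652764679560450698055130489459317039513747400767895797823443483460330425374566952461470231265876197540353309607455809958167603193755899088724652919305
  | 2 => digitMap 81 361828517550987719166926588982894367159706451306467981014678380476826096271993107450204061295188255310015097188390933891416677660704698472605922928633868634707268885892291181279046244941754074115
  | 3 => digitMap 81 361828517550987719166928528873406555502477978174059576040425194972740121815492874966657586780750835335955696871991347562524142469238421919174475008976315963783053338529296706004024368598112862210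
  | 4 => digitMap 81 329819658590776326769050986613812135746740136012247127501410899881356477532078707810288513982760943193864566495560306451040006099408523974063063644817342270252015586632510637578060045138052580355
  | 5 => digitMap 81 357301651113549436919990878942195646818224988757670912464436939313267975039485714980786787823755854296669185787260347125453900092084262937877064474066718874565424582029172062274253442730145415170
  | 7 => digitMap 81 357301651113549436919988950462023657356945323378668181936672368873178395143728668139318721121443644525724368767649483794201649823452222952832676736653250194746695516080977916832814513031869366785
  | _ => id


theorem card_of_independent {W : Type*} [Group W] {e : ℕ} {h : ℕ → W}
    (hs : (pcData 0 e 0 0).Sat h) (h8 : ∀ i, 8 ≤ i → h i = 1)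
    (hind : ∀ i j : ℕ, i < 3 → j < 3 → h 6 ^ i * h 7 ^ j = 1 → i = 0 ∧ j = 0) :
    Nat.card (PCGroup e) = 3 ^ 8 := by
  refine (PCGroup.model e).card_eq fun i j hi hj hij => hind i j hi hj ?_
  have := congrArg (PCGroup.lift h8 hs) hij
  simpa [PCGroup.lift_gen] using this

theorem checkAction_big (e : ℕ) (he : e = 0 ∨ e = 2) :
    checkAction (pcData 0 e 0 0) actionBig = true := by
  rcases he with rfl | rfl <;> decide +kernel

theorem iterate_actionBig : ∀ i < 8, ∀ x, (actionBig i)^[27] x = x := by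
  decide +kernel

theorem checkAction_small (e : ℕ) (he : e = 0 ∨ e = 2) :
    checkAction (pcData 0 e 0 0) (actionSmall e) = true ∧
      ∀ i < 8, ∀ x, (actionSmall e i)^[27] x = x := by
  rcases he with rfl | rfl <;> decide +kernel

/-- In the product of the two permutation representations, `g_6` acts nontrivially only on the 243
points and `g_7` only on the 81 points, so they are independent and `PCModel.card_eq` applies. The
large action serves both values of `e`, because `e` is only an exponent of `g_7`. -/
theorem card_eq {e : ℕ} (he : e = 0 ∨ e = 2) : Nat.card (PCGroup e) = 3 ^ 8 := by
  have hR := pcData_bounded 0 e 0 0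
  obtain ⟨g, hg, hg1, hgf⟩ := exists_perm_sat hR (f := actionBig) (fun i hi => by
    obtain ⟨k, rfl⟩ := Nat.exists_eq_add_of_le' hi
    rfl) iterate_actionBig (checkAction_big e he)
  obtain ⟨k, hk, hk1, hkf⟩ := exists_perm_sat hR (f := actionSmall e) (fun i hi => by
    obtain ⟨k, rfl⟩ := Nat.exists_eq_add_of_le' hi
    rfl) (checkAction_small e he).2 (checkAction_small e he).1
  have g7 : g 7 = 1 := Equiv.ext fun x => by rw [hgf]; rfl
  have k6 : k 6 = 1 := Equiv.ext fun x => by rw [hkf]; rfl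
  refine card_of_independent (h := fun i => (g i, k i)) ⟨fun i => ?_, fun i j hij => ?_⟩
    (fun i hi => by simp [hg1 i hi, hk1 i hi]) fun i j hi hj hij => ?_
  · refine Prod.ext ?_ ?_
    · change _ = MonoidHom.fst _ _ (ev _ _)
      rw [map_ev]
      exact hg.pow i
    · change _ = MonoidHom.snd _ _ (ev _ _)
      rw [map_ev]
      exact hk.pow i
  · refine Prod.ext ?_ ?_
    · change _ = _ * MonoidHom.fst _ _ (ev _ _)
      rw [map_ev]
      exact hg.comm i j hij
    · change _ = _ * MonoidHom.snd _ _ (ev _ _)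
      rw [map_ev]
      exact hk.comm i j hij
  · simp only [g7, k6, Prod.pow_mk, one_pow, Prod.mk_mul_mk, mul_one, one_mul, Prod.mk_eq_one] at hij
    constructor
    · have := congrArg (fun s : Equiv.Perm (Fin 243) => s 0) hij.1
      interval_cases i
      · rfl
      · rw [pow_one, hgf] at this
        exact absurd this (by decide +kernel)
      · rw [pow_two, Equiv.Perm.mul_apply, hgf] at this
        exact absurd this (by decide +kernel)
    · have := congrArg (fun s : Equiv.Perm (Fin 81) => s 0) hij.2
      interval_cases j
      · rfl
      · rw [pow_one, hkf] at this
        exact absurd this (by rcases he with rfl | rfl <;> decide +kernel)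
      · rw [pow_two, Equiv.Perm.mul_apply, hkf] at this
        exact absurd this (by rcases he with rfl | rfl <;> decide +kernel)

end PCGroup

/-! ### Central extensions defined by cocycles. -/

/-- The embedding of `ZMod 3` into `ZMod 9`. -/
def zmodEmb : ZMod 3 →+ ZMod 9 :=
  ZMod.lift 3 ⟨(zmultiplesHom (ZMod 9)) 3, by decide⟩

theorem zmodEmb_injective : Function.Injective zmodEmb := by decide +kernel

theorem zmodEmb_eq : ∀ x : ZMod 3, ∃ u : ZMod 9, 3 • u = zmodEmb x := by decide +kernel

theorem three_smul_eq : ∀ u : ZMod 9, ∃ x : ZMod 3, 3 • u = zmodEmb x := by decide +kernel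

section CocycleExt
variable {G A : Type*} [Group G] [AddCommGroup A]

/-- The (inhomogeneous) `2`-cocycles of `G` with values in `A`, with trivial action. -/
def IsTrivCocycle (F : G × G → A) : Prop :=
  ∀ g h k : G, F (h, k) - F (g * h, k) + F (g, h * k) - F (g, h) = 0

/-- The central extension of `G` by `A` defined by a `2`-cocycle. -/
@[ext]
structure CocycleExt (F : G × G → A) (hF : IsTrivCocycle F) where
  fst : G
  snd : A

namespace CocycleExt
variable {F : G × G → A} {hF : IsTrivCocycle F}

theorem map_one_left (hF : IsTrivCocycle F) (g : G) : F (1, g) = F (1, 1) := by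
  have := hF 1 1 g
  simp only [one_mul, mul_one] at this
  rw [← sub_eq_zero, ← this]
  abel

theorem map_one_right (hF : IsTrivCocycle F) (g : G) : F (g, 1) = F (1, 1) := by
  have := hF g 1 1
  simp only [mul_one] at this
  rw [eq_comm, ← sub_eq_zero, ← this]
  abel

instance : Mul (CocycleExt F hF) := ⟨fun x y => ⟨x.1 * y.1, x.2 + y.2 + F (x.1, y.1)⟩⟩
-- Cocycles are not assumed normalized; hence the corrections by `F (1, 1)` here, in the inverse and
-- in `incl`.
instance : One (CocycleExt F hF) := ⟨⟨1, -F (1, 1)⟩⟩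
instance : Inv (CocycleExt F hF) := ⟨fun x => ⟨x.1⁻¹, -x.2 - F (x.1⁻¹, x.1) - F (1, 1)⟩⟩

@[simp] theorem mul_fst (x y : CocycleExt F hF) : (x * y).1 = x.1 * y.1 := rfl
@[simp] theorem mul_snd (x y : CocycleExt F hF) : (x * y).2 = x.2 + y.2 + F (x.1, y.1) := rfl
@[simp] theorem one_fst : (1 : CocycleExt F hF).1 = 1 := rfl
@[simp] theorem one_snd : (1 : CocycleExt F hF).2 = -F (1, 1) := rfl

instance : Group (CocycleExt F hF) :=
  Group.ofLeftAxioms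
    (fun x y z => by
      ext
      · simp [mul_assoc]
      · have := hF x.1 y.1 z.1
        simp only [mul_snd, mul_fst]
        rw [← sub_eq_zero, ← neg_eq_zero, ← this]
        abel)
    (fun x => by
      ext
      · simp
      · simp [map_one_left hF])
    (fun x => by
      ext
      · exact inv_mul_cancel x.1
      · change -x.2 - F (x.1⁻¹, x.1) - F (1, 1) + x.2 + F (x.1⁻¹, x.1) = -F (1, 1)
        abel)

/-- The projection. -/
def proj : CocycleExt F hF →* G where
  toFun := fst
  map_one' := rfl
  map_mul' _ _ := rfl

/-- The inclusion of the central subgroup. -/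
def incl : Multiplicative A →* CocycleExt F hF where
  toFun a := ⟨1, a.toAdd - F (1, 1)⟩
  map_one' := by
    ext
    · rfl
    · simp
  map_mul' a b := by
    ext
    · simp
    · simp only [toAdd_mul, mul_snd]
      abel

theorem mul_incl (x : CocycleExt F hF) (a : Multiplicative A) :
    x * incl a = ⟨x.1, x.2 + a.toAdd⟩ := by
  ext
  · simp [incl]
  · simp only [incl, MonoidHom.coe_mk, OneHom.coe_mk, mul_snd, map_one_right hF]
    abel

theorem incl_central (x : CocycleExt F hF) (a : Multiplicative A) :
    x * incl a = incl a * x := by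
  rw [mul_incl]
  ext
  · simp [incl]
  · simp only [incl, MonoidHom.coe_mk, OneHom.coe_mk, mul_snd, map_one_left hF]
    abel

theorem incl_injective : Function.Injective (incl : Multiplicative A →* CocycleExt F hF) := by
  intro a b hab
  have := congrArg snd hab
  simpa [incl] using this

theorem exists_incl_of_proj_eq {x y : CocycleExt F hF} (h : proj x = proj y) :
    ∃ a, x = y * incl a := by
  refine ⟨Multiplicative.ofAdd (x.2 - y.2), ?_⟩
  rw [mul_incl]
  ext
  · exact h
  · simp

/-- Change of coefficients. -/
def mapCoeff {B : Type*} [AddCommGroup B] (φ : A →+ B) (hφ : IsTrivCocycle fun p => φ (F p)) :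
    CocycleExt F hF →* CocycleExt (fun p => φ (F p)) hφ where
  toFun x := ⟨x.1, φ x.2⟩
  map_one' := by
    ext
    · rfl
    · simp
  map_mul' x y := by
    ext
    · rfl
    · simp

end CocycleExt

theorem IsTrivCocycle.comp {F : G × G → A} (hF : IsTrivCocycle F) {B : Type*} [AddCommGroup B]
    (φ : A →+ B) : IsTrivCocycle fun p => φ (F p) := fun g h k => by
  rw [← map_sub, ← map_add, ← map_sub, hF, map_zero]

end CocycleExt

/-! ### Consistency equations for the tails of a central extension. -/

namespace PCData

/-- The sum of the values attached to a list of relations. -/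
def tailSum (t : ℕ → ℕ → ZMod 3) (T : List (ℕ × ℕ)) : ZMod 3 := (T.map fun p => t p.1 p.2).sum

/-- Rewriting of the first letters of a word by a relation. -/
def rewriteHead (R : PCData) : List ℕ → List ℕ × (ℕ × ℕ)
  | a :: b :: l =>
    bif Nat.blt b a then (b :: a :: R.cw a b ++ l, (a, b)) else (R.pw a ++ l.tail, (a, a))
  | _ => ([], (0, 0))

/-- The word starts with the left-hand side of a relation. -/
def headOk : List ℕ → Bool
  | a :: b :: c :: _ => Nat.blt b a || (Nat.beq a b && Nat.beq b c)
  | _ => false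

/-- The relations used in the two ways of collecting `w`. -/
def tailsLeft (R : PCData) (w : List ℕ) : List (ℕ × ℕ) := (R.collectTail w).2

def tailsRight (R : PCData) (w : List ℕ) : List (ℕ × ℕ) :=
  (R.rewriteHead w).2 :: (R.collectTail (R.rewriteHead w).1).2

/-- The word is an overlap for which the two ways of collecting it agree. -/
def overlapOk (R : PCData) (w : List ℕ) : Bool :=
  headOk w && (R.collect w == R.collect (R.rewriteHead w).1)

/-- The relations in the consistency equation given by `w`; recall that `-1 = 2` in `ZMod 3`. -/
def overlapTails (R : PCData) (w : List ℕ) : List (ℕ × ℕ) :=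
  R.tailsLeft w ++ (R.tailsRight w ++ R.tailsRight w)

/-- The coefficient of the tail of `r` in the consistency equation given by `w`. -/
def overlapCoeff (R : PCData) (w : List ℕ) (r : ℕ × ℕ) : ℕ := (R.overlapTails w).count r

/-- Only relations from `K` have a nonzero coefficient in the consistency equation given by `w`. -/
def overlapSupport (R : PCData) (w : List ℕ) (K : List (ℕ × ℕ)) : Bool :=
  (R.overlapTails w).all fun r => K.contains r || R.overlapCoeff w r % 3 == 0

/-- Checks that the consistency equations of the given words, one after the other, show that the
tails of the given relations vanish, if those of the relations in `K` do. -/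
def checkTriangular (R : PCData) : List (List ℕ × (ℕ × ℕ)) → List (ℕ × ℕ) → Bool
  | [], _ => true
  | (w, r) :: l, K => R.overlapOk w && R.overlapSupport w (r :: K) &&
      (R.overlapCoeff w r % 3 != 0) && R.checkTriangular l (r :: K)

section tails
variable {R : PCData} {E : Type*} [Group E] {g : ℕ → E} {ζ : Multiplicative (ZMod 3) →* E}
  {t : ℕ → ℕ → ZMod 3}

theorem evTail_eq (T : List (ℕ × ℕ)) :
    evTail (fun j i => ζ (Multiplicative.ofAdd (t j i))) T =
      ζ (Multiplicative.ofAdd (tailSum t T)) := by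
  induction T with
  | nil => simp [evTail, tailSum]
  | cons p T ih =>
    rw [evTail_cons, ih, ← map_mul, ← ofAdd_add]
    simp [tailSum]

/-- Collection of `w` works from the right, while `rewriteHead` starts from the left; on an overlap
these are the two competing reductions. Since they end in the same word, the central factors they
leave must agree, and injectivity of `ζ` turns this into a linear equation over `ℤ/3` for the tails.
-/
theorem tailSum_eq_of_overlapOk (hζ : Function.Injective ζ)
    (h : R.SatTail g fun j i => ζ (Multiplicative.ofAdd (t j i))) {w : List ℕ}
    (hw : R.overlapOk w = true) : tailSum t (R.tailsLeft w) = tailSum t (R.tailsRight w) := by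
  simp only [overlapOk, Bool.and_eq_true, beq_iff_eq] at hw
  obtain ⟨h1, h2⟩ := hw
  have key : ev g w = ev g (R.rewriteHead w).1 *
      ζ (Multiplicative.ofAdd (t (R.rewriteHead w).2.1 (R.rewriteHead w).2.2)) := by
    rcases w with _ | ⟨a, _ | ⟨b, _ | ⟨c, l⟩⟩⟩
    · simp [headOk] at h1
    · simp [headOk] at h1
    · simp [headOk] at h1
    · rcases hba : Nat.blt b a with _ | _
      · simp only [headOk, hba, Bool.false_or, Bool.and_eq_true] at h1
        obtain rfl := Nat.eq_of_beq_eq_true h1.1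
        obtain rfl := Nat.eq_of_beq_eq_true h1.2
        have e1 := h.pow a
        simp only [rewriteHead, hba, cond_false, List.tail_cons, ev_append, ev_cons]
        rw [mul_assoc (ev g (R.pw a)), h.central a a (ev g l), ← mul_assoc (ev g (R.pw a)), ← e1]
        simp only [pow_succ, pow_zero, one_mul, mul_assoc]
      · have hlt : b < a := by simpa [Nat.blt_eq] using hba
        have e1 := h.comm b a hlt
        simp only [rewriteHead, hba, cond_true, List.cons_append, ev_append, ev_cons]
        rw [← mul_assoc, e1]
        simp only [mul_assoc]
        congr 3
        rw [← mul_assoc (g c), h.central a b (g c * ev g l)]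
  have e1 := h.collect_eq w
  have e2 := h.collect_eq (R.rewriteHead w).1
  rw [key, e2, h2, evTail_eq, evTail_eq, mul_assoc, mul_right_inj, ← map_mul] at e1
  have := hζ e1
  rw [← ofAdd_add] at this
  have := Multiplicative.ofAdd.injective this
  rw [tailsLeft, ← this, tailsRight, add_comm]
  simp [tailSum]

theorem overlap_sum (hζ : Function.Injective ζ)
    (h : R.SatTail g fun j i => ζ (Multiplicative.ofAdd (t j i))) {w : List ℕ}
    (hw : R.overlapOk w = true) :
    ∑ r ∈ (R.overlapTails w).toFinset, R.overlapCoeff w r • t r.1 r.2 = 0 := by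
  have h1 := tailSum_eq_of_overlapOk hζ h hw
  have h3 : (3 : ZMod 3) = 0 := by decide
  have h2 := (Finset.sum_list_map_count (R.overlapTails w) fun r => t r.1 r.2).symm
  have h4 : ∑ r ∈ (R.overlapTails w).toFinset, R.overlapCoeff w r • t r.1 r.2 =
      ((R.overlapTails w).map fun r => t r.1 r.2).sum := by
    rw [← h2]
    refine Finset.sum_congr rfl fun r _ => ?_
    rw [overlapCoeff]
    congr!
  rw [h4]
  simp only [overlapTails, List.map_append, List.sum_append]
  simp only [tailSum] at h1
  rw [h1]
  linear_combination (List.map (fun r => t r.1 r.2) (R.tailsRight w)).sum * h3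

theorem term_eq_zero {w : List ℕ} {K : List (ℕ × ℕ)} (hK : ∀ p ∈ K, t p.1 p.2 = 0)
    {p : ℕ × ℕ} (hp : K.contains p = true ∨ R.overlapCoeff w p % 3 = 0) :
    R.overlapCoeff w p • t p.1 p.2 = 0 := by
  rcases hp with hp | hp
  · rw [hK p (by simpa using hp), smul_zero]
  · rw [nsmul_eq_mul, (ZMod.natCast_eq_zero_iff _ 3).2 (Nat.dvd_of_mod_eq_zero hp), zero_mul]

theorem overlap_equation₁ (hζ : Function.Injective ζ)
    (h : R.SatTail g fun j i => ζ (Multiplicative.ofAdd (t j i))) {w : List ℕ}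
    (hw : R.overlapOk w = true) {K : List (ℕ × ℕ)} (hK : ∀ p ∈ K, t p.1 p.2 = 0)
    {r : ℕ × ℕ} (hsupp : R.overlapSupport w (r :: K) = true) :
    R.overlapCoeff w r • t r.1 r.2 = 0 := by
  have h1 := overlap_sum hζ h hw
  rwa [Finset.sum_eq_single r] at h1
  · intro p hp hpr
    simp only [overlapSupport, List.all_eq_true] at hsupp
    have := hsupp p (List.mem_toFinset.1 hp)
    refine term_eq_zero hK ?_
    simpa [hpr] using this
  · intro hr
    rw [List.mem_toFinset] at hr
    rw [overlapCoeff, List.count_eq_zero_of_not_mem hr, zero_smul]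

theorem overlap_equation₂ (hζ : Function.Injective ζ)
    (h : R.SatTail g fun j i => ζ (Multiplicative.ofAdd (t j i))) {w : List ℕ}
    (hw : R.overlapOk w = true) {K : List (ℕ × ℕ)} (hK : ∀ p ∈ K, t p.1 p.2 = 0)
    {r s : ℕ × ℕ} (hrs : r ≠ s) (hsupp : R.overlapSupport w (r :: s :: K) = true) :
    R.overlapCoeff w r • t r.1 r.2 + R.overlapCoeff w s • t s.1 s.2 = 0 := by
  have h1 := overlap_sum hζ h hw
  have h0 : ∀ r, r ∉ (R.overlapTails w).toFinset → R.overlapCoeff w r • t r.1 r.2 = 0 := by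
    intro r hr
    rw [List.mem_toFinset] at hr
    rw [overlapCoeff, List.count_eq_zero_of_not_mem hr, zero_smul]
  rwa [Finset.sum_eq_add r s hrs _ (h0 r) (h0 s)] at h1
  intro p hp hpr
  simp only [overlapSupport, List.all_eq_true] at hsupp
  have := hsupp p (List.mem_toFinset.1 hp)
  refine term_eq_zero hK ?_
  simpa [hpr.1, hpr.2] using this

/-- Forward substitution: each equation contains one new tail, with a coefficient that is invertible
mod 3. -/
theorem tails_eq_zero (hζ : Function.Injective ζ)
    (h : R.SatTail g fun j i => ζ (Multiplicative.ofAdd (t j i)))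
    (l : List (List ℕ × (ℕ × ℕ))) (K : List (ℕ × ℕ)) (hK : ∀ p ∈ K, t p.1 p.2 = 0)
    (hl : R.checkTriangular l K = true) :
    ∀ p ∈ l.map Prod.snd ++ K, t p.1 p.2 = 0 := by
  induction l generalizing K with
  | nil => simpa using hK
  | cons q l ih =>
    obtain ⟨w, r⟩ := q
    simp only [checkTriangular, Bool.and_eq_true, bne_iff_ne] at hl
    obtain ⟨⟨⟨h1, h2⟩, h3⟩, h4⟩ := hl
    have hr : t r.1 r.2 = 0 := by
      have h5 := overlap_equation₁ hζ h h1 hK h2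
      rw [nsmul_eq_mul] at h5
      refine (mul_eq_zero.1 h5).resolve_left ?_
      rw [ZMod.natCast_eq_zero_iff]
      omega
    have := ih (r :: K) (by
      intro p hp
      rcases List.mem_cons.1 hp with rfl | hp
      · exact hr
      · exact hK p hp) h4
    intro p hp
    refine this p ?_
    simp only [List.map_cons, List.cons_append, List.mem_cons, List.mem_append] at hp ⊢
    tauto

end tails
end PCData

/-! ### Lifting of cocycles to `ℤ/9` for `Γ_e`. -/

/-- Every continuous `2`-cocycle with values in `ZMod 3` becomes a coboundary over `ZMod 9`. -/
def CocyclesLift (G : Type*) [Group G] [TopologicalSpace G] [IsTopologicalGroup G] : Prop :=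
  ∀ f ∈ contCocycles₂ 3 G, ∃ s : G → ZMod 9, Continuous s ∧
    ∀ g h : G, zmodEmb (f (g, h)) = s g + s h - s (g * h)

namespace PCData

/-- Multiplication of the generators by central elements. -/
theorem SatTail.twist {R : PCData} {E : Type*} [Group E] {g : ℕ → E} {τ : ℕ → ℕ → E}
    (h : R.SatTail g τ) (hp : ∀ i, ∀ k ∈ R.pw i, 2 ≤ k) (hc : ∀ j i, ∀ k ∈ R.cw j i, 2 ≤ k)
    {c : ℕ → E} (hcc : ∀ i x, x * c i = c i * x) (hc1 : ∀ i, 2 ≤ i → c i = 1) :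
    R.SatTail (fun i => g i * c i) fun j i => if j = i then τ i i * c i ^ 3 else τ j i := by
  -- The right-hand sides of the relations only contain letters from 2 on, and those generators are
  -- left unchanged.
  have hev : ∀ w : List ℕ, (∀ k ∈ w, 2 ≤ k) → ev (fun i => g i * c i) w = ev g w := fun w hw =>
    ev_congr fun i hi => by rw [hc1 i (hw i hi), mul_one]
  have hcom : ∀ i x, Commute x (c i) := hcc
  constructor
  · intro i
    rw [hev _ (hp i), if_pos rfl, (hcom i _).mul_pow, h.pow, mul_assoc]
  · intro i j hij
    rw [hev _ (hc j i), if_neg (by omega)]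
    have hl : g j * c j * (g i * c i) = (g j * g i) * (c i * c j) := by
      rw [mul_assoc, ← mul_assoc (c j), ← hcc j, mul_assoc (g i), ← hcc i (c j), mul_assoc]
    have hr : g i * c i * (g j * c j) = (g i * g j) * (c i * c j) := by
      rw [mul_assoc, ← mul_assoc (c i), ← hcc i, mul_assoc (g j), mul_assoc]
    have hz : ∀ x, x * (c i * c j) = (c i * c j) * x := fun x => by
      rw [← mul_assoc, hcc i, mul_assoc, hcc j, mul_assoc]
    rw [hl, hr, h.comm i j hij, mul_assoc _ (c i * c j), ← hz, mul_assoc (g i * g j * _),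
      ← h.central, ← mul_assoc, ← mul_assoc]
    simp only [mul_assoc]
  · intro j i x
    split_ifs
    · rw [← mul_assoc, h.central, mul_assoc, ((hcom i x).pow_right 3).eq, mul_assoc]
    · exact h.central j i x

end PCData

theorem two_le_of_mem_pw {a b c d i k : ℕ} (h : k ∈ (pcData a b c d).pw i) : 2 ≤ k := by
  rcases i with _ | _ | _ | _ | _ | i <;> simp [pcData] at h <;> rcases h with h | h <;> omega

theorem two_le_of_mem_cw {a b c d i j k : ℕ} (h : k ∈ (pcData a b c d).cw j i) : 2 ≤ k := by
  rcases lt_or_ge j 6 with hj | hj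
  · rcases lt_or_ge i 3 with hi | hi
    · interval_cases j <;> interval_cases i <;> simp [pcData] at h <;> omega
    · obtain ⟨m, rfl⟩ := Nat.exists_eq_add_of_le' hi
      interval_cases j <;> simp [pcData] at h
  · obtain ⟨m, rfl⟩ := Nat.exists_eq_add_of_le' hj
    simp [pcData] at h

/-- The eight elements defined from the first two by the defining commutators. -/
def buildGens {E : Type*} [Group E] (x y : E) : ℕ → E :=
  let k (a b : E) := a⁻¹ * b⁻¹ * a * b
  fun i => match i with
    | 0 => x
    | 1 => y
    | 2 => k y x
    | 3 => k (k y x) x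
    | 4 => k (k y x) y
    | 5 => k (k (k y x) y) y
    | 6 => k (k (k y x) y) x
    | 7 => k (k (k (k y x) y) y) y
    | _ => 1

/-- From the third one on, every generator is a commutator of earlier ones, so all are determined by
the first two. -/
theorem PCData.Sat.buildGens_eq {a b c d : ℕ} {E : Type*} [Group E] {h : ℕ → E}
    (H : (pcData a b c d).Sat h) (h8 : ∀ i, 8 ≤ i → h i = 1) :
    buildGens (h 0) (h 1) = h := by
  have key : ∀ {i j k : ℕ}, i < j → (pcData a b c d).cw j i = [k] →
      (h j)⁻¹ * (h i)⁻¹ * h j * h i = h k := fun {i j k} hij hk => by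
    rw [mul_assoc, H.comm i j hij, hk]
    simp [mul_assoc]
  have e2 := key (i := 0) (j := 1) (by norm_num) rfl
  have e3 := key (i := 0) (j := 2) (by norm_num) rfl
  have e4 := key (i := 1) (j := 2) (by norm_num) rfl
  have e5 := key (i := 1) (j := 4) (by norm_num) rfl
  have e6 := key (i := 0) (j := 4) (by norm_num) rfl
  have e7 := key (i := 1) (j := 5) (by norm_num) rfl
  funext i
  rcases i with _ | _ | _ | _ | _ | _ | _ | _ | i
  · rfl
  · rfl
  · exact e2
  · simp only [buildGens, e2, e3]
  · simp only [buildGens, e2, e4]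
  · simp only [buildGens, e2, e4, e5]
  · simp only [buildGens, e2, e4, e6]
  · simp only [buildGens, e2, e4, e5, e7]
  · exact (h8 _ (by omega)).symm

theorem map_buildGens {E F : Type*} [Group E] [Group F] (φ : E →* F) (x y : E) (i : ℕ) :
    φ (buildGens x y i) = buildGens (φ x) (φ y) i := by
  rcases i with _ | _ | _ | _ | _ | _ | _ | _ | i <;> simp [buildGens]

namespace PCGroup

/-- Overlaps whose consistency equations determine one tail after the other. -/
def overlaps (e : ℕ) : List (List ℕ × (ℕ × ℕ)) :=
  [([3, 3, 3, 3], (6, 3)), ([4, 4, 4, 4], (7, 4)), ([3, 1, 1, 1], (7, 3)), ([3, 1, 0], (3, 2)),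
    ([3, 2, 1], (4, 3)), ([4, 3, 1], (5, 3)), ([5, 4, 2], (6, 5)), ([6, 1, 0], (6, 2)),
    ([6, 2, 1], (6, 4)), ([6, 5, 1], (7, 6)), ([7, 1, 0], (7, 2)), ([2, 2, 2, 2], (5, 2)),
    ([7, 4, 1], (7, 5)), ([3, 3, 3, 0], (6, 0)), ([3, 3, 3, 1], (6, 1)), ([5, 2, 1], (5, 4)),
    ([5, 5, 5, 0], (6, 6)), ([5, 5, 5, 1], (7, 7)), ([4, 4, 4, 0], (7, 0)),
    ([0, 0, 0, 0], (5, 0)), ([4, 1, 0], (4, 2)), ([2, 1, 0], (3, 1)), ([1, 1, 1, 1], (7, 1)),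
    ([4, 4, 4, 1], (5, 5)), ([2, 1, 1, 1], (4, 4)),
    (if e = 0 then [2, 0, 0, 0] else [2, 2, 2, 0], (3, 3))]

/-- The relations which define the generators. -/
def definingRels : List (ℕ × ℕ) := [(1, 0), (2, 0), (2, 1), (4, 1), (4, 0), (5, 1)]

theorem check_overlaps {e : ℕ} (he : e = 0 ∨ e = 2) :
    (pcData 0 e 0 0).checkTriangular (overlaps e) definingRels = true := by
  rcases he with rfl | rfl <;> decide +kernel

/-- In a central extension of `Γ_e` by `ℤ/3`, all relations of `Γ_e` lift, except for the first
two power relations. -/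
theorem tail_eq_zero {e : ℕ} (he : e = 0 ∨ e = 2) {E : Type*} [Group E] {g : ℕ → E}
    {ζ : Multiplicative (ZMod 3) →* E} {t : ℕ → ℕ → ZMod 3} (hζ : Function.Injective ζ)
    (h : (pcData 0 e 0 0).SatTail g fun j i => ζ (Multiplicative.ofAdd (t j i)))
    (hdef : ∀ p ∈ definingRels, t p.1 p.2 = 0) :
    ∀ j i, i ≤ j → j < 8 → (j, i) ≠ (0, 0) → (j, i) ≠ (1, 1) → t j i = 0 := by
  have h1 := tails_eq_zero hζ h _ _ hdef (check_overlaps he)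
  -- The tails of `(2, 2)` and `(3, 0)` are not reached by the triangular system. They satisfy `u +
  -- 2v = 0` and `2u + 2v = 0`, a system of determinant 1 mod 3.
  have e1 := overlap_equation₂ hζ h (w := [1, 1, 1, 0]) (r := (2, 2)) (s := (3, 0))
    (by rcases he with rfl | rfl <;> decide +kernel) h1 (by decide)
    (by rcases he with rfl | rfl <;> decide +kernel)
  have e2 := overlap_equation₂ hζ h (w := [1, 0, 0, 0]) (r := (2, 2)) (s := (3, 0))
    (by rcases he with rfl | rfl <;> decide +kernel) h1 (by decide)
    (by rcases he with rfl | rfl <;> decide +kernel)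
  have c1 : ((pcData 0 e 0 0).overlapCoeff [1, 1, 1, 0] (2, 2) % 3 = 1 ∧
      (pcData 0 e 0 0).overlapCoeff [1, 1, 1, 0] (3, 0) % 3 = 2) ∧
      (pcData 0 e 0 0).overlapCoeff [1, 0, 0, 0] (2, 2) % 3 = 2 ∧
      (pcData 0 e 0 0).overlapCoeff [1, 0, 0, 0] (3, 0) % 3 = 2 := by
    rcases he with rfl | rfl <;> decide +kernel
  have hc : ∀ {n m : ℕ} (x : ZMod 3), n % 3 = m → n • x = (m : ZMod 3) * x := by
    rintro n m x rfl
    rw [nsmul_eq_mul, ZMod.natCast_mod]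
  rw [hc _ c1.1.1, hc _ c1.1.2] at e1
  rw [hc _ c1.2.1, hc _ c1.2.2] at e2
  have z : t 2 2 = 0 ∧ t 3 0 = 0 := by
    generalize t 2 2 = u at *
    generalize t 3 0 = v at *
    revert u v
    decide
  intro j i hij hj h00 h11
  have hmem : (j, i) = (2, 2) ∨ (j, i) = (3, 0) ∨
      (j, i) ∈ (overlaps e).map Prod.snd ++ definingRels := by
    revert h00 h11
    interval_cases j <;> interval_cases i <;> simp [overlaps, definingRels]
  rcases hmem with hm | hm | hm
  · obtain ⟨rfl, rfl⟩ := Prod.mk.inj hm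
    exact z.1
  · obtain ⟨rfl, rfl⟩ := Prod.mk.inj hm
    exact z.2
  · exact h1 _ hm

theorem hom_ext {e : ℕ} {E : Type*} [Group E] {φ ψ : PCGroup e →* E}
    (h : ∀ i, φ (gen e i) = ψ (gen e i)) : φ = ψ := by
  refine MonoidHom.eq_of_eqOn_dense (closure_gen e) ?_
  rintro _ ⟨i, rfl⟩
  exact h i

end PCGroup

theorem CocycleExt.mapCoeff_incl {G A : Type*} [Group G] [AddCommGroup A] {F : G × G → A}
    {hF : IsTrivCocycle F} {B : Type*} [AddCommGroup B] (φ : A →+ B)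
    (hφ : IsTrivCocycle fun p => φ (F p)) (a : A) :
    mapCoeff (hF := hF) φ hφ (incl (Multiplicative.ofAdd a)) =
      incl (Multiplicative.ofAdd (φ a)) := by
  ext
  · rfl
  · simp [mapCoeff, incl]

namespace PCGroup

theorem buildGens_gen (e : ℕ) : buildGens (gen e 0) (gen e 1) = gen e :=
  (sat_gen e).buildGens_eq fun _ => gen_of_le e

theorem buildGens_comm {E : Type*} [Group E] (a b c d : ℕ) (x y : E) {j i : ℕ}
    (h : (j, i) ∈ definingRels) :
    buildGens x y j * buildGens x y i =
      buildGens x y i * buildGens x y j * ev (buildGens x y) ((pcData a b c d).cw j i) := by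
  simp only [definingRels, List.mem_cons, Prod.mk.injEq, List.not_mem_nil, or_false] at h
  rcases h with ⟨rfl, rfl⟩ | ⟨rfl, rfl⟩ | ⟨rfl, rfl⟩ | ⟨rfl, rfl⟩ | ⟨rfl, rfl⟩ | ⟨rfl, rfl⟩ <;>
    simp [pcData, buildGens, mul_assoc]

theorem buildGens_of_le {E : Type*} [Group E] (x y : E) {i : ℕ} (hi : 8 ≤ i) :
    buildGens x y i = 1 := by
  obtain ⟨k, rfl⟩ := Nat.exists_eq_add_of_le' hi
  rfl

/-- In the extension defined by a cocycle, lift the first two generators and define the others as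
commutators. By `tail_eq_zero` only the first two power relations can fail. After extending the
kernel to `ℤ/9` the generators can be corrected, which splits the extension; the second coordinate
of a splitting is the required cochain up to sign. -/
theorem cocyclesLift {e : ℕ} (he : e = 0 ∨ e = 2) : CocyclesLift (PCGroup e) := by
  rintro f ⟨-, hf⟩
  replace hf : IsTrivCocycle f := hf
  let E := CocycleExt f hf
  have hfW : IsTrivCocycle fun p => zmodEmb (f p) := hf.comp zmodEmb
  let W := CocycleExt _ hfW
  let h : ℕ → E := buildGens ⟨gen e 0, 0⟩ ⟨gen e 1, 0⟩
  have hproj : ∀ i, CocycleExt.proj (h i) = gen e i := fun i => by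
    rw [map_buildGens]
    exact congrFun (buildGens_gen e) i
  have hex : ∀ j i, ∃ a : ZMod 3,
      (i = j → h i ^ 3 = ev h ((pcData 0 e 0 0).pw i) *
        CocycleExt.incl (Multiplicative.ofAdd a)) ∧
      (i < j → h j * h i = h i * h j * ev h ((pcData 0 e 0 0).cw j i) *
        CocycleExt.incl (Multiplicative.ofAdd a)) := by
    intro j i
    rcases eq_or_ne i j with rfl | hij
    · obtain ⟨a, ha⟩ := CocycleExt.exists_incl_of_proj_eq (x := h i ^ 3)
        (y := ev h ((pcData 0 e 0 0).pw i)) (by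
          rw [map_pow, map_ev, hproj]
          simp only [hproj]
          exact (sat_gen e).pow i)
      exact ⟨a.toAdd, fun _ => ha, fun h => absurd h (lt_irrefl _)⟩
    · by_cases hlt : i < j
      · obtain ⟨a, ha⟩ := CocycleExt.exists_incl_of_proj_eq (x := h j * h i)
          (y := h i * h j * ev h ((pcData 0 e 0 0).cw j i)) (by
            simp only [map_mul, map_ev, hproj]
            exact (sat_gen e).comm i j hlt)
        exact ⟨a.toAdd, fun h => absurd h hij, fun _ => ha⟩
      · exact ⟨0, fun h => absurd h hij, fun h => absurd h hlt⟩
  choose t ht1 ht2 using hex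
  have hsat : (pcData 0 e 0 0).SatTail h
      fun j i => CocycleExt.incl (Multiplicative.ofAdd (t j i)) :=
    ⟨fun i => ht1 i i rfl, fun i j => ht2 j i, fun j i x => CocycleExt.incl_central x _⟩
  have hinj := CocycleExt.incl_injective (F := f) (hF := hf)
  -- The relations that define the later generators hold in the extension by construction, so their
  -- tails vanish.
  have hdef : ∀ p ∈ definingRels, t p.1 p.2 = 0 := by
    rintro ⟨j, i⟩ hp
    have hlt : i < j := by
      simp only [definingRels, List.mem_cons, Prod.mk.injEq, List.not_mem_nil, or_false] at hp
      omega
    have := ht2 j i hlt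
    rw [← buildGens_comm 0 e 0 0 _ _ hp, left_eq_mul] at this
    exact Multiplicative.ofAdd.injective (hinj (this.trans (map_one _).symm))
  have hz := tail_eq_zero he hinj hsat hdef
  have hz' : ∀ j i, i < j → t j i = 0 := by
    intro j i hij
    by_cases hj : j < 8
    · exact hz j i hij.le hj (by simp; omega) (by simp; omega)
    · have := ht2 j i hij
      rw [(pcData_bounded 0 e 0 0).cw j i (not_lt.1 hj),
        show h j = 1 from buildGens_of_le _ _ (not_lt.1 hj)] at this
      simp only [one_mul, mul_one, ev_nil, left_eq_mul] at this
      exact Multiplicative.ofAdd.injective (hinj (this.trans (map_one _).symm))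
  have hz2 : ∀ i, 2 ≤ i → t i i = 0 := by
    intro i hi
    by_cases hi8 : i < 8
    · exact hz i i le_rfl hi8 (by simp; omega) (by simp; omega)
    · have := ht1 i i rfl
      rw [(pcData_bounded 0 e 0 0).pw i (not_lt.1 hi8),
        show h i = 1 from buildGens_of_le _ _ (not_lt.1 hi8)] at this
      simp only [one_pow, one_mul, ev_nil] at this
      exact Multiplicative.ofAdd.injective (hinj (this.symm.trans (map_one _).symm))
  let m : E →* W := CocycleExt.mapCoeff zmodEmb hfW
  have hsatW : (pcData 0 e 0 0).SatTail (fun i => m (h i))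
      fun j i => CocycleExt.incl (Multiplicative.ofAdd (zmodEmb (t j i))) :=
    ⟨fun i => by rw [← map_pow, ht1 i i rfl, map_mul, map_ev, CocycleExt.mapCoeff_incl],
      fun i j hij => by
        rw [← map_mul, ht2 j i hij, map_mul, map_mul, map_mul, map_ev, CocycleExt.mapCoeff_incl],
      fun j i x => CocycleExt.incl_central x _⟩
  -- Elements of the image of `ℤ/3` in `ℤ/9` are multiples of 3, so a central factor with prescribed
  -- cube exists in the enlarged extension.
  choose u hu using zmodEmb_eq
  let c : ℕ → W := fun i =>
    CocycleExt.incl (Multiplicative.ofAdd (if i < 2 then u (-t i i) else 0))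
  have hc3 : ∀ i, c i ^ 3 = CocycleExt.incl (Multiplicative.ofAdd (-zmodEmb (t i i))) := by
    intro i
    rw [← map_pow, ← ofAdd_nsmul]
    congr 2
    split_ifs with hi
    · rw [hu, map_neg]
    · rw [hz2 i (not_lt.1 hi), map_zero, neg_zero, smul_zero]
  have htw := hsatW.twist (c := c) (fun i k hk => two_le_of_mem_pw hk)
    (fun j i k hk => two_le_of_mem_cw hk) (fun i x => CocycleExt.incl_central x _)
    (fun i hi => by simp only [c, if_neg (not_lt.2 hi), ofAdd_zero, map_one])
  have hsat' : (pcData 0 e 0 0).Sat fun i => m (h i) * c i := by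
    constructor
    · intro i
      rw [htw.pow i, if_pos rfl, hc3, ← map_mul, ← ofAdd_add, add_neg_cancel, ofAdd_zero, map_one,
        mul_one]
    · intro i j hij
      rw [htw.comm i j hij, if_neg hij.ne', hz' j i hij, map_zero, ofAdd_zero, map_one, mul_one]
  have h8 : ∀ i, 8 ≤ i → m (h i) * c i = 1 := by
    intro i hi
    rw [show h i = 1 from buildGens_of_le _ _ hi]
    simp only [c, if_neg (show ¬ i < 2 by omega), ofAdd_zero, map_one, mul_one]
  let φ : PCGroup e →* W := lift h8 hsat'
  have hφ : ∀ g, (φ g).1 = g := by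
    have : (CocycleExt.proj.comp φ : PCGroup e →* PCGroup e) = MonoidHom.id _ := by
      refine hom_ext fun i => ?_
      rw [MonoidHom.comp_apply, lift_gen, map_mul]
      exact (congrArg (· * (1 : PCGroup e)) (hproj i)).trans (mul_one _)
    exact fun g => DFunLike.congr_fun this g
  -- A splitting adds the cocycle to the sum of second coordinates, hence the sign.
  refine ⟨fun g => -(φ g).2, continuous_of_discreteTopology, fun g k => ?_⟩
  have := congrArg CocycleExt.snd (map_mul φ g k)
  rw [CocycleExt.mul_snd, hφ, hφ] at this
  dsimp only
  rw [this]
  abel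

end PCGroup

/-! ### Frames, Bocksteins and the relation rank. -/

/-- A pair of elements and of continuous homomorphisms to `ℤ/3` dual to each other, which exhibit
the topological abelianization as an elementary abelian group of rank two. -/
structure Frame (G : Type*) [Group G] [TopologicalSpace G] [IsTopologicalGroup G] where
  x : G
  y : G
  χ : G → ZMod 3
  ψ : G → ZMod 3
  χ_mul : ∀ g h, χ (g * h) = χ g + χ h
  ψ_mul : ∀ g h, ψ (g * h) = ψ g + ψ h
  χ_cont : Continuous χ
  ψ_cont : Continuous ψ
  χ_x : χ x = 1
  χ_y : χ y = 0
  ψ_x : ψ x = 0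
  ψ_y : ψ y = 1
  mem_closure : ∀ g, χ g = 0 → ψ g = 0 → g ∈ (commutator G).topologicalClosure

/-- A function to an additive group, additive as a homomorphism. -/
def addHomOf {G A : Type*} [Group G] [AddGroup A] (s : G → A)
    (hs : ∀ g h, s (g * h) = s g + s h) : G →* Multiplicative A where
  toFun g := Multiplicative.ofAdd (s g)
  map_one' := by
    have := hs 1 1
    rw [mul_one, left_eq_add] at this
    rw [this, ofAdd_zero]
  map_mul' g h := by rw [hs, ofAdd_add]

section addHomOf
variable {G A : Type*} [Group G] [AddCommGroup A] {s : G → A}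

theorem addHom_one (hs : ∀ g h, s (g * h) = s g + s h) : s 1 = 0 :=
  congrArg Multiplicative.toAdd (map_one (addHomOf s hs))

theorem addHom_inv (hs : ∀ g h, s (g * h) = s g + s h) (g : G) : s g⁻¹ = -s g :=
  congrArg Multiplicative.toAdd (map_inv (addHomOf s hs) g)

theorem addHom_pow (hs : ∀ g h, s (g * h) = s g + s h) (g : G) (n : ℕ) : s (g ^ n) = n • s g :=
  congrArg Multiplicative.toAdd (map_pow (addHomOf s hs) g n)

theorem addHom_closure [TopologicalSpace G] [IsTopologicalGroup G] [TopologicalSpace A]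
    [DiscreteTopology A] (hs : ∀ g h, s (g * h) = s g + s h) (hc : Continuous s) {g : G}
    (hg : g ∈ (commutator G).topologicalClosure) : s g = 0 := by
  have hcl : IsClosed ((addHomOf s hs).ker : Set G) := by
    have : ((addHomOf s hs).ker : Set G) = s ⁻¹' {0} := by
      ext g
      exact Multiplicative.ofAdd.injective.eq_iff' ofAdd_zero
    rw [this]
    exact (isClosed_discrete _).preimage hc
  have := Subgroup.topologicalClosure_minimal _
    (Abelianization.commutator_subset_ker (addHomOf s hs)) hcl hg
  exact Multiplicative.ofAdd.injective this

end addHomOf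

namespace Frame
variable {G : Type*} [Group G] [TopologicalSpace G] [IsTopologicalGroup G] (F : Frame G)

theorem χ_one : F.χ 1 = 0 := addHom_one F.χ_mul
theorem ψ_one : F.ψ 1 = 0 := addHom_one F.ψ_mul
theorem χ_inv (g : G) : F.χ g⁻¹ = -F.χ g := addHom_inv F.χ_mul g
theorem ψ_inv (g : G) : F.ψ g⁻¹ = -F.ψ g := addHom_inv F.ψ_mul g
theorem χ_pow (g : G) (n : ℕ) : F.χ (g ^ n) = n * F.χ g := by
  rw [addHom_pow F.χ_mul, nsmul_eq_mul]
theorem ψ_pow (g : G) (n : ℕ) : F.ψ (g ^ n) = n * F.ψ g := by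
  rw [addHom_pow F.ψ_mul, nsmul_eq_mul]

theorem mem_closure_iff (g : G) :
    g ∈ (commutator G).topologicalClosure ↔ F.χ g = 0 ∧ F.ψ g = 0 :=
  ⟨fun h => ⟨addHom_closure F.χ_mul F.χ_cont h, addHom_closure F.ψ_mul F.ψ_cont h⟩,
    fun h => F.mem_closure g h.1 h.2⟩

theorem pow_three_mem (F : Frame G) (g : G) : g ^ 3 ∈ (commutator G).topologicalClosure := by
  have h3 : ((3 : ℕ) : ZMod 3) = 0 := rfl
  exact F.mem_closure _ (by rw [χ_pow, h3, zero_mul]) (by rw [ψ_pow, h3, zero_mul])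

/-- The element with given coordinates. -/
def pt (a b : ZMod 3) : G := F.x ^ a.val * F.y ^ b.val

@[simp] theorem χ_pt (a b : ZMod 3) : F.χ (F.pt a b) = a := by
  simp [pt, F.χ_mul, χ_pow, F.χ_x, F.χ_y]

@[simp] theorem ψ_pt (a b : ZMod 3) : F.ψ (F.pt a b) = b := by
  simp [pt, F.ψ_mul, ψ_pow, F.ψ_x, F.ψ_y]

theorem pt_inv_mul_mem (g : G) :
    (F.pt (F.χ g) (F.ψ g))⁻¹ * g ∈ (commutator G).topologicalClosure :=
  F.mem_closure _ (by simp [F.χ_mul, χ_inv]) (by simp [F.ψ_mul, ψ_inv])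

/-- Additive functions which vanish on the closure of the commutator subgroup are determined by
their values at the two elements of the frame. -/
theorem eq_add {A : Type*} [AddCommGroup A] [TopologicalSpace A] [DiscreteTopology A] {s : G → A}
    (hs : ∀ g h, s (g * h) = s g + s h) (hc : Continuous s) (g : G) :
    s g = (F.χ g).val • s F.x + (F.ψ g).val • s F.y := by
  have h1 := addHom_closure hs hc (F.pt_inv_mul_mem g)
  rw [hs, addHom_inv hs, neg_add_eq_zero] at h1
  rw [← h1, pt, hs, addHom_pow hs, addHom_pow hs]

end Frame

/-- The carry of the addition in `ZMod 9`, a `2`-cocycle of `ZMod 3`. -/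
def carry (a b : ZMod 3) : ZMod 3 := if a.val + b.val < 3 then 0 else 1

/-- The lift of an element of `ZMod 3` to `ZMod 9`. -/
def zmodLift (a : ZMod 3) : ZMod 9 := (a.val : ZMod 9)

theorem zmodEmb_carry : ∀ a b : ZMod 3,
    zmodEmb (carry a b) = zmodLift a + zmodLift b - zmodLift (a + b) := by decide +kernel

theorem carry_cocycle : ∀ a b c : ZMod 3,
    carry b c - carry (a + b) c + carry a (b + c) - carry a b = 0 := by decide +kernel

theorem zmodEmb_mul : ∀ a b : ZMod 3, zmodEmb (a * b) = zmodLift a * zmodEmb b := by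
  decide +kernel

theorem three_mul_zmodEmb : ∀ a : ZMod 3, 3 * zmodEmb a = 0 := by decide +kernel

theorem three_mul_zmodLift : ∀ a : ZMod 3, 3 * zmodLift a = zmodEmb a := by decide +kernel

/-- Reduction from `ZMod 9` to `ZMod 3`. -/
def zmodRed : ZMod 9 →+* ZMod 3 := ZMod.castHom (by norm_num) (ZMod 3)

theorem zmodRed_zmodEmb : ∀ a : ZMod 3, zmodRed (zmodEmb a) = 0 := by decide +kernel

theorem zmodRed_zmodLift : ∀ a : ZMod 3, zmodRed (zmodLift a) = a := by decide +kernel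

theorem exists_zmodEmb_eq : ∀ u : ZMod 9, ∃ a : ZMod 3, zmodRed u = 0 → u = zmodEmb a := by
  decide +kernel

section bockstein
variable {G : Type*} [Group G] [TopologicalSpace G] [IsTopologicalGroup G]

/-- The Bockstein of a homomorphism to `ZMod 3`. -/
def bockstein (χ : G → ZMod 3) (hχ : ∀ g h, χ (g * h) = χ g + χ h) (hc : Continuous χ) :
    contCocycles₂ 3 G :=
  ⟨fun p => carry (χ p.1) (χ p.2),
    (continuous_of_discreteTopology (f := fun q : ZMod 3 × ZMod 3 => carry q.1 q.2)).comp
      ((hc.comp continuous_fst).prodMk (hc.comp continuous_snd)),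
    fun g h k => by
      simp only [hχ]
      exact carry_cocycle _ _ _⟩

variable (F : Frame G)

/-- The classes of the Bocksteins of the two homomorphisms of a frame. -/
def Frame.bocksteinClass : Fin 2 → ContH2 3 G :=
  ![Submodule.Quotient.mk (bockstein F.χ F.χ_mul F.χ_cont),
    Submodule.Quotient.mk (bockstein F.ψ F.ψ_mul F.ψ_cont)]

/-- A `ZMod 9`-valued cochain whose coboundary is a combination of the Bocksteins. -/
def Frame.cochain (a b : ZMod 3) (g : G) : ZMod 9 :=
  zmodLift a * zmodLift (F.χ g) + zmodLift b * zmodLift (F.ψ g)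

theorem Frame.cochain_cont (a b : ZMod 3) : Continuous (F.cochain a b) :=
  (continuous_of_discreteTopology (f := fun q : ZMod 3 × ZMod 3 =>
    zmodLift a * zmodLift q.1 + zmodLift b * zmodLift q.2)).comp (F.χ_cont.prodMk F.ψ_cont)

theorem Frame.zmodEmb_bockstein (a b : ZMod 3) (g h : G) :
    zmodEmb ((a • bockstein F.χ F.χ_mul F.χ_cont + b • bockstein F.ψ F.ψ_mul F.ψ_cont :
      contCocycles₂ 3 G).1 (g, h)) =
      F.cochain a b g + F.cochain a b h - F.cochain a b (g * h) := by
  change zmodEmb (a * carry (F.χ g) (F.χ h) + b * carry (F.ψ g) (F.ψ h)) = _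
  rw [map_add, zmodEmb_mul, zmodEmb_mul, zmodEmb_carry, zmodEmb_carry, cochain, cochain, cochain,
    F.χ_mul, F.ψ_mul]
  ring

/-- If a combination of the Bocksteins is the coboundary of `φ`, then its `ℤ/9`-valued cochain minus
`φ` is a homomorphism to `ℤ/9`. Cubes lie in the closed commutator subgroup, so three times this
homomorphism vanishes, and evaluation at `x` and `y` gives the coefficients. -/
theorem Frame.linearIndependent_bocksteinClass :
    LinearIndependent (ZMod 3) F.bocksteinClass := by
  rw [bocksteinClass, LinearIndependent.pair_iff]
  intro a b hab
  have hab' : (a • bockstein F.χ F.χ_mul F.χ_cont + b • bockstein F.ψ F.ψ_mul F.ψ_cont :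
      contCocycles₂ 3 G) ∈ (contCoboundaries₂ 3 G).submoduleOf (contCocycles₂ 3 G) := by
    rw [← Submodule.Quotient.mk_eq_zero]
    simpa [bocksteinClass] using hab
  obtain ⟨φ, hφ, h⟩ := hab'
  let s : G → ZMod 9 := fun g => F.cochain a b g - zmodEmb (φ g)
  have hs : ∀ g h, s (g * h) = s g + s h := by
    intro g k
    have h1 := F.zmodEmb_bockstein a b g k
    have h2 : zmodEmb ((a • bockstein F.χ F.χ_mul F.χ_cont +
        b • bockstein F.ψ F.ψ_mul F.ψ_cont : contCocycles₂ 3 G).1 (g, k)) =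
        zmodEmb (φ k - φ (g * k) + φ g) := congrArg zmodEmb (h g k)
    rw [map_add zmodEmb, map_sub] at h2
    simp only [s]
    linear_combination h1 - h2
  have hsc : Continuous s :=
    (F.cochain_cont a b).sub ((continuous_of_discreteTopology (f := zmodEmb)).comp hφ)
  have key : ∀ g, 3 * F.cochain a b g = 0 := by
    intro g
    have h1 := addHom_closure hs hsc (F.pow_three_mem g)
    rw [addHom_pow hs, nsmul_eq_mul] at h1
    have h2 := three_mul_zmodEmb (φ g)
    simp only [s] at h1
    push_cast at h1
    linear_combination h1 + h2
  have l0 : zmodLift 0 = 0 := by decide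
  have l1 : zmodLift 1 = 1 := by decide
  have hx := key F.x
  have hy := key F.y
  rw [cochain, F.χ_x, F.ψ_x, l0, l1, mul_zero, add_zero, mul_one, three_mul_zmodLift] at hx
  rw [cochain, F.χ_y, F.ψ_y, l0, l1, mul_zero, zero_add, mul_one, three_mul_zmodLift] at hy
  exact ⟨zmodEmb_injective (hx.trans (map_zero _).symm),
    zmodEmb_injective (hy.trans (map_zero _).symm)⟩

/-- This is exactness of `H¹(ℤ/3) → H²(ℤ/3) → H²(ℤ/9)` at the middle term, on the level of cochains.
-/
theorem Frame.span_bocksteinClass_iff :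
    ⊤ ≤ Submodule.span (ZMod 3) (Set.range F.bocksteinClass) ↔ CocyclesLift G := by
  have hcl : ∀ u : ContH2 3 G, u ∈ Submodule.span (ZMod 3) (Set.range F.bocksteinClass) ↔
      ∃ a b : ZMod 3, Submodule.Quotient.mk (a • bockstein F.χ F.χ_mul F.χ_cont +
        b • bockstein F.ψ F.ψ_mul F.ψ_cont) = u := by
    intro u
    simp only [bocksteinClass, Matrix.range_cons, Matrix.range_empty, Set.union_empty,
      Set.singleton_union]
    rw [Submodule.mem_span_pair]
    rfl
  constructor
  · intro h f hf
    obtain ⟨a, b, hab⟩ := (hcl (Submodule.Quotient.mk ⟨f, hf⟩)).1 (h trivial)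
    obtain ⟨φ, hφ, hfφ⟩ := (Submodule.Quotient.eq _).1 hab
    refine ⟨fun g => F.cochain a b g - zmodEmb (φ g), (F.cochain_cont a b).sub
      ((continuous_of_discreteTopology (f := zmodEmb)).comp hφ), fun g k => ?_⟩
    have h1 := F.zmodEmb_bockstein a b g k
    have h2 : zmodEmb ((a • bockstein F.χ F.χ_mul F.χ_cont +
        b • bockstein F.ψ F.ψ_mul F.ψ_cont : contCocycles₂ 3 G).1 (g, k) - f (g, k)) =
        zmodEmb (φ k - φ (g * k) + φ g) := congrArg zmodEmb (hfφ g k)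
    rw [map_sub, map_add zmodEmb, map_sub] at h2
    linear_combination h1 - h2
  · intro h u _
    obtain ⟨⟨f, hf⟩, rfl⟩ := Submodule.Quotient.mk_surjective _ u
    obtain ⟨s, hs, hfs⟩ := h f hf
    -- The coboundary of `s` has values in the image of `ℤ/3`, so `s` mod 3 is a homomorphism, and
    -- `f` is its Bockstein up to a coboundary.
    let t : G → ZMod 3 := fun g => zmodRed (s g)
    have ht : ∀ g h, t (g * h) = t g + t h := by
      intro g k
      have := congrArg zmodRed (hfs g k)
      rw [zmodRed_zmodEmb, map_sub, map_add] at this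
      linear_combination this
    have htc : Continuous t := continuous_of_discreteTopology.comp hs
    have hcomb := F.eq_add ht htc
    choose κ hκ using exists_zmodEmb_eq
    refine (hcl _).2 ⟨t F.x, t F.y, ?_⟩
    let φ : G → ZMod 3 := fun g => κ (F.cochain (t F.x) (t F.y) g - s g)
    have hφ : ∀ g, zmodEmb (φ g) = F.cochain (t F.x) (t F.y) g - s g := by
      intro g
      refine (hκ _ ?_).symm
      rw [map_sub, cochain, map_add, map_mul, map_mul]
      simp only [zmodRed_zmodLift]
      rw [sub_eq_zero]
      change _ = t g
      rw [hcomb g]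
      simp [mul_comm]
    have hφc : Continuous φ :=
      continuous_of_discreteTopology.comp ((F.cochain_cont _ _).sub hs)
    refine (Submodule.Quotient.eq _).2 ⟨φ, hφc, fun g k => zmodEmb_injective ?_⟩
    have h1 := F.zmodEmb_bockstein (t F.x) (t F.y) g k
    change zmodEmb ((t F.x • bockstein F.χ F.χ_mul F.χ_cont +
        t F.y • bockstein F.ψ F.ψ_mul F.ψ_cont : contCocycles₂ 3 G).1 (g, k) - f (g, k)) = _
    rw [map_sub zmodEmb, map_add zmodEmb, map_sub zmodEmb, hφ, hφ, hφ, hfs]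
    linear_combination h1

theorem Frame.relationRank_eq_two (F : Frame G) (h : CocyclesLift G) : relationRank 3 G = 2 := by
  have b := Module.Basis.mk F.linearIndependent_bocksteinClass (F.span_bocksteinClass_iff.2 h)
  rw [relationRank, rank_eq_card_basis b]
  simp

/-- The two Bockstein classes are always independent, so a space of dimension at most 2 is spanned
by them. -/
theorem Frame.cocyclesLift (F : Frame G) (h : relationRank 3 G ≤ 2) : CocyclesLift G := by
  rw [← F.span_bocksteinClass_iff]
  have hfin : Module.Finite (ZMod 3) (ContH2 3 G) :=
    Module.rank_lt_aleph0_iff.1 (h.trans_lt (Cardinal.natCast_lt_aleph0 (n := 2)))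
  have h1 := F.linearIndependent_bocksteinClass.fintype_card_le_finrank
  have h2 : Module.finrank (ZMod 3) (ContH2 3 G) ≤ 2 := Module.finrank_le_of_rank_le h
  exact (F.linearIndependent_bocksteinClass.span_eq_top_of_card_eq_finrank'
    (le_antisymm h1 (h2.trans (by simp)))).ge

end bockstein

/-! ### Maximal subgroups of finite `p`-groups and of pro-`p` groups. -/

/-- By the normalizer condition `M` is normal. The preimage of the nontrivial center of `P / M`
properly contains `M`, so it is everything and `P / M` is abelian. -/
theorem IsPGroup.commutator_le_of_isCoatom {p : ℕ} [Fact p.Prime] {P : Type*} [Group P] [Finite P]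
    (hP : IsPGroup p P) {M : Subgroup P} (hM : IsCoatom M) : commutator P ≤ M := by
  have hN : Group.IsNilpotent P := hP.isNilpotent
  have hn : M.Normal := Subgroup.NormalizerCondition.normal_of_coatom M
    Group.normalizerCondition_of_isNilpotent hM
  have hnt : Nontrivial (P ⧸ M) := QuotientGroup.nontrivial_iff.2 hM.1
  have hc := (hP.to_quotient M).center_nontrivial
  have hle : M ≤ (Subgroup.center (P ⧸ M)).comap (QuotientGroup.mk' M) := by
    intro m hm
    have : (QuotientGroup.mk' M) m = 1 := (QuotientGroup.eq_one_iff m).2 hm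
    rw [Subgroup.mem_comap, this]
    exact one_mem _
  rcases hle.eq_or_lt with h | h
  · obtain ⟨z, hz⟩ := exists_ne (1 : Subgroup.center (P ⧸ M))
    obtain ⟨t, ht⟩ := QuotientGroup.mk_surjective z.1
    refine (hz (Subtype.ext ?_)).elim
    rw [← ht]
    refine (QuotientGroup.eq_one_iff t).2 ?_
    rw [h, Subgroup.mem_comap]
    change (t : P ⧸ M) ∈ _
    rw [ht]
    exact z.2
  · have htop := hM.2 _ h
    rw [commutator_def, Subgroup.commutator_le]
    intro a _ b _
    have ha : a ∈ (Subgroup.center (P ⧸ M)).comap (QuotientGroup.mk' M) := by rw [htop]; trivial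
    rw [Subgroup.mem_comap, Subgroup.mem_center_iff] at ha
    rw [← QuotientGroup.eq_one_iff]
    have := ha b
    simp only [commutatorElement_def, QuotientGroup.mk_mul, QuotientGroup.mk_inv]
    rw [show ((a : P ⧸ M) * b) = b * a from this.symm]
    group

section profinite
variable {G : Type*} [Group G] [TopologicalSpace G] [IsTopologicalGroup G]

theorem IsProP.isPGroup_quotient {p : ℕ} (h : IsProP p G) {U : Subgroup G} [hU : U.Normal]
    (hUo : IsOpen (U : Set G)) : IsPGroup p (G ⧸ U) := by
  obtain ⟨n, hn⟩ := h.index_eq_pow U hU hUo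
  exact IsPGroup.of_card (n := n) (by rw [← hn, Subgroup.index_eq_card])

theorem IsProP.finiteIndex {p : ℕ} (h : IsProP p G) {U : Subgroup G}
    (hUo : IsOpen (U : Set G)) : U.FiniteIndex := by
  have := h.compact
  have := Subgroup.quotient_finite_of_isOpen U hUo
  exact Subgroup.finiteIndex_of_finite_quotient

theorem isOpen_of_le' {U V : Subgroup G} (h : U ≤ V) (hU : IsOpen (U : Set G)) :
    IsOpen (V : Set G) := Subgroup.isOpen_mono h hU

/-- In a pro-`p` group, open maximal subgroups contain the closure of the commutator subgroup. -/
theorem IsProP.closure_commutator_le {p : ℕ} [Fact p.Prime] (h : IsProP p G) {M : Subgroup G}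
    (hMo : IsOpen (M : Set G)) (hM : IsCoatom M) : (commutator G).topologicalClosure ≤ M := by
  have hf := h.finiteIndex hMo
  have hMc : IsClosed (M : Set G) := Subgroup.isClosed_of_isOpen M hMo
  refine Subgroup.topologicalClosure_minimal _ ?_ hMc
  have hco : IsOpen (M.normalCore : Set G) :=
    Subgroup.isOpen_of_isClosed_of_finiteIndex _ (M.normalCore_isClosed hMc)
  have hP := h.isPGroup_quotient hco
  have hcf : M.normalCore.FiniteIndex := h.finiteIndex hco
  have hfin : Finite (G ⧸ M.normalCore) := Subgroup.finite_quotient_of_finiteIndex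
  let π := QuotientGroup.mk' M.normalCore
  have hπ : Function.Surjective π := QuotientGroup.mk'_surjective _
  have hcm : (M.map π).comap π = M := by
    rw [Subgroup.comap_map_eq, QuotientGroup.ker_mk', sup_of_le_left M.normalCore_le]
  have hMm : IsCoatom (M.map π) := by
    constructor
    · intro ht
      rw [ht, Subgroup.comap_top] at hcm
      exact hM.1 hcm.symm
    · intro K hK
      have h1 : M < K.comap π :=
        hcm.symm.trans_lt ((Subgroup.comap_lt_comap_of_surjective hπ).2 hK)
      have h2 := hM.2 _ h1
      rw [← Subgroup.map_comap_eq_self_of_surjective hπ K, h2, Subgroup.map_top_of_surjective π hπ]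
  have := hP.commutator_le_of_isCoatom hMm
  rw [← hcm, ← Subgroup.map_le_iff_le_comap, commutator_def, Subgroup.map_commutator]
  refine le_trans (Subgroup.commutator_mono le_top le_top) this

/-- A closed proper subgroup of a pro-`p` group is contained in an open maximal subgroup. -/
theorem IsProP.exists_le_isCoatom {p : ℕ} (h : IsProP p G) {H : Subgroup G}
    (hH : IsClosed (H : Set G)) (hne : H ≠ ⊤) :
    ∃ M : Subgroup G, IsOpen (M : Set G) ∧ IsCoatom M ∧ H ≤ M := by
  have := h.compact
  have := h.totallyDisconnected
  have h1 := ProfiniteGrp.closedSubgroup_eq_sInf_open (⟨H, hH⟩ : ClosedSubgroup G)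
  obtain ⟨V, ⟨hVo, hHV⟩, hV⟩ : ∃ V ∈ {N : Subgroup G | IsOpen (N : Set G) ∧ H ≤ N}, V ≠ ⊤ := by
    by_contra! hcon
    refine hne ((show H = _ from h1).trans ?_)
    exact sInf_eq_top.2 hcon
  have hVc : IsClosed (V : Set G) := Subgroup.isClosed_of_isOpen V hVo
  have hf := h.finiteIndex hVo
  have hco : IsOpen (V.normalCore : Set G) :=
    Subgroup.isOpen_of_isClosed_of_finiteIndex _ (V.normalCore_isClosed hVc)
  have hcf : V.normalCore.FiniteIndex := h.finiteIndex hco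
  have hfin : Finite (G ⧸ V.normalCore) := Subgroup.finite_quotient_of_finiteIndex
  let π := QuotientGroup.mk' V.normalCore
  have hπ : Function.Surjective π := QuotientGroup.mk'_surjective _
  have hcm : (V.map π).comap π = V := by
    rw [Subgroup.comap_map_eq, QuotientGroup.ker_mk', sup_of_le_left V.normalCore_le]
  rcases eq_top_or_exists_le_coatom (V.map π) with ht | ⟨M, hM, hVM⟩
  · rw [ht, Subgroup.comap_top] at hcm
    exact (hV hcm.symm).elim
  · have hle : V ≤ M.comap π := Subgroup.map_le_iff_le_comap.1 hVM
    exact ⟨M.comap π, isOpen_of_le' hle hVo, Subgroup.isCoatom_comap_of_surjective hπ hM,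
      hHV.trans hle⟩

end profinite

/-! ### The four maximal subgroups as lines in a plane over `ℤ/3`; the generator rank. -/

namespace Frame
variable {G : Type*} [Group G] [TopologicalSpace G] [IsTopologicalGroup G] (F : Frame G)

/-- Representatives of the four lines of the plane over `ZMod 3`. -/
def dir : Fin 4 → ZMod 3 × ZMod 3 := ![(1, 0), (0, 1), (1, 1), (1, 2)]

/-- The maximal subgroups, as the inverse images of lines. -/
def line (i : Fin 4) : Subgroup G where
  carrier := {g | (dir i).1 * F.ψ g = (dir i).2 * F.χ g}
  one_mem' := by simp [χ_one, ψ_one]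
  mul_mem' := by
    intro a b ha hb
    simp only [Set.mem_ofPred_eq, F.χ_mul, F.ψ_mul] at *
    linear_combination ha + hb
  inv_mem' := by
    intro a ha
    simp only [Set.mem_ofPred_eq, χ_inv, ψ_inv] at *
    linear_combination -ha

theorem mem_line {i : Fin 4} {g : G} : g ∈ F.line i ↔ (dir i).1 * F.ψ g = (dir i).2 * F.χ g :=
  Iff.rfl

theorem isOpen_line (i : Fin 4) : IsOpen (F.line i : Set G) := by
  have : (F.line i : Set G) =
      (fun g => (dir i).1 * F.ψ g - (dir i).2 * F.χ g) ⁻¹' {0} := by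
    ext g
    simp [mem_line, sub_eq_zero]
  rw [this]
  exact (isOpen_discrete _).preimage
    ((continuous_const.mul F.ψ_cont).sub (continuous_const.mul F.χ_cont))

theorem closure_le_line (i : Fin 4) : (commutator G).topologicalClosure ≤ F.line i := by
  intro g hg
  obtain ⟨h1, h2⟩ := (F.mem_closure_iff g).1 hg
  rw [mem_line, h1, h2, mul_zero, mul_zero]

theorem mem_of_eq {M : Subgroup G} (hM : (commutator G).topologicalClosure ≤ M) {g k : G}
    (hg : g ∈ M) (h1 : F.χ g = F.χ k) (h2 : F.ψ g = F.ψ k) : k ∈ M := by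
  have : g⁻¹ * k ∈ M := hM (F.mem_closure _ (by rw [F.χ_mul, F.χ_inv, h1, neg_add_cancel])
    (by rw [F.ψ_mul, F.ψ_inv, h2, neg_add_cancel]))
  simpa using mul_mem hg this

theorem dir_mul : ∀ i : Fin 4, ∀ a b : ZMod 3, (dir i).1 * b = (dir i).2 * a →
    ∃ n : Fin 3, ((n : ℕ) : ZMod 3) * (dir i).1 = a ∧ ((n : ℕ) : ZMod 3) * (dir i).2 = b := by
  decide +kernel

theorem exists_dir : ∀ a b : ZMod 3, ∃ i : Fin 4, ∃ n : Fin 3, (a = 0 ∧ b = 0) ∨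
    ((n : ℕ) : ZMod 3) * a = (dir i).1 ∧ ((n : ℕ) : ZMod 3) * b = (dir i).2 := by
  decide +kernel

theorem dir_sub : ∀ i : Fin 4, ∀ a b c d : ZMod 3, (dir i).1 * d ≠ (dir i).2 * c →
    ∃ n : Fin 3, (dir i).1 * (b + -((n : ℕ) * d)) = (dir i).2 * (a + -((n : ℕ) * c)) := by
  decide +kernel

theorem exists_dir_orth : ∀ a b : ZMod 3, ∃ i : Fin 4, (dir i).1 * b = (dir i).2 * a := by
  decide +kernel

theorem dir_orth : ∀ i j : Fin 4, (dir i).1 * (dir j).2 = (dir i).2 * (dir j).1 ↔ i = j := by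
  decide +kernel

theorem pt_mem_line {i j : Fin 4} : F.pt (dir j).1 (dir j).2 ∈ F.line i ↔ i = j := by
  rw [mem_line, χ_pt, ψ_pt, dir_orth]

theorem line_le {M : Subgroup G} (hM : (commutator G).topologicalClosure ≤ M) {i : Fin 4}
    (hi : F.pt (dir i).1 (dir i).2 ∈ M) : F.line i ≤ M := by
  intro g hg
  obtain ⟨n, h1, h2⟩ := dir_mul i _ _ (F.mem_line.1 hg)
  refine F.mem_of_eq hM (pow_mem hi n) ?_ ?_
  · rw [χ_pow, χ_pt, h1]
  · rw [ψ_pow, ψ_pt, h2]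

theorem isCoatom_line (i : Fin 4) : IsCoatom (F.line i) := by
  constructor
  · intro h
    have h0 := F.pt_mem_line (i := i) (j := 0)
    have h1 := F.pt_mem_line (i := i) (j := 1)
    rw [h] at h0 h1
    have := (h0.1 trivial).symm.trans (h1.1 trivial)
    exact absurd this (by decide)
  · intro K hK
    obtain ⟨k, hk, hki⟩ := SetLike.exists_of_lt hK
    refine eq_top_iff.2 fun g _ => ?_
    obtain ⟨n, hn⟩ := dir_sub i (F.χ g) (F.ψ g) _ _ hki
    have : g * (k ^ (n : ℕ))⁻¹ ∈ F.line i := by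
      rw [mem_line, F.χ_mul, F.ψ_mul, χ_inv, ψ_inv, χ_pow, ψ_pow, hn]
    have h2 := mul_mem (hK.le this) (pow_mem hk (n : ℕ))
    simpa using h2

theorem line_injective : Function.Injective F.line := by
  intro i j h
  rw [← F.pt_mem_line, h, F.pt_mem_line]

/-- `M` contains the closed commutator subgroup, so it is determined by its image in the plane. If
it missed all four directions this image would be zero, contradicting maximality; and containing one
direction it contains the whole line, itself maximal. -/
theorem exists_line (hG : IsProP 3 G) {M : Subgroup G} (hMo : IsOpen (M : Set G))
    (hM : IsCoatom M) : ∃ i, M = F.line i := by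
  have hle := hG.closure_commutator_le hMo hM
  obtain ⟨i, hi⟩ : ∃ i, F.pt (dir i).1 (dir i).2 ∈ M := by
    by_contra! hcon
    have h0 : M ≤ F.line 0 := by
      intro g hg
      obtain ⟨i, n, ⟨h1, h2⟩ | ⟨h1, h2⟩⟩ := exists_dir (F.χ g) (F.ψ g)
      · rw [mem_line, h1, h2, mul_zero, mul_zero]
      · refine (hcon i (F.mem_of_eq hle (pow_mem hg n) ?_ ?_)).elim
        · rw [χ_pow, χ_pt, h1]
        · rw [ψ_pow, ψ_pt, h2]
    rcases h0.eq_or_lt with h | h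
    · exact hcon 0 (by rw [h, pt_mem_line])
    · exact (F.isCoatom_line 0).1 (hM.2 _ h)
  refine ⟨i, ?_⟩
  rcases (F.line_le hle hi).eq_or_lt with h | h
  · exact h.symm
  · exact (hM.1 ((F.isCoatom_line i).2 _ h)).elim

/-- The maximal open subgroups of a pro-`3` group with a frame. -/
noncomputable def maximal (hG : IsProP 3 G) : Fin 4 ≃ MaximalOpenSubgroup G :=
  Equiv.ofBijective
    (fun i => ⟨F.line i, F.isOpen_line i, hG.finiteIndex (F.isOpen_line i), F.isCoatom_line i⟩)
    ⟨fun i j h => F.line_injective (congrArg MaximalOpenSubgroup.toSubgroup h), fun M => by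
      obtain ⟨i, hi⟩ := F.exists_line hG M.isOpen M.isCoatom
      refine ⟨i, ?_⟩
      obtain ⟨M, _, _, _⟩ := M
      simp only at hi
      subst hi
      rfl⟩

/-- Two elements of the frame generate the group topologically. -/
theorem closure_pair (hG : IsProP 3 G) {H : Subgroup G} (hH : IsClosed (H : Set G))
    (hx : F.x ∈ H) (hy : F.y ∈ H) : H = ⊤ := by
  by_contra hne
  obtain ⟨M, hMo, hM, hHM⟩ := hG.exists_le_isCoatom hH hne
  obtain ⟨i, rfl⟩ := F.exists_line hG hMo hM
  have h1 := hHM hx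
  have h2 := hHM hy
  rw [mem_line, F.χ_x, F.ψ_x] at h1
  rw [mem_line, F.χ_y, F.ψ_y] at h2
  revert h1 h2
  fin_cases i <;> decide

/-- For the lower bound: a set with at most one element lies in one of the four lines, a proper
closed subgroup. -/
theorem generatorRank_eq_two (F : Frame G) (hG : IsProP 3 G) : generatorRank G = 2 := by
  have hmem : (2 : Cardinal) ∈ {c | ∃ S : Set G, Cardinal.mk S = c ∧
      (∀ U : Subgroup G, IsOpen (U : Set G) → (S \ (U : Set G)).Finite) ∧
      (Subgroup.closure S).topologicalClosure = ⊤} := by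
    refine ⟨{F.x, F.y}, ?_, fun U _ => ((Set.toFinite _).sdiff), ?_⟩
    · have hxy : F.x ≠ F.y := fun h => by
        have := F.χ_x
        rw [h, F.χ_y] at this
        exact absurd this (by decide)
      rw [Cardinal.mk_insert (by simpa using hxy), Cardinal.mk_singleton]
      norm_num
    · refine F.closure_pair hG (Subgroup.isClosed_topologicalClosure _) ?_ ?_ <;>
        exact Subgroup.le_topologicalClosure _ (Subgroup.subset_closure (by simp))
  refine le_antisymm (csInf_le' hmem) (le_csInf ⟨_, hmem⟩ ?_)
  rintro c ⟨S, rfl, -, hS⟩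
  rw [Cardinal.two_le_iff]
  by_contra! hcon
  have key : ∃ i, S ⊆ F.line i := by
    rcases S.eq_empty_or_nonempty with rfl | ⟨s, hs⟩
    · exact ⟨0, Set.empty_subset _⟩
    · obtain ⟨i, hi⟩ := exists_dir_orth (F.χ s) (F.ψ s)
      refine ⟨i, fun t ht => ?_⟩
      have : (⟨t, ht⟩ : S) = ⟨s, hs⟩ := hcon _ _
      rw [show t = s from congrArg Subtype.val this]
      exact hi
  obtain ⟨i, hi⟩ := key
  refine (F.isCoatom_line i).1 (top_le_iff.1 ?_)
  rw [← hS]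
  exact Subgroup.topologicalClosure_minimal _ ((Subgroup.closure_le _).2 hi)
    (Subgroup.isClosed_of_isOpen _ (F.isOpen_line i))

theorem exists_of_abelianization
    (h : Nonempty (TopologicalAbelianization G ≃* AbelianOfType [3, 3])) : Nonempty (Frame G) := by
  obtain ⟨e⟩ := h
  have hfin : Finite (AbelianOfType [3, 3]) := by
    have : ∀ i : Fin [3, 3].length, Finite (ZMod ([3, 3].get i)) := by
      intro i
      fin_cases i <;> exact inferInstanceAs (Finite (ZMod 3))
    exact inferInstanceAs (Finite (∀ i : Fin [3, 3].length, ZMod ([3, 3].get i)))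
  have hq : Finite (G ⧸ (commutator G).topologicalClosure) := Finite.of_injective _ e.injective
  have hfi : (commutator G).topologicalClosure.FiniteIndex :=
    Subgroup.finiteIndex_of_finite_quotient
  have hop : IsOpen ((commutator G).topologicalClosure : Set G) :=
    Subgroup.isOpen_of_isClosed_of_finiteIndex _ (Subgroup.isClosed_topologicalClosure _)
  have hd : DiscreteTopology (G ⧸ (commutator G).topologicalClosure) :=
    QuotientGroup.discreteTopology hop
  let π : G →* TopologicalAbelianization G :=
    QuotientGroup.mk' (commutator G).topologicalClosure
  have hπ : Continuous π := continuous_quotient_mk'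
  let c : TopologicalAbelianization G → Fin 2 → ZMod 3 := fun a i =>
    match i with
    | 0 => (e a).toAdd (0 : Fin 2)
    | 1 => (e a).toAdd (1 : Fin 2)
  have hc : ∀ a b i, c (a * b) i = c a i + c b i := by
    intro a b i
    fin_cases i <;> simp only [c, map_mul] <;> rfl
  have hc1 : ∀ a, c a 0 = 0 → c a 1 = 0 → a = 1 := by
    intro a h0 h1
    apply e.injective
    rw [map_one]
    refine Multiplicative.toAdd.injective (funext fun i => ?_)
    match i with
    | ⟨0, _⟩ => exact h0
    | ⟨1, _⟩ => exact h1
  have hcs : ∀ u v : ZMod 3, ∃ g, c (π g) 0 = u ∧ c (π g) 1 = v := by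
    intro u v
    obtain ⟨a, ha⟩ := e.surjective (Multiplicative.ofAdd (fun i => match i with
      | ⟨0, _⟩ => u
      | ⟨1, _⟩ => v))
    obtain ⟨g, rfl⟩ := QuotientGroup.mk_surjective a
    refine ⟨g, ?_, ?_⟩
    · exact congrArg (fun q : AbelianOfType [3, 3] => q.toAdd (0 : Fin 2)) ha
    · exact congrArg (fun q : AbelianOfType [3, 3] => q.toAdd (1 : Fin 2)) ha
  have hcc : ∀ i, Continuous fun g => c (π g) i := fun i =>
    (continuous_of_discreteTopology (f := fun a => c a i)).comp hπ
  obtain ⟨x, hx0, hx1⟩ := hcs 1 0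
  obtain ⟨y, hy0, hy1⟩ := hcs 0 1
  exact ⟨{
    x := x
    y := y
    χ := fun g => c (π g) 0
    ψ := fun g => c (π g) 1
    χ_mul := fun g h => hc (π g) (π h) 0
    ψ_mul := fun g h => hc (π g) (π h) 1
    χ_cont := hcc 0
    ψ_cont := hcc 1
    χ_x := hx0
    χ_y := hy0
    ψ_x := hx1
    ψ_y := hy1
    mem_closure := fun g h0 h1 => (QuotientGroup.eq_one_iff g).1 (hc1 _ h0 h1) }⟩

/-- A frame with given independent elements. -/
def change (F : Frame G) (a b c d : ZMod 3) (h : (a * d - b * c) * (a * d - b * c) = 1) :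
    Frame G where
  x := F.pt a b
  y := F.pt c d
  -- Cramer's rule: a determinant whose square is 1 is its own inverse, and in `ℤ/3` this just means
  -- that it is nonzero.
  χ g := (a * d - b * c) * (d * F.χ g - c * F.ψ g)
  ψ g := (a * d - b * c) * (a * F.ψ g - b * F.χ g)
  χ_mul g k := by rw [F.χ_mul, F.ψ_mul]; ring
  ψ_mul g k := by rw [F.χ_mul, F.ψ_mul]; ring
  χ_cont := (continuous_of_discreteTopology (f := fun q : ZMod 3 × ZMod 3 =>
    (a * d - b * c) * (d * q.1 - c * q.2))).comp (F.χ_cont.prodMk F.ψ_cont)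
  ψ_cont := (continuous_of_discreteTopology (f := fun q : ZMod 3 × ZMod 3 =>
    (a * d - b * c) * (a * q.2 - b * q.1))).comp (F.χ_cont.prodMk F.ψ_cont)
  χ_x := by rw [χ_pt, ψ_pt]; linear_combination h
  χ_y := by rw [χ_pt, ψ_pt]; ring
  ψ_x := by rw [χ_pt, ψ_pt]; ring
  ψ_y := by rw [χ_pt, ψ_pt]; linear_combination h
  mem_closure g h1 h2 := by
    refine F.mem_closure g ?_ ?_
    · linear_combination a * h1 + c * h2 - h * F.χ g
    · linear_combination b * h1 + d * h2 - h * F.ψ g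

theorem dir_det : ∀ i j : Fin 4, i ≠ j →
    ((dir i).1 * (dir j).2 - (dir i).2 * (dir j).1) *
      ((dir i).1 * (dir j).2 - (dir i).2 * (dir j).1) = 1 := by
  decide +kernel

/-- There is a frame with two given lines as the first ones. -/
theorem exists_adapted (F : Frame G) {i j : Fin 4} (hij : i ≠ j) :
    ∃ F' : Frame G, F'.line 0 = F.line i ∧ F'.line 1 = F.line j := by
  refine ⟨F.change _ _ _ _ (dir_det i j hij), ?_, ?_⟩
  · ext g
    have h := dir_det i j hij
    rw [mem_line, mem_line]
    constructor
    · intro hg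
      have hg : (1 : ZMod 3) * (((dir i).1 * (dir j).2 - (dir i).2 * (dir j).1) *
        ((dir i).1 * F.ψ g - (dir i).2 * F.χ g)) = 0 * _ := hg
      linear_combination ((dir i).1 * (dir j).2 - (dir i).2 * (dir j).1) * hg -
        ((dir i).1 * F.ψ g - (dir i).2 * F.χ g) * h
    · intro hg
      change (1 : ZMod 3) * (((dir i).1 * (dir j).2 - (dir i).2 * (dir j).1) *
        ((dir i).1 * F.ψ g - (dir i).2 * F.χ g)) = 0 * _
      linear_combination ((dir i).1 * (dir j).2 - (dir i).2 * (dir j).1) * hg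
  · ext g
    have h := dir_det i j hij
    rw [mem_line, mem_line]
    constructor
    · intro hg
      have hg : 0 * _ = (1 : ZMod 3) * (((dir i).1 * (dir j).2 - (dir i).2 * (dir j).1) *
        ((dir j).2 * F.χ g - (dir j).1 * F.ψ g)) := hg
      linear_combination ((dir i).1 * (dir j).2 - (dir i).2 * (dir j).1) * hg +
        ((dir j).2 * F.χ g - (dir j).1 * F.ψ g) * h
    · intro hg
      change 0 * _ = (1 : ZMod 3) * (((dir i).1 * (dir j).2 - (dir i).2 * (dir j).1) *
        ((dir j).2 * F.χ g - (dir j).1 * F.ψ g))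
      linear_combination ((dir i).1 * (dir j).2 - (dir i).2 * (dir j).1) * hg

end Frame

/-! ### The transfer to the maximal subgroups. -/

section discrete
variable {G : Type*} [Group G] [TopologicalSpace G] [IsTopologicalGroup G]

theorem topologicalClosure_of_discrete [DiscreteTopology G] (H : Subgroup G) :
    H.topologicalClosure = H :=
  le_antisymm (Subgroup.topologicalClosure_minimal _ le_rfl (isClosed_discrete _))
    (Subgroup.le_topologicalClosure _)

end discrete

theorem mem_commutator_subtype {G : Type*} [Group G] {M : Subgroup G} {g : G} (hg : g ∈ M) :
    (⟨g, hg⟩ : M) ∈ commutator M ↔ g ∈ ⁅M, M⁆ := by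
  rw [← Subgroup.map_subtype_commutator M, Subgroup.mem_map]
  constructor
  · intro h
    exact ⟨_, h, rfl⟩
  · rintro ⟨⟨a, ha⟩, h1, rfl⟩
    exact h1

/-- The transfer to a normal subgroup of prime index, at an element outside of it. -/
theorem transfer_eq_pow_of_prime_index {G A : Type*} [Group G] [CommGroup A] {M : Subgroup G}
    [hM : M.Normal] {p : ℕ} (hp : p.Prime) (hidx : M.index = p) [M.FiniteIndex] (φ : M →* A)
    {n : G} (hn : n ∉ M) (hnp : n ^ p ∈ M) : MonoidHom.transfer φ n = φ ⟨n ^ p, hnp⟩ := by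
  classical
  have := Fact.mk hp
  have hcard : Nat.card (G ⧸ M) = p := by rw [← hidx, Subgroup.index_eq_card]
  have hgen : ∀ q : G ⧸ M, ∃ k : ℤ, (n : G ⧸ M) ^ k = q := by
    intro q
    have h1 : (n : G ⧸ M) ≠ 1 := fun h => hn ((QuotientGroup.eq_one_iff n).1 h)
    exact Subgroup.mem_zpowers_iff.1 (mem_zpowers_of_prime_card hcard h1)
  -- `n` generates `G / M`, so the cycle formula for the transfer has a single factor, of length
  -- `p`.
  have hsub : Subsingleton (Quotient (MulAction.orbitRel (Subgroup.zpowers n) (G ⧸ M))) := by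
    constructor
    intro a b
    induction a, b using Quotient.inductionOn₂ with
    | h a b =>
      refine Quotient.sound ?_
      obtain ⟨k, rfl⟩ := hgen a
      obtain ⟨l, rfl⟩ := hgen b
      refine ⟨⟨n ^ (k - l), Subgroup.zpow_mem_zpowers n _⟩, ?_⟩
      change ((n ^ (k - l) : G) : G ⧸ M) * (n : G ⧸ M) ^ l = _
      rw [QuotientGroup.mk_zpow, ← zpow_add, sub_add_cancel]
  have := M.fintypeQuotientOfFiniteIndex
  have : Fintype (Quotient (MulAction.orbitRel (Subgroup.zpowers n) (G ⧸ M))) :=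
    Fintype.ofFinite _
  rw [MonoidHom.transfer_eq_prod_quotient_orbitRel_zpowers_quot]
  let q0 : Quotient (MulAction.orbitRel (Subgroup.zpowers n) (G ⧸ M)) :=
    Quotient.mk _ ((1 : G) : G ⧸ M)
  rw [Fintype.prod_subsingleton _ q0]
  have hper : Function.minimalPeriod (n • · : G ⧸ M → G ⧸ M) q0.out = p := by
    have hd : Function.minimalPeriod (n • · : G ⧸ M → G ⧸ M) q0.out ∣ p := by
      rw [← Function.isPeriodicPt_iff_minimalPeriod_dvd, Function.IsPeriodicPt,
        smul_iterate]
      change (n ^ p) • q0.out = q0.out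
      generalize q0.out = q
      obtain ⟨t, rfl⟩ := QuotientGroup.mk_surjective q
      change ((n ^ p * t : G) : G ⧸ M) = _
      rw [QuotientGroup.mk_mul, (QuotientGroup.eq_one_iff _).2 hnp, one_mul]
    rcases (Nat.dvd_prime hp).1 hd with h1 | h1
    · have := Function.isPeriodicPt_minimalPeriod (n • · : G ⧸ M → G ⧸ M) q0.out
      rw [h1] at this
      change n • q0.out = q0.out at this
      revert this
      generalize q0.out = q
      obtain ⟨t, rfl⟩ := QuotientGroup.mk_surjective q
      intro this
      change ((n * t : G) : G ⧸ M) = _ at this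
      rw [QuotientGroup.mk_mul, mul_eq_right] at this
      exact (hn ((QuotientGroup.eq_one_iff n).1 this)).elim
    · exact h1
  -- The chosen representative is `n ^ k * m` with `m ∈ M`. The power of `n` commutes with `n ^ p`,
  -- and conjugation by `m` disappears in the abelian group `A`.
  obtain ⟨k, hk⟩ := hgen q0.out
  have hm : (n ^ k)⁻¹ * q0.out.out ∈ M := by
    rw [← QuotientGroup.eq, QuotientGroup.mk_zpow, hk]
    exact (QuotientGroup.out_eq' _).symm
  have : q0.out.out⁻¹ * n ^ p * q0.out.out =
      ((n ^ k)⁻¹ * q0.out.out)⁻¹ * n ^ p * ((n ^ k)⁻¹ * q0.out.out) := by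
    rw [mul_inv_rev, inv_inv]
    have hc : n ^ k * n ^ p * (n ^ k)⁻¹ = n ^ p := by
      rw [← zpow_natCast, ← zpow_add, ← zpow_neg, ← zpow_add]
      congr 1
      ring
    simp only [mul_assoc] at hc ⊢
    rw [← mul_assoc (n ^ p) (n ^ k)⁻¹, ← mul_assoc (n ^ k)]
    simp only [mul_assoc]
    rw [← mul_assoc (n ^ k) (n ^ p), ← mul_assoc (n ^ k * n ^ p), mul_assoc (n ^ k), hc]
  have h2 : ∀ (r : ℕ) (hr : q0.out.out⁻¹ * n ^ r * q0.out.out ∈ M), r = p →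
      φ ⟨q0.out.out⁻¹ * n ^ r * q0.out.out, hr⟩ = φ ⟨n ^ p, hnp⟩ := by
    rintro r hr rfl
    have : (⟨q0.out.out⁻¹ * n ^ r * q0.out.out, hr⟩ : M) =
        (⟨_, hm⟩ : M)⁻¹ * ⟨n ^ r, hnp⟩ * ⟨_, hm⟩ := Subtype.ext this
    rw [this, map_mul, map_mul, map_inv, mul_comm, mul_inv_cancel_left]
  exact h2 _ _ hper

namespace Frame
variable {G : Type*} [Group G] [TopologicalSpace G] [IsTopologicalGroup G] (F : Frame G)

instance line_normal (i : Fin 4) : (F.line i).Normal := by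
  constructor
  intro g hg t
  rw [mem_line] at hg ⊢
  rw [F.χ_mul, F.χ_mul, F.ψ_mul, F.ψ_mul, χ_inv, ψ_inv]
  linear_combination hg

theorem index_line (i : Fin 4) : (F.line i).index = 3 := by
  let f : G →* Multiplicative (ZMod 3) :=
    addHomOf (fun g => (dir i).1 * F.ψ g - (dir i).2 * F.χ g)
      fun g h => by rw [F.χ_mul, F.ψ_mul]; ring
  have hk : f.ker = F.line i := by
    ext g
    rw [mem_line, ← sub_eq_zero (a := (dir i).1 * _)]
    exact Multiplicative.ofAdd.injective.eq_iff' ofAdd_zero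
  have hs : Function.Surjective f := by
    intro a
    have : ∀ i : Fin 4, ∀ c : ZMod 3, ∃ a b : ZMod 3, (dir i).1 * b - (dir i).2 * a = c := by
      decide +kernel
    obtain ⟨u, v, huv⟩ := this i a.toAdd
    refine ⟨F.pt u v, ?_⟩
    change Multiplicative.ofAdd ((dir i).1 * F.ψ (F.pt u v) - (dir i).2 * F.χ (F.pt u v)) = a
    rw [χ_pt, ψ_pt, huv]
    rfl
  rw [← hk, Subgroup.index_ker, MonoidHom.range_eq_top.2 hs, Subgroup.card_top]
  exact Nat.card_zmod 3

theorem pow_three_mem_line (i : Fin 4) (g : G) : g ^ 3 ∈ F.line i :=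
  F.closure_le_line i (F.pow_three_mem g)

theorem transfer_of_notMem (hG : IsProP 3 G) {i : Fin 4} {n : G} (hn : n ∉ F.line i) :
    (F.maximal hG i).transfer (n : TopologicalAbelianization G) =
      QuotientGroup.mk ⟨n ^ 3, F.pow_three_mem_line i n⟩ := by
  have := hG.finiteIndex (F.isOpen_line i)
  exact transfer_eq_pow_of_prime_index Nat.prime_three (F.index_line i)
    (QuotientGroup.mk' (commutator (F.line i)).topologicalClosure) hn (F.pow_three_mem_line i n)

/-- The cube of an element outside a maximal subgroup is trivial in its abelianization. -/
def CubeTrivial (i : Fin 4) (n : G) : Prop :=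
  (⟨n ^ 3, F.pow_three_mem_line i n⟩ : F.line i) ∈ (commutator (F.line i)).topologicalClosure

theorem mem_ker_transfer_iff (hG : IsProP 3 G) {i : Fin 4} {n : G} (hn : n ∉ F.line i) :
    (n : TopologicalAbelianization G) ∈ (F.maximal hG i).transfer.ker ↔ F.CubeTrivial i n := by
  rw [MonoidHom.mem_ker, F.transfer_of_notMem hG hn]
  exact QuotientGroup.eq_one_iff _

theorem mk_mem_image (hG : IsProP 3 G) {i : Fin 4} {n : G} :
    (n : TopologicalAbelianization G) ∈ (F.maximal hG i).image ↔ n ∈ F.line i := by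
  rw [MaximalOpenSubgroup.image, Subgroup.mem_map]
  constructor
  · rintro ⟨m, hm, h⟩
    have h1 : m⁻¹ * n ∈ (commutator G).topologicalClosure := QuotientGroup.eq.1 h
    simpa using mul_mem (show m ∈ F.line i from hm) (F.closure_le_line i h1)
  · intro h
    exact ⟨n, h, rfl⟩

theorem ker_transfer_eq_iff (hG : IsProP 3 G) {i j : Fin 4} :
    (F.maximal hG i).transfer.ker = (F.maximal hG j).image ↔
      ∀ n : G, (n : TopologicalAbelianization G) ∈ (F.maximal hG i).transfer.ker ↔ n ∈ F.line j := by
  rw [SetLike.ext_iff]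
  constructor
  · intro h n
    rw [h, F.mk_mem_image hG]
  · intro h q
    obtain ⟨n, rfl⟩ := QuotientGroup.mk_surjective q
    rw [F.mk_mem_image hG]
    exact h n

/-- The kernel of a transfer is determined by one nontrivial element of it and one element outside
of it. -/
theorem ker_transfer_eq (hG : IsProP 3 G) {i j : Fin 4}
    (h1 : (F.pt (dir j).1 (dir j).2 : TopologicalAbelianization G) ∈
      (F.maximal hG i).transfer.ker) {n : G}
    (h2 : (n : TopologicalAbelianization G) ∉ (F.maximal hG i).transfer.ker) :
    (F.maximal hG i).transfer.ker = (F.maximal hG j).image := by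
  rw [F.ker_transfer_eq_iff hG]
  let K := (F.maximal hG i).transfer.ker.comap
    (QuotientGroup.mk' (commutator G).topologicalClosure)
  have hK : (commutator G).topologicalClosure ≤ K := by
    intro g hg
    rw [Subgroup.mem_comap]
    have : QuotientGroup.mk' (commutator G).topologicalClosure g = 1 :=
      (QuotientGroup.eq_one_iff g).2 hg
    rw [this]
    exact one_mem _
  have h3 : F.line j ≤ K := F.line_le hK h1
  have h4 : F.line j = K := by
    rcases h3.eq_or_lt with h | h
    · exact h
    · refine (h2 ?_).elim
      have : n ∈ K := by rw [(F.isCoatom_line j).2 _ h]; trivial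
      exact this
  intro m
  rw [h4]
  rfl

end Frame

/-! ### Identifying abelian groups, and membership in subgroups of the central series. -/

/-- An abelian group generated by two elements of orders dividing `m` and `n`, and of order at
least `m * n`. -/
theorem nonempty_mulEquiv_abelianOfType {A : Type*} [CommGroup A] {m n : ℕ} [NeZero m] [NeZero n]
    {u v : A} (hu : u ^ m = 1) (hv : v ^ n = 1) (hgen : Subgroup.closure {u, v} = ⊤)
    (hcard : m * n ≤ Nat.card A) : Nonempty (A ≃* AbelianOfType [m, n]) := by
  let fu : ZMod m →+ Additive A := ZMod.lift m ⟨zmultiplesHom (Additive A) (Additive.ofMul u), by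
    simpa using congrArg Additive.ofMul hu⟩
  let fv : ZMod n →+ Additive A := ZMod.lift n ⟨zmultiplesHom (Additive A) (Additive.ofMul v), by
    simpa using congrArg Additive.ofMul hv⟩
  let f : ZMod m × ZMod n →+ Additive A := fu.coprod fv
  have hfu : f (1, 0) = Additive.ofMul u := by
    have : fu 1 = Additive.ofMul u := by
      have := ZMod.lift_castAddHom m ⟨zmultiplesHom (Additive A) (Additive.ofMul u), by
        simpa using congrArg Additive.ofMul hu⟩ 1
      simpa [fu] using this
    simp [f, this]
  have hfv : f (0, 1) = Additive.ofMul v := by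
    have : fv 1 = Additive.ofMul v := by
      have := ZMod.lift_castAddHom n ⟨zmultiplesHom (Additive A) (Additive.ofMul v), by
        simpa using congrArg Additive.ofMul hv⟩ 1
      simpa [fv] using this
    simp [f, this]
  let F : Multiplicative (ZMod m × ZMod n) →* A := AddMonoidHom.toMultiplicativeLeft f
  have hF : Function.Surjective F := by
    rw [← MonoidHom.range_eq_top, eq_top_iff, ← hgen, Subgroup.closure_le]
    rintro a (rfl | rfl)
    · exact ⟨Multiplicative.ofAdd (1, 0), hfu⟩
    · exact ⟨Multiplicative.ofAdd (0, 1), hfv⟩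
  have hc : Nat.card (Multiplicative (ZMod m × ZMod n)) = m * n := by
    rw [Nat.card_congr Multiplicative.toAdd, Nat.card_prod, Nat.card_zmod, Nat.card_zmod]
  have hfin : Finite A := Finite.of_surjective F hF
  have hbij : Function.Bijective F := by
    rw [Nat.bijective_iff_surjective_and_card]
    exact ⟨hF, le_antisymm (hc.le.trans hcard) (Nat.card_le_card_of_surjective F hF)⟩
  let g : (∀ i : Fin [m, n].length, ZMod ([m, n].get i)) ≃+ ZMod m × ZMod n :=
    { toFun := fun q => (q (0 : Fin 2), q (1 : Fin 2))
      invFun := fun q i => match i with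
        | ⟨0, _⟩ => q.1
        | ⟨1, _⟩ => q.2
      left_inv := fun q => funext fun i => match i with
        | ⟨0, _⟩ => rfl
        | ⟨1, _⟩ => rfl
      right_inv := fun q => rfl
      map_add' := fun a b => rfl }
  exact ⟨(MulEquiv.ofBijective F hbij).symm.trans (AddEquiv.toMultiplicative g).symm⟩

theorem commutator_closure_le {T : Type*} [Group T] {S : Set T} {K : Subgroup T} [K.Normal]
    (h : ∀ a ∈ S, ∀ b ∈ S, (a : T ⧸ K) * b = b * a) :
    ⁅Subgroup.closure S, Subgroup.closure S⁆ ≤ K := by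
  have h1 : ∀ a ∈ S, ∀ t ∈ Subgroup.closure S, (a : T ⧸ K) * t = t * a := by
    intro a ha t ht
    induction ht using Subgroup.closure_induction with
    | mem x hx => exact h a ha x hx
    | one => simp
    | mul x y _ _ hx hy =>
      rw [QuotientGroup.mk_mul, ← mul_assoc, hx, mul_assoc, hy, mul_assoc]
    | inv x _ hx =>
      rw [QuotientGroup.mk_inv, eq_inv_mul_iff_mul_eq, ← mul_assoc, ← hx, mul_inv_cancel_right]
  rw [Subgroup.commutator_le]
  intro s hs t ht
  have h2 : (s : T ⧸ K) * t = t * s := by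
    induction hs using Subgroup.closure_induction with
    | mem x hx => exact h1 x hx t ht
    | one => simp
    | mul x y _ _ hx hy => rw [QuotientGroup.mk_mul, mul_assoc, hy, ← mul_assoc, hx, mul_assoc]
    | inv x _ hx =>
      rw [QuotientGroup.mk_inv, inv_mul_eq_iff_eq_mul, ← mul_assoc, hx, mul_inv_cancel_right]
  rw [← QuotientGroup.eq_one_iff]
  simp only [commutatorElement_def, QuotientGroup.mk_mul, QuotientGroup.mk_inv]
  rw [h2]
  group

/-- A collected word with a letter less than `c`. -/
def leadingLt (c : ℕ) : List ℕ → Bool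
  | [] => false
  | [k] => Nat.blt k c && Nat.blt k 8
  | k :: m :: l => Nat.blt k c && Nat.blt k 8 && Nat.ble k m && l.all fun i => Nat.blt k i

namespace PCModel
variable {a b c d : ℕ} {T : Type*} [Group T] {h : ℕ → T}

theorem pow_three_mem (H : PCModel a b c d h) (k : ℕ) : h k ^ 3 ∈ chain h (k + 1) := by
  rw [H.sat.pow]
  exact ev_mem_chain fun i hi => (lt_of_mem_pw hi).1

/-- The leading letter `k < m` occurs once or twice, an exponent prime to 3, and the rest of the
word lies in `N_{k+1}`. Membership in `N_m` would therefore put `h k` into `N_{k+1}`. -/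
theorem ev_notMem (H : PCModel a b c d h) (hT : Nat.card T = 3 ^ 8) {m : ℕ} {w : List ℕ}
    (hw : leadingLt m ((pcData a b c d).collect w) = true) : ev h w ∉ chain h m := by
  rw [H.sat.collect_eq]
  generalize (pcData a b c d).collect w = v at hw
  rcases v with _ | ⟨k, _ | ⟨l, v⟩⟩
  · simp [leadingLt] at hw
  · simp only [leadingLt, Bool.and_eq_true, Nat.blt_eq] at hw
    intro hm
    refine H.notMem_chain hT hw.2 (chain_anti hw.1 ?_)
    simpa using hm
  · simp only [leadingLt, Bool.and_eq_true, Nat.blt_eq, Nat.ble_eq, List.all_eq_true] at hw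
    obtain ⟨⟨⟨h1, h2⟩, h3⟩, h4⟩ := hw
    have hv : ev h v ∈ chain h (k + 1) := ev_mem_chain fun i hi => h4 i hi
    intro hm
    have hm' := chain_anti h1 hm
    rw [ev_cons, ev_cons, ← mul_assoc, Subgroup.mul_mem_cancel_right _ hv] at hm'
    rcases h3.eq_or_lt with rfl | h5
    · refine H.notMem_chain hT h2 ?_
      have := mul_mem (inv_mem hm') (H.pow_three_mem k)
      rwa [show (h k * h k)⁻¹ * h k ^ 3 = h k by group] at this
    · rw [Subgroup.mul_mem_cancel_right _ (mem_chain h5)] at hm'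
      exact H.notMem_chain hT h2 hm'

theorem ev_mem (H : PCModel a b c d h) {m : ℕ} {w : List ℕ}
    (hw : ((pcData a b c d).collect w).all (fun i => Nat.ble m i) = true) :
    ev h w ∈ chain h m := by
  rw [H.sat.collect_eq]
  simp only [List.all_eq_true, Nat.ble_eq] at hw
  exact ev_mem_chain hw

end PCModel

/-- The subgroup generated by `z` and the `h i` with `m ≤ i`, for `z` central modulo the latter. -/
def chainZ {T : Type*} [Group T] (h : ℕ → T) (m : ℕ) [(chain h m).Normal] (z : T) : Subgroup T :=
  (Subgroup.zpowers (z : T ⧸ chain h m)).comap (QuotientGroup.mk' (chain h m))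

section chainZ
variable {T : Type*} [Group T] {h : ℕ → T} {m : ℕ} [(chain h m).Normal] {z : T}

theorem chainZ_normal (hz : ∀ t : T, (t : T ⧸ chain h m) * z = z * t) : (chainZ h m z).Normal := by
  refine Subgroup.Normal.comap ⟨fun x hx g => ?_⟩ _
  obtain ⟨n, rfl⟩ := Subgroup.mem_zpowers_iff.1 hx
  obtain ⟨g, rfl⟩ := QuotientGroup.mk_surjective g
  have : Commute ((g : T) : T ⧸ chain h m) z := hz g
  rw [(this.zpow_right n).eq, mul_inv_cancel_right]
  exact hx

theorem exists_of_mem_chainZ {q : ℕ} (hq : 0 < q) (hzq : z ^ q ∈ chain h m) {t : T}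
    (ht : t ∈ chainZ h m z) : ∃ j < q, ∃ n ∈ chain h m, t = z ^ j * n := by
  obtain ⟨k, hk⟩ := Subgroup.mem_zpowers_iff.1 ht
  have hq' : (q : ℤ) ≠ 0 := by omega
  have h0 := Int.emod_nonneg k hq'
  refine ⟨(k % q).toNat, ?_, (z ^ (k % q).toNat)⁻¹ * t, ?_, by simp⟩
  · have := Int.emod_lt_of_pos k (show (0 : ℤ) < q by omega)
    omega
  · rw [← QuotientGroup.eq, QuotientGroup.mk_pow, ← zpow_natCast, Int.toNat_of_nonneg h0]
    change _ = QuotientGroup.mk' _ t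
    rw [← hk]
    conv_rhs => rw [← Int.emod_add_mul_ediv k q, zpow_add, zpow_mul]
    have : (z : T ⧸ chain h m) ^ (q : ℤ) = 1 := by
      rw [zpow_natCast, ← QuotientGroup.mk_pow]
      exact (QuotientGroup.eq_one_iff _).2 hzq
    rw [this, one_zpow, mul_one]

theorem card_chainZ_le [Finite T] {q : ℕ} (hq : 0 < q) (hzq : z ^ q ∈ chain h m) :
    Nat.card (chainZ h m z) ≤ q * Nat.card (chain h m) := by
  have hz : z ∈ chainZ h m z := Subgroup.mem_zpowers _
  have hle : chain h m ≤ chainZ h m z := by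
    intro t ht
    have : QuotientGroup.mk' (chain h m) t = 1 := (QuotientGroup.eq_one_iff t).2 ht
    rw [chainZ, Subgroup.mem_comap, this]
    exact one_mem _
  let f : Fin q × chain h m → chainZ h m z := fun p =>
    ⟨z ^ (p.1 : ℕ) * p.2, mul_mem (pow_mem hz _) (hle p.2.2)⟩
  have hf : Function.Surjective f := by
    rintro ⟨t, ht⟩
    obtain ⟨j, hj, n, hn, rfl⟩ := exists_of_mem_chainZ hq hzq ht
    exact ⟨(⟨j, hj⟩, ⟨n, hn⟩), rfl⟩
  have := Nat.card_le_card_of_surjective f hf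
  rwa [Nat.card_prod, Nat.card_fin] at this

end chainZ

/-! ### The maximal subgroups of `Γ_e`: commutator subgroups, abelianizations and transfer kernels.
-/

namespace PCGroup
variable {e : ℕ}

theorem chain_two_le (e : ℕ) : chain (gen e) 2 ≤ commutator (PCGroup e) := by
  rw [chain, Subgroup.closure_le]
  rintro _ ⟨i, hi, rfl⟩
  have hc : ∀ a b : PCGroup e, a⁻¹ * b⁻¹ * a * b ∈ commutator (PCGroup e) := by
    intro a b
    have := Subgroup.commutator_mem_commutator (Subgroup.mem_top a⁻¹) (Subgroup.mem_top b⁻¹)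
    rwa [commutatorElement_def, inv_inv, inv_inv] at this
  rw [← buildGens_gen e]
  have hi' : 2 ≤ i := hi
  rcases i with _ | _ | _ | _ | _ | _ | _ | _ | i
  · omega
  · omega
  all_goals first | exact hc _ _ | exact one_mem _

theorem sat_of_comm {A : Type*} [CommGroup A] (e : ℕ) {u v : A} (hu : u ^ 3 = 1) (hv : v ^ 3 = 1) :
    (pcData 0 e 0 0).Sat fun i => if i = 0 then u else if i = 1 then v else 1 := by
  have hev : ∀ w : List ℕ, (∀ k ∈ w, 2 ≤ k) →
      ev (fun i => if i = 0 then u else if i = 1 then v else 1) w = 1 := by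
    intro w hw
    induction w with
    | nil => rfl
    | cons k w ih =>
      have := hw k (by simp)
      rw [ev_cons, ih fun i hi => hw i (by simp [hi]), if_neg (by omega), if_neg (by omega),
        one_mul]
  constructor
  · intro i
    rw [hev _ fun k hk => two_le_of_mem_pw hk]
    split_ifs <;> simp [hu, hv]
  · intro i j _
    rw [hev _ fun k hk => two_le_of_mem_cw hk, mul_one, mul_comm]

/-- The homomorphism to `ZMod 3` with given values at the first two generators. -/
def character (e : ℕ) (u v : ZMod 3) : PCGroup e →* Multiplicative (ZMod 3) :=
  lift (h := fun i => if i = 0 then Multiplicative.ofAdd u else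
      if i = 1 then Multiplicative.ofAdd v else 1)
    (fun i hi => by rw [if_neg (by omega), if_neg (by omega)])
    (sat_of_comm e (by revert u; decide) (by revert v; decide))

theorem character_gen (u v : ZMod 3) (i : ℕ) : character e u v (gen e i) =
    if i = 0 then Multiplicative.ofAdd u else if i = 1 then Multiplicative.ofAdd v else 1 :=
  lift_gen _ _ i

theorem character_of_mem {u v : ZMod 3} {g : PCGroup e} (hg : g ∈ chain (gen e) 2) :
    character e u v g = 1 := by
  have : chain (gen e) 2 ≤ (character e u v).ker := by
    rw [chain, Subgroup.closure_le]
    rintro _ ⟨i, hi, rfl⟩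
    have hi' : 2 ≤ i := hi
    change character e u v _ = 1
    rw [character_gen, if_neg (by omega), if_neg (by omega)]
  exact this hg

theorem mem_chain_two_of_character {g : PCGroup e} (h0 : character e 1 0 g = 1)
    (h1 : character e 0 1 g = 1) : g ∈ chain (gen e) 2 := by
  have H := model e
  obtain ⟨a, ha, n, hn, rfl⟩ := H.exists_pow_mul (k := 0) (t := g) (by rw [H.chain_zero]; trivial)
  obtain ⟨b, hb, m, hm, rfl⟩ := H.exists_pow_mul hn
  have key : ∀ u v : ZMod 3, character e u v (gen e 0 ^ a * (gen e (0 + 1) ^ b * m)) =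
      Multiplicative.ofAdd (a * u + b * v) := fun u v => by
    rw [map_mul, map_mul, map_pow, map_pow, character_of_mem hm, character_gen, character_gen,
      if_pos rfl, if_neg (by omega), if_pos rfl, mul_one, ← ofAdd_nsmul, ← ofAdd_nsmul, ← ofAdd_add,
      nsmul_eq_mul, nsmul_eq_mul]
  rw [key] at h0 h1
  have h0' := Multiplicative.ofAdd.injective (h0.trans ofAdd_zero.symm)
  have h1' := Multiplicative.ofAdd.injective (h1.trans ofAdd_zero.symm)
  simp only [mul_one, mul_zero, add_zero, zero_add, ZMod.natCast_eq_zero_iff] at h0' h1'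
  have ea : a = 0 := by omega
  have eb : b = 0 := by omega
  rw [ea, eb]
  simpa using hm

/-- The standard frame of `Γ_e`. -/
def frame (e : ℕ) : Frame (PCGroup e) where
  x := gen e 0
  y := gen e 1
  χ g := (character e 1 0 g).toAdd
  ψ g := (character e 0 1 g).toAdd
  χ_mul g h := by rw [map_mul, toAdd_mul]
  ψ_mul g h := by rw [map_mul, toAdd_mul]
  χ_cont := continuous_of_discreteTopology
  ψ_cont := continuous_of_discreteTopology
  χ_x := by rw [character_gen]; rfl
  χ_y := by rw [character_gen]; rfl
  ψ_x := by rw [character_gen]; rfl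
  ψ_y := by rw [character_gen]; rfl
  mem_closure g h0 h1 := by
    rw [topologicalClosure_of_discrete]
    exact chain_two_le e (mem_chain_two_of_character (Multiplicative.toAdd.injective h0)
      (Multiplicative.toAdd.injective h1))

theorem isProP {e : ℕ} (he : e = 0 ∨ e = 2) : IsProP 3 (PCGroup e) where
  compact := by
    have := (model e).finite
    infer_instance
  totallyDisconnected := inferInstance
  index_eq_pow U _ _ := by
    have h1 : U.index ∣ 3 ^ 8 := by
      rw [← card_eq he]
      exact Subgroup.index_dvd_card U
    obtain ⟨n, _, hn⟩ := (Nat.dvd_prime_pow Nat.prime_three).1 h1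
    exact ⟨n, hn⟩

theorem mem_chain_two_iff {g : PCGroup e} :
    g ∈ chain (gen e) 2 ↔ (frame e).χ g = 0 ∧ (frame e).ψ g = 0 := by
  constructor
  · intro h
    exact ⟨congrArg Multiplicative.toAdd (character_of_mem h),
      congrArg Multiplicative.toAdd (character_of_mem h)⟩
  · rintro ⟨h0, h1⟩
    exact mem_chain_two_of_character (Multiplicative.toAdd.injective h0)
      (Multiplicative.toAdd.injective h1)

/-- Words which describe a maximal subgroup and its commutator subgroup: a representative, its
commutators with the generators from the third on, and an element `z` which together with the
generators from the `m`-th on generates the commutator subgroup. -/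
structure LineData where
  rep : List ℕ
  com : List (List ℕ)
  z : List ℕ
  m : ℕ

def lineData : Fin 4 → LineData :=
  ![⟨[0], [[3], [], [6], [6], [], []], [3], 8⟩,
    ⟨[1], [[4], [], [5], [7], [], []], [4], 5⟩,
    ⟨[0, 1], [[3, 4], [], [5, 6], [6, 7], [], []], [3, 4], 5⟩,
    ⟨[0, 1, 1], [[3, 4, 4, 5], [], [5, 5, 6, 7], [6, 7, 7], [], []], [3, 4, 4], 5⟩]

theorem ev_rep (i : Fin 4) :
    ev (gen e) (lineData i).rep = (frame e).pt (Frame.dir i).1 (Frame.dir i).2 := by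
  fin_cases i <;> simp [lineData, Frame.pt, Frame.dir, frame, ZMod.val_one]
  exact (pow_two _).symm

theorem rep_mem (i : Fin 4) : ev (gen e) (lineData i).rep ∈ (frame e).line i := by
  rw [ev_rep, Frame.pt_mem_line]

theorem gen_mem_line (i : Fin 4) {k : ℕ} (hk : 2 ≤ k) : gen e k ∈ (frame e).line i := by
  obtain ⟨h0, h1⟩ := mem_chain_two_iff.1 (mem_chain (h := gen e) hk)
  rw [Frame.mem_line, h0, h1, mul_zero, mul_zero]

theorem line_le_of {M : Subgroup (PCGroup e)} {i : Fin 4} (h2 : ∀ k, 2 ≤ k → gen e k ∈ M)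
    (hr : ev (gen e) (lineData i).rep ∈ M) : (frame e).line i ≤ M := by
  refine (frame e).line_le ?_ (by rwa [← ev_rep])
  intro g hg
  have : g ∈ chain (gen e) 2 := mem_chain_two_iff.2 (((frame e).mem_closure_iff g).1 hg)
  refine (Subgroup.closure_le M).2 ?_ this
  rintro _ ⟨k, hk, rfl⟩
  exact h2 k hk

theorem ev_flatten_replicate {E : Type*} [Monoid E] (g : ℕ → E) (n : ℕ) (w : List ℕ) :
    ev g (List.replicate n w).flatten = ev g w ^ n := by
  induction n with
  | zero => simp
  | succ n ih => rw [List.replicate_succ, List.flatten_cons, ev_append, ih, pow_succ']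

/-- Words for generators of the commutator subgroup of a maximal subgroup, together with words for
generators of the maximal subgroup modulo that. -/
def token (i : Fin 4) : ℕ → List ℕ
  | 0 => (lineData i).rep
  | 1 => [2]
  | 2 => (lineData i).com.getD 0 []
  | 3 => (lineData i).com.getD 2 []
  | 4 => (lineData i).com.getD 3 []
  | _ => [6]

/-- The word with given exponents in the tokens. -/
def tokenWord (i : Fin 4) (a : List ℕ) : List ℕ :=
  (List.range 6).flatMap fun k => (List.replicate (a.getD k 0) (token i k)).flatten

theorem collect_com (he : e = 0 ∨ e = 2) : ∀ i : Fin 4, ∀ j < 6,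
    (pcData 0 e 0 0).collect ([j + 2] ++ (lineData i).rep) =
      (pcData 0 e 0 0).collect ((lineData i).rep ++ [j + 2] ++ (lineData i).com.getD j []) := by
  rcases he with rfl | rfl <;> decide +kernel

theorem ev_com (he : e = 0 ∨ e = 2) (i : Fin 4) {j : ℕ} (hj : j < 6) :
    gen e (j + 2) * ev (gen e) (lineData i).rep =
      ev (gen e) (lineData i).rep * gen e (j + 2) * ev (gen e) ((lineData i).com.getD j []) := by
  have := (sat_gen e).ev_eq (collect_com he i j hj)
  simpa [mul_assoc] using this

theorem token_mem (he : e = 0 ∨ e = 2) (i : Fin 4) {k : ℕ} (hk : 2 ≤ k) :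
    ev (gen e) (token i k) ∈ ⁅(frame e).line i, (frame e).line i⁆ := by
  have key : ∀ a b c : PCGroup e, a ∈ (frame e).line i → b ∈ (frame e).line i →
      a * b = b * a * c → c ∈ ⁅(frame e).line i, (frame e).line i⁆ := by
    intro a b c ha hb hc
    have := Subgroup.commutator_mem_commutator (inv_mem ha) (inv_mem hb)
    rw [commutatorElement_def, inv_inv, inv_inv, mul_assoc, hc] at this
    convert this using 1
    group
  have hcom : ∀ j, j < 6 → ev (gen e) ((lineData i).com.getD j []) ∈
      ⁅(frame e).line i, (frame e).line i⁆ := fun j hj =>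
    key _ _ _ (gen_mem_line i (by omega)) (rep_mem i) (ev_com he i hj)
  rcases k with _ | _ | _ | _ | _ | k
  · omega
  · omega
  · exact hcom 0 (by norm_num)
  · exact hcom 2 (by norm_num)
  · exact hcom 3 (by norm_num)
  · have := key (gen e 4) (gen e 2) (gen e 6) (gen_mem_line i (by omega))
      (gen_mem_line i (by omega)) (by simpa [pcData] using (sat_gen e).comm 2 4 (by norm_num))
    simpa [token] using this

theorem tokenWord_mem (i : Fin 4) {M : Subgroup (PCGroup e)} {a : List ℕ}
    (h : ∀ k, a.getD k 0 ≠ 0 → ev (gen e) (token i k) ∈ M) : ev (gen e) (tokenWord i a) ∈ M := by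
  rw [tokenWord, ev_flatMap]
  refine _root_.ev_mem fun k _ => ?_
  by_cases hk : a.getD k 0 = 0
  · rw [hk]
    exact one_mem _
  · rw [ev_flatten_replicate]
    exact pow_mem (h k hk) _

/-- The words for the generators from the fourth on in terms of the tokens, and the orders of the
first two tokens modulo the commutator subgroup with the corresponding words. -/
structure LineWords where
  gens : List (List ℕ)
  ord : ℕ
  ordWord : List ℕ
  ord₂ : ℕ
  ordWord₂ : List ℕ
  out : List ℕ
  cubeWord : List ℕ

def lineWords (e : ℕ) : Fin 4 → LineWords :=
  ![if e = 0 then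
      ⟨[[0, 0, 1], [21, 6, 0, 0, 0, 1], [18, 6, 0, 0, 0, 1], [0, 0, 0, 0, 0, 1], [18]],
        27, [], 9, [], [1], [0, 0, 2, 0, 0, 1]⟩
    else
      ⟨[[0, 0, 1], [12, 6, 0, 0, 0, 1], [18, 6, 0, 0, 0, 1], [0, 0, 0, 0, 0, 1], [18]],
        27, [], 9, [], [1], [0, 0, 1]⟩,
    ⟨[[3, 0, 0, 0, 2], [0, 0, 1], [0, 0, 0, 1], [0, 0, 0, 0, 0, 1], [0, 0, 0, 0, 1]],
      9, [0, 0, 0, 0, 0, 2], 3, [0, 0, 0, 2, 1, 1], [0, 1],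
      if e = 0 then [0, 0, 1, 2] else [0, 0, 1, 2, 2]⟩,
    ⟨[if e = 0 then [6, 0, 0, 0, 0, 2] else [6, 0, 0, 0, 2],
        if e = 0 then [3, 0, 1] else [3, 0, 1, 0, 1, 2],
        [0, 0, 0, 1, 0, 2], [0, 0, 0, 0, 0, 1], [0, 0, 0, 0, 1, 2]],
      9, [0, 0, 0, 0, 0, 1], 3, [0, 0, 0, 2, 1, 1], [0],
      if e = 0 then [0, 0, 2, 1, 0, 1] else [0, 0, 2, 1, 2, 2]⟩,
    ⟨[if e = 0 then [3, 0, 0, 0, 1, 2] else [3], if e = 0 then [3, 0, 2, 2, 2] else [3, 0, 2, 2, 1, 1],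
        [0, 0, 0, 2, 2, 2], [0, 0, 0, 0, 0, 1], [0, 0, 0, 0, 2, 1]],
      9, [0, 0, 0, 0, 0, 2], 3, [0, 0, 0, 1], [0],
      if e = 0 then [0, 0, 1, 0, 2, 1] else [0, 0, 1]⟩]

/-- The transfer kernel type. -/
def kernelType (e : ℕ) : Fin 4 → Fin 4 := ![if e = 0 then 2 else 3, 0, 2, 3]

theorem check_gens (he : e = 0 ∨ e = 2) : ∀ i : Fin 4, ∀ k < 5,
    (pcData 0 e 0 0).collect (tokenWord i ((lineWords e i).gens.getD k [])) = [k + 3] := by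
  rcases he with rfl | rfl <;> decide +kernel

theorem check_ord (he : e = 0 ∨ e = 2) : ∀ i : Fin 4,
    (pcData 0 e 0 0).collect (List.replicate (lineWords e i).ord (lineData i).rep).flatten =
      (pcData 0 e 0 0).collect (tokenWord i (lineWords e i).ordWord) ∧
    (pcData 0 e 0 0).collect (List.replicate (lineWords e i).ord₂ 2) =
      (pcData 0 e 0 0).collect (tokenWord i (lineWords e i).ordWord₂) := by
  rcases he with rfl | rfl <;> decide +kernel

/-- For `i ≠ kernelType e i` the representative of the kernel lies outside the line and its cube is
tested directly. When the two coincide it lies inside, where the transfer is not given by the cube;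
then the transfers of `out * rep` and `out` are compared instead. -/
theorem check_cube (he : e = 0 ∨ e = 2) : ∀ i : Fin 4,
    (kernelType e i = i →
      (pcData 0 e 0 0).collect (List.replicate 3 ((lineWords e i).out ++ (lineData i).rep)).flatten =
        (pcData 0 e 0 0).collect ((List.replicate 3 (lineWords e i).out).flatten ++
          tokenWord i (lineWords e i).cubeWord)) ∧
    (kernelType e i ≠ i →
      (pcData 0 e 0 0).collect (List.replicate 3 (lineData (kernelType e i)).rep).flatten =
        (pcData 0 e 0 0).collect (tokenWord i (lineWords e i).cubeWord)) := by
  rcases he with rfl | rfl <;> decide +kernel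

/-- As `z ^ 9 = 1`, an element of `⟨z⟩ N_m` falls into `N_m` after multiplication by some `z ^ j`
with `j < 9`; excluding all nine products excludes membership. -/
theorem check_notMem (he : e = 0 ∨ e = 2) : ∀ i : Fin 4, ∀ j < 9,
    leadingLt (lineData i).m ((pcData 0 e 0 0).collect
      ((List.replicate j (lineData i).z).flatten ++
        (List.replicate 3 (lineWords e i).out).flatten)) = true := by
  rcases he with rfl | rfl <;> decide +kernel

theorem check_z (he : e = 0 ∨ e = 2) : ∀ i : Fin 4,
    (∀ k < 8, ((pcData 0 e 0 0).collect ((lineData i).z ++ [k])).filter (Nat.blt · (lineData i).m) =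
      ((pcData 0 e 0 0).collect ([k] ++ (lineData i).z)).filter (Nat.blt · (lineData i).m)) ∧
    (pcData 0 e 0 0).collect (List.replicate 9 (lineData i).z).flatten = [] ∧
    ((lineData i).m = 5 →
      ((pcData 0 e 0 0).collect (List.replicate 3 (lineData i).z).flatten).all (Nat.ble 5 ·)) ∧
    ∀ j < 6, ∃ k < 9, ((pcData 0 e 0 0).collect
      ((List.replicate k (lineData i).z).flatten ++ (lineData i).com.getD j [])).all
        (Nat.ble (lineData i).m ·) := by
  rcases he with rfl | rfl <;> decide +kernel

/-- Representatives of the maximal subgroups are independent modulo the last commutators. -/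
theorem out_notMem (he : e = 0 ∨ e = 2) (i : Fin 4) :
    ev (gen e) (lineWords e i).out ∉ (frame e).line i := by
  have h0 : gen e 0 = (frame e).x := rfl
  have h1 : gen e 1 = (frame e).y := rfl
  rw [Frame.mem_line]
  rcases he with rfl | rfl <;> fin_cases i <;>
    simp [lineWords, Frame.dir, h0, h1, Frame.χ_mul, Frame.ψ_mul, Frame.χ_x, Frame.χ_y, Frame.ψ_x,
      Frame.ψ_y] <;> decide

end PCGroup

theorem PCData.ev_filter {E : Type*} [Monoid E] {g : ℕ → E} {p : ℕ → Bool}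
    (h : ∀ i, p i = false → g i = 1) (w : List ℕ) : ev g (w.filter p) = ev g w := by
  induction w with
  | nil => rfl
  | cons a w ih =>
    rcases hp : p a with _ | _
    · rw [List.filter_cons_of_neg (by simp [hp]), ih, ev_cons, h a hp, one_mul]
    · rw [List.filter_cons_of_pos hp, ev_cons, ih, ev_cons]

namespace PCGroup
variable {e : ℕ}

instance (e k : ℕ) : (chain (gen e) k).Normal := (model e).chain_normal k

/-- The commutator subgroup of a maximal subgroup. -/
def derived (e : ℕ) (i : Fin 4) : Subgroup (PCGroup e) :=
  chainZ (gen e) (lineData i).m (ev (gen e) (lineData i).z)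

theorem derived_normal (he : e = 0 ∨ e = 2) (i : Fin 4) : (derived e i).Normal := by
  refine chainZ_normal fun t => ?_
  have ht : t ∈ Subgroup.closure (Set.range (gen e)) := by rw [closure_gen]; trivial
  induction ht using Subgroup.closure_induction with
  | mem x hx =>
    obtain ⟨k, rfl⟩ := hx
    by_cases hk : k < 8
    · have h1 := (check_z he i).1 k hk
      let π := QuotientGroup.mk' (chain (gen e) (lineData i).m)
      have hπ : ∀ w, π (ev (gen e) w) = ev (fun i => π (gen e i))
          (((pcData 0 e 0 0).collect w).filter (Nat.blt · (lineData i).m)) := by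
        intro w
        rw [ev_filter, (sat_gen e).collect_eq, map_ev]
        intro j hj
        refine (QuotientGroup.eq_one_iff _).2 (mem_chain ?_)
        by_contra hlt
        rw [show Nat.blt j (lineData i).m = true by simpa using hlt] at hj
        exact absurd hj (by simp)
      have h2 := hπ ((lineData i).z ++ [k])
      rw [h1, ← hπ] at h2
      simp only [ev_append, ev_cons, ev_nil, mul_one] at h2
      exact h2.symm
    · rw [gen_of_le e (not_lt.1 hk)]
      simp
  | one => simp
  | mul x y _ _ hx hy => rw [QuotientGroup.mk_mul, mul_assoc, hy, ← mul_assoc, hx, mul_assoc]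
  | inv x _ hx =>
    rw [QuotientGroup.mk_inv, inv_mul_eq_iff_eq_mul, ← mul_assoc, hx, mul_inv_cancel_right]

theorem chain_le_derived (i : Fin 4) : chain (gen e) (lineData i).m ≤ derived e i := by
  intro t ht
  have : QuotientGroup.mk' (chain (gen e) (lineData i).m) t = 1 := (QuotientGroup.eq_one_iff t).2 ht
  rw [derived, chainZ, Subgroup.mem_comap, this]
  exact one_mem _

theorem z_mem_derived (i : Fin 4) : ev (gen e) (lineData i).z ∈ derived e i :=
  Subgroup.mem_zpowers _

theorem com_mem_derived (he : e = 0 ∨ e = 2) (i : Fin 4) {j : ℕ} (hj : j < 6) :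
    ev (gen e) ((lineData i).com.getD j []) ∈ derived e i := by
  obtain ⟨k, -, hk⟩ := (check_z he i).2.2.2 j hj
  have := chain_le_derived i ((model e).ev_mem hk)
  rw [ev_append, ev_flatten_replicate] at this
  exact (Subgroup.mul_mem_cancel_left _ (pow_mem (z_mem_derived i) k)).1 this

theorem six_mem_derived (he : e = 0 ∨ e = 2) (i : Fin 4) : gen e 6 ∈ derived e i := by
  fin_cases i
  · have := com_mem_derived he 0 (j := 2) (by norm_num)
    simpa [lineData] using this
  all_goals exact chain_le_derived _ (mem_chain (by decide))

theorem commutator_le_derived (he : e = 0 ∨ e = 2) (i : Fin 4) :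
    ⁅(frame e).line i, (frame e).line i⁆ ≤ derived e i := by
  have hN := derived_normal he i
  let S : Set (PCGroup e) := insert (ev (gen e) (lineData i).rep) (gen e '' Set.Ici 2)
  have hS : (frame e).line i ≤ Subgroup.closure S :=
    line_le_of (fun k hk => Subgroup.subset_closure (Or.inr ⟨k, hk, rfl⟩))
      (Subgroup.subset_closure (Or.inl rfl))
  refine (Subgroup.commutator_mono hS hS).trans (commutator_closure_le ?_)
  have key : ∀ a b c : PCGroup e, a * b = b * a * c → c ∈ derived e i →
      (a : PCGroup e ⧸ derived e i) * b = b * a := by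
    intro a b c h hc
    rw [← QuotientGroup.mk_mul, h, QuotientGroup.mk_mul, QuotientGroup.mk_mul,
      (QuotientGroup.eq_one_iff c).2 hc, mul_one]
  have hr : ∀ k, 2 ≤ k → (gen e k : PCGroup e ⧸ derived e i) * ev (gen e) (lineData i).rep =
      ev (gen e) (lineData i).rep * gen e k := by
    intro k hk
    by_cases hk8 : k < 8
    · obtain ⟨j, rfl⟩ := Nat.exists_eq_add_of_le' hk
      exact key _ _ _ (ev_com he i (by omega)) (com_mem_derived he i (by omega))
    · rw [gen_of_le e (not_lt.1 hk8)]
      simp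
  have hg : ∀ j k, 2 ≤ j → j < k → (gen e k : PCGroup e ⧸ derived e i) * gen e j =
      gen e j * gen e k := by
    intro j k hj hjk
    refine key _ _ _ ((sat_gen e).comm j k hjk) (_root_.ev_mem fun l hl => ?_)
    have : l = 6 := by
      rcases lt_or_ge k 8 with hk | hk
      · interval_cases k <;> interval_cases j <;> simp [pcData] at hl; exact hl
      · rw [(pcData_bounded 0 e 0 0).cw k j hk] at hl
        simp at hl
    rw [this]
    exact six_mem_derived he i
  rintro a (rfl | ⟨k, hk, rfl⟩) b (rfl | ⟨l, hl, rfl⟩)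
  · rfl
  · exact (hr l hl).symm
  · exact hr k hk
  · rcases lt_trichotomy k l with h | rfl | h
    · exact (hg k l hk h).symm
    · rfl
    · exact hg l k hl h

theorem card_derived_le (he : e = 0 ∨ e = 2) (i : Fin 4) :
    (lineWords e i).ord * (lineWords e i).ord₂ * Nat.card (derived e i) ≤ 3 ^ 7 := by
  have := (model e).finite
  have h9 : ev (gen e) (lineData i).z ^ 9 ∈ chain (gen e) (lineData i).m := by
    have := (sat_gen e).collect_eq (List.replicate 9 (lineData i).z).flatten
    rw [(check_z he i).2.1, ev_flatten_replicate] at this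
    rw [this]
    exact one_mem _
  have hc := fun k hk => (model e).card_chain (card_eq he) (k := k) hk
  have h3 : (lineData i).m = 5 → ev (gen e) (lineData i).z ^ 3 ∈ chain (gen e) (lineData i).m := by
    intro hm
    rw [hm]
    have := (model e).ev_mem ((check_z he i).2.2.1 hm)
    rwa [ev_flatten_replicate] at this
  have k3 : (lineData i).m = 5 → Nat.card (derived e i) ≤ 3 * 27 := by
    intro hm
    have := card_chainZ_le (by norm_num) (h3 hm)
    have hcm : Nat.card (chain (gen e) (lineData i).m) = 27 := by
      rw [hm]
      exact hc 5 (by norm_num)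
    rw [hcm] at this
    exact this
  have k9 := card_chainZ_le (by norm_num) h9
  fin_cases i
  · rw [hc _ (by decide)] at k9
    change _ * Nat.card (derived e 0) ≤ _
    have k9 : Nat.card (derived e 0) ≤ 9 * 1 := k9
    rcases he with rfl | rfl <;> change 27 * 9 * _ ≤ _ <;> omega
  all_goals
    have := k3 rfl
    revert this
    generalize Nat.card _ = N
    intro this
    change 9 * 3 * N ≤ _
    omega

/-- The line has order `3^7`, and `card_derived_le` bounds its commutator subgroup from above. -/
theorem ab_card_ge (he : e = 0 ∨ e = 2) (i : Fin 4) :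
    (lineWords e i).ord * (lineWords e i).ord₂ ≤
      Nat.card (TopologicalAbelianization ((frame e).line i)) := by
  have := (model e).finite
  let M := (frame e).line i
  have h1 : Nat.card M * 3 = 3 ^ 8 := by
    rw [← card_eq he, ← (frame e).index_line i]
    exact Subgroup.card_mul_index M
  have h2 : Nat.card (TopologicalAbelianization M) * Nat.card (⁅M, M⁆ : Subgroup (PCGroup e)) = Nat.card M := by
    have h3 := Subgroup.card_mul_index (commutator M)
    rw [← Subgroup.map_subtype_commutator M, Subgroup.card_map_of_injective M.subtype_injective,
      mul_comm, TopologicalAbelianization, topologicalClosure_of_discrete, ← Subgroup.index_eq_card]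
    exact h3
  have h3 : Nat.card (⁅M, M⁆ : Subgroup (PCGroup e)) ≤ Nat.card (derived e i) :=
    Nat.card_le_card_of_injective _ (Subgroup.inclusion_injective (commutator_le_derived he i))
  have h4 := card_derived_le he i
  have h5 : 0 < Nat.card (⁅M, M⁆ : Subgroup (PCGroup e)) := Nat.card_pos
  by_contra! hlt
  have : Nat.card (TopologicalAbelianization M) * Nat.card (⁅M, M⁆ : Subgroup (PCGroup e)) <
      (lineWords e i).ord * (lineWords e i).ord₂ * Nat.card (⁅M, M⁆ : Subgroup (PCGroup e)) :=
    Nat.mul_lt_mul_of_pos_right hlt h5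
  have := Nat.mul_le_mul_left ((lineWords e i).ord * (lineWords e i).ord₂) h3
  omega

theorem mk_pow_eq {G : Type*} [Group G] [TopologicalSpace G] [IsTopologicalGroup G]
    [DiscreteTopology G] {M : Subgroup G} {a b : G} (ha : a ∈ M) (hb : b ∈ M) {c : G}
    (hc : c ∈ ⁅M, M⁆) (h : a = b * c) :
    (QuotientGroup.mk (⟨a, ha⟩ : M) : TopologicalAbelianization M) = QuotientGroup.mk ⟨b, hb⟩ := by
  rw [eq_comm, QuotientGroup.eq, topologicalClosure_of_discrete]
  have : (⟨b, hb⟩ : M)⁻¹ * ⟨a, ha⟩ = ⟨b⁻¹ * a, mul_mem (inv_mem hb) ha⟩ := rfl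
  rw [this, mem_commutator_subtype, h, inv_mul_cancel_left]
  exact hc

theorem tokenWord_mem_commutator (he : e = 0 ∨ e = 2) (i : Fin 4) {a : List ℕ}
    (h0 : a.getD 0 0 = 0) (h1 : a.getD 1 0 = 0) :
    ev (gen e) (tokenWord i a) ∈ ⁅(frame e).line i, (frame e).line i⁆ := by
  refine tokenWord_mem i fun k hk => token_mem he i ?_
  rcases k with _ | _ | k
  · exact (hk h0).elim
  · exact (hk h1).elim
  · omega

theorem ordWords_getD (e : ℕ) : ∀ i : Fin 4, (lineWords e i).ordWord.getD 0 0 = 0 ∧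
    (lineWords e i).ordWord.getD 1 0 = 0 ∧ (lineWords e i).ordWord₂.getD 0 0 = 0 ∧
    (lineWords e i).ordWord₂.getD 1 0 = 0 ∧ (lineWords e i).cubeWord.getD 0 0 = 0 ∧
    (lineWords e i).cubeWord.getD 1 0 = 0 := by
  intro i
  fin_cases i <;> by_cases he : e = 0 <;> simp [lineWords, he]

/-- The abelianization is generated by the representative and `g_2`, since `check_gens` expresses
the other generators by these and by commutators of the line. The orders of the two divide `ord` and
`ord₂`, and `ab_card_ge` leaves no room for further relations. -/
theorem nonempty_ab_mulEquiv (he : e = 0 ∨ e = 2) (i : Fin 4) :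
    Nonempty (TopologicalAbelianization ((frame e).line i) ≃*
      AbelianOfType [(lineWords e i).ord₂, (lineWords e i).ord]) := by
  let M := (frame e).line i
  have hw := ordWords_getD e i
  let π : M →* TopologicalAbelianization M := QuotientGroup.mk' _
  let r : M := ⟨_, rep_mem i⟩
  let s : M := ⟨_, gen_mem_line (e := e) i (le_refl 2)⟩
  have n1 : NeZero (lineWords e i).ord := ⟨by fin_cases i <;> rcases he with rfl | rfl <;> decide⟩
  have n2 : NeZero (lineWords e i).ord₂ := ⟨by fin_cases i <;> rcases he with rfl | rfl <;> decide⟩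
  have h1 : π r ^ (lineWords e i).ord = 1 := by
    have := (sat_gen e).ev_eq (check_ord he i).1
    rw [ev_flatten_replicate] at this
    rw [← map_pow, ← map_one π]
    refine mk_pow_eq _ (one_mem _) (tokenWord_mem_commutator he i hw.1 hw.2.1) ?_
    rw [one_mul, ← this]
  have h2 : π s ^ (lineWords e i).ord₂ = 1 := by
    have := (sat_gen e).ev_eq (check_ord he i).2
    rw [ev_replicate] at this
    rw [← map_pow, ← map_one π]
    refine mk_pow_eq _ (one_mem _) (tokenWord_mem_commutator he i hw.2.2.1 hw.2.2.2.1) ?_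
    rw [one_mul, ← this]
  refine nonempty_mulEquiv_abelianOfType h2 h1 ?_ (by rw [mul_comm]; exact ab_card_ge he i)
  -- The preimage in `Γ_e` of the subgroup generated by the two classes; it has to be shown to
  -- contain the whole line.
  let D : Subgroup (PCGroup e) := ((Subgroup.closure {π s, π r}).comap π).map M.subtype
  have hD : M ≤ D := by
    have hr : ev (gen e) (lineData i).rep ∈ D := ⟨r, Subgroup.subset_closure (by simp), rfl⟩
    have hs : gen e 2 ∈ D := ⟨s, Subgroup.subset_closure (by simp), rfl⟩
    have hcD : ⁅M, M⁆ ≤ D := by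
      intro c hc
      refine ⟨⟨c, Subgroup.commutator_le_self M hc⟩, ?_, rfl⟩
      have : π ⟨c, Subgroup.commutator_le_self M hc⟩ = π 1 :=
        mk_pow_eq _ (one_mem _) hc (one_mul c).symm
      refine Subgroup.mem_comap.2 ?_
      rw [this, map_one]
      exact one_mem _
    have htok : ∀ a, ev (gen e) (tokenWord i a) ∈ D := fun a => tokenWord_mem i fun k _ => by
      rcases k with _ | _ | k
      · exact hr
      · simpa [token] using hs
      · exact hcD (token_mem he i (by omega))
    refine line_le_of (fun k hk => ?_) hr
    rcases hk.eq_or_lt with rfl | hk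
    · exact hs
    · by_cases hk8 : k < 8
      · obtain ⟨j, rfl⟩ := Nat.exists_eq_add_of_le' (show 3 ≤ k from hk)
        have := (sat_gen e).collect_eq (tokenWord i ((lineWords e i).gens.getD j []))
        rw [check_gens he i j (by omega)] at this
        have h3 := htok ((lineWords e i).gens.getD j [])
        rw [this] at h3
        simpa using h3
      · rw [gen_of_le e (not_lt.1 hk8)]
        exact one_mem _
  rw [eq_top_iff]
  intro q _
  obtain ⟨m, rfl⟩ := QuotientGroup.mk_surjective q
  obtain ⟨m', hm', h⟩ := hD m.2
  rw [show m' = m from Subtype.ext h] at hm'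
  exact hm'

theorem orders (he : e = 0 ∨ e = 2) (i : Fin 4) :
    [(lineWords e i).ord₂, (lineWords e i).ord] = if i = 0 then [9, 27] else [3, 9] := by
  fin_cases i <;> rcases he with rfl | rfl <;> rfl

theorem hasTransferTargetType (he : e = 0 ∨ e = 2) :
    HasTransferTargetType (PCGroup e) ![[3, 9], [3, 9], [3, 9], [9, 27]] := by
  refine ⟨(finRotate 4).trans ((frame e).maximal (isProP he)), fun i => ?_⟩
  have := nonempty_ab_mulEquiv he (finRotate 4 i)
  rw [orders he] at this
  fin_cases i <;> exact this

theorem cubeTrivial_iff (i : Fin 4) (n : PCGroup e) :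
    (frame e).CubeTrivial i n ↔ n ^ 3 ∈ ⁅(frame e).line i, (frame e).line i⁆ := by
  rw [Frame.CubeTrivial, topologicalClosure_of_discrete, mem_commutator_subtype]

theorem out_cube_notMem (he : e = 0 ∨ e = 2) (i : Fin 4) :
    ev (gen e) (lineWords e i).out ^ 3 ∉ derived e i := by
  intro h
  have h9 : ev (gen e) (lineData i).z ^ 9 = 1 := by
    have := (sat_gen e).collect_eq (List.replicate 9 (lineData i).z).flatten
    rwa [(check_z he i).2.1, ev_flatten_replicate] at this
  obtain ⟨j, hj, n, hn, h⟩ := exists_of_mem_chainZ (q := 9) (by norm_num) (by rw [h9]; exact one_mem _) h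
  refine (model e).ev_notMem (card_eq he) (check_notMem he i ((9 - j) % 9)
    (Nat.mod_lt _ (by norm_num))) ?_
  rw [ev_append, ev_flatten_replicate, ev_flatten_replicate, h, ← mul_assoc, ← pow_add]
  have : ev (gen e) (lineData i).z ^ ((9 - j) % 9 + j) = 1 := by
    rcases Nat.eq_zero_or_pos j with rfl | hj0
    · exact pow_zero _
    · rw [Nat.mod_eq_of_lt (by omega), Nat.sub_add_cancel hj.le, h9]
  rwa [this, one_mul]

theorem out_notMem_ker (he : e = 0 ∨ e = 2) (i : Fin 4) :
    (QuotientGroup.mk (ev (gen e) (lineWords e i).out) : TopologicalAbelianization (PCGroup e)) ∉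
      ((frame e).maximal (isProP he) i).transfer.ker := by
  rw [(frame e).mem_ker_transfer_iff (isProP he) (out_notMem he i), cubeTrivial_iff]
  exact fun h => out_cube_notMem he i (commutator_le_derived he i h)

theorem ker_transfer (he : e = 0 ∨ e = 2) (i : Fin 4) :
    ((frame e).maximal (isProP he) i).transfer.ker =
      ((frame e).maximal (isProP he) (kernelType e i)).image := by
  refine (frame e).ker_transfer_eq (isProP he) ?_ (out_notMem_ker he i)
  have hw := ordWords_getD e i
  have hc := tokenWord_mem_commutator he i hw.2.2.2.2.1 hw.2.2.2.2.2
  rw [← ev_rep]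
  by_cases hk : kernelType e i = i
  · have h1 := (sat_gen e).ev_eq ((check_cube he i).1 hk)
    rw [hk]
    rw [ev_append, ev_flatten_replicate, ev_flatten_replicate, ev_append] at h1
    have h2 : ev (gen e) (lineWords e i).out * ev (gen e) (lineData i).rep ∉ (frame e).line i := by
      rw [Subgroup.mul_mem_cancel_right _ (rep_mem i)]
      exact out_notMem he i
    have h3 := (frame e).transfer_of_notMem (isProP he) h2
    replace h3 := h3.trans
      (mk_pow_eq _ ((frame e).pow_three_mem_line i (ev (gen e) (lineWords e i).out)) hc h1)
    replace h3 := h3.trans ((frame e).transfer_of_notMem (isProP he) (out_notMem he i)).symm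
    rw [MonoidHom.mem_ker]
    have h4 : ((frame e).maximal (isProP he) i).transfer
        (QuotientGroup.mk (ev (gen e) (lineWords e i).out) *
          QuotientGroup.mk (ev (gen e) (lineData i).rep)) = _ := h3
    rwa [map_mul, mul_eq_left] at h4
  · have h1 := (sat_gen e).ev_eq ((check_cube he i).2 hk)
    rw [ev_flatten_replicate] at h1
    rw [(frame e).mem_ker_transfer_iff (isProP he), cubeTrivial_iff, h1]
    · exact hc
    · rw [ev_rep, Frame.pt_mem_line]
      exact fun h => hk h.symm

theorem hasTransferKernelType (he : e = 0 ∨ e = 2) :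
    HasTransferKernelType (PCGroup e) ![1, 4, 3, 1] := by
  -- In the type `(1,4,3,1)` there is a chain `2 ↦ 4 ↦ 1` ending in a fixed label, and a second
  -- fixed label `3`. The corresponding chain of lines is `1 ↦ 0 ↦ 2` for `e = 0` and `1 ↦ 0 ↦ 3`
  -- for `e = 2`.
  let p : Equiv.Perm (Fin 4) :=
    if e = 0 then ⟨![2, 1, 3, 0], ![3, 1, 0, 2], by decide, by decide⟩
    else ⟨![3, 1, 2, 0], ![3, 1, 2, 0], by decide, by decide⟩
  refine ⟨p.trans ((frame e).maximal (isProP he)), fun i => ?_⟩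
  refine (ker_transfer he (p i)).trans ?_
  rcases he with rfl | rfl <;> fin_cases i <;> rfl

end PCGroup

/-! ### The involution, the Schur property and the derived length. -/

namespace PCGroup
variable {e : ℕ}

/-- Words for the images of the generators under an involution which inverts the abelianization. -/
def sigmaWord (e : ℕ) : ℕ → List ℕ
  | 0 => [0, 0, 4, 4, 5, 7] ++ (if e = 0 then [] else [7])
  | 1 => [1, 1, 3, 3, 6, 7, 7]
  | 2 => [2, 3, 3, 4, 4, 5, 6]
  | 3 => [3, 3, 6]
  | 4 => [4, 4, 5, 5, 7]
  | 5 => [5]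
  | 6 => [6, 6]
  | 7 => [7, 7]
  | _ => []

theorem check_sigma (he : e = 0 ∨ e = 2) :
    (pcData 0 e 0 0).checkSubst (pcData 0 e 0 0) (sigmaWord e) = true := by
  rcases he with rfl | rfl <;> decide +kernel

theorem check_sigma_sigma (he : e = 0 ∨ e = 2) : ∀ i < 8,
    (pcData 0 e 0 0).collect ((sigmaWord e i).flatMap (sigmaWord e)) = [i] := by
  rcases he with rfl | rfl <;> decide +kernel

theorem sigmaWord_of_le {i : ℕ} (hi : 8 ≤ i) : sigmaWord e i = [] := by
  obtain ⟨k, rfl⟩ := Nat.exists_eq_add_of_le' hi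
  rfl

theorem exists_sigma (he : e = 0 ∨ e = 2) :
    ∃ σ : PCGroup e ≃ₜ* PCGroup e, (∃ x, σ x ≠ x) ∧ (∀ x, σ (σ x) = x) ∧
      ∀ x, (QuotientGroup.mk (σ x) : TopologicalAbelianization (PCGroup e)) =
        (QuotientGroup.mk x)⁻¹ := by
  have hs := (sat_gen e).subst (pcData_bounded 0 e 0 0) (fun i => sigmaWord_of_le (i := i))
    (check_sigma he)
  have h8 : ∀ i, 8 ≤ i → ev (gen e) (sigmaWord e i) = 1 := fun i hi => by
    rw [sigmaWord_of_le hi, ev_nil]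
  let s : PCGroup e →* PCGroup e := lift h8 hs
  have hss : ∀ x, s (s x) = x := by
    have : s.comp s = MonoidHom.id _ := by
      refine hom_ext fun i => ?_
      rw [MonoidHom.comp_apply, lift_gen, map_ev]
      simp only [s, lift_gen]
      rw [← ev_flatMap]
      by_cases hi : i < 8
      · rw [(sat_gen e).collect_eq, check_sigma_sigma he i hi]
        simp
      · rw [sigmaWord_of_le (not_lt.1 hi), gen_of_le e (not_lt.1 hi)]
        rfl
    exact fun x => DFunLike.congr_fun this x
  have hχ : ∀ u v x, character e u v (s x) = (character e u v x)⁻¹ := by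
    intro u v
    have : (character e u v).comp s = (character e u v)⁻¹ := by
      refine hom_ext fun i => ?_
      rw [MonoidHom.comp_apply, lift_gen, map_ev, MonoidHom.inv_apply]
      simp only [character_gen]
      have h3 : ∀ a : ZMod 3, Multiplicative.ofAdd a * Multiplicative.ofAdd a =
          (Multiplicative.ofAdd a)⁻¹ := by decide
      rcases i with _ | _ | i
      · by_cases h : e = 0 <;> simp [sigmaWord, h, h3]
      · simp [sigmaWord, h3]
      · have : ev (fun j => if j = 0 then Multiplicative.ofAdd u else
            if j = 1 then Multiplicative.ofAdd v else 1) (sigmaWord e (i + 2)) = 1 := by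
          rcases i with _ | _ | _ | _ | _ | _ | i <;> simp [sigmaWord]
        rw [this]
        simp
    exact fun x => DFunLike.congr_fun this x
  refine ⟨{ toFun := s, invFun := s, left_inv := hss, right_inv := hss, map_mul' := map_mul s
            continuous_toFun := continuous_of_discreteTopology
            continuous_invFun := continuous_of_discreteTopology }, ⟨gen e 0, fun h => ?_⟩, hss,
    fun x => ?_⟩
  · have h1 := hχ 1 0 (gen e 0)
    rw [show s (gen e 0) = gen e 0 from h, character_gen] at h1
    exact absurd h1 (by decide)
  · change QuotientGroup.mk (s x) = _
    rw [← QuotientGroup.mk_inv, QuotientGroup.eq]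
    refine (frame e).mem_closure _ ?_ ?_
    · change ((character e 1 0) _).toAdd = 0
      rw [map_mul, map_inv, map_inv, hχ]
      simp
    · change ((character e 0 1) _).toAdd = 0
      rw [map_mul, map_inv, map_inv, hχ]
      simp

theorem nonempty_abelianization_mulEquiv (e : ℕ) :
    Nonempty (TopologicalAbelianization (PCGroup e) ≃* AbelianOfType [3, 3]) := by
  let F := frame e
  let π : PCGroup e →* TopologicalAbelianization (PCGroup e) :=
    QuotientGroup.mk' (commutator (PCGroup e)).topologicalClosure
  have hπ : ∀ g, π (g ^ 3) = 1 := fun g => (QuotientGroup.eq_one_iff _).2 (F.pow_three_mem g)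
  refine nonempty_mulEquiv_abelianOfType (u := π F.x) (v := π F.y)
    (by rw [← map_pow, hπ]) (by rw [← map_pow, hπ]) ?_ ?_
  · rw [eq_top_iff]
    intro q _
    obtain ⟨g, rfl⟩ := QuotientGroup.mk_surjective q
    have h1 : π (F.pt (F.χ g) (F.ψ g)) = π g := QuotientGroup.eq.2 (F.pt_inv_mul_mem g)
    change π g ∈ _
    rw [← h1, Frame.pt, map_mul, map_pow, map_pow]
    exact mul_mem (pow_mem (Subgroup.subset_closure (by simp)) _)
      (pow_mem (Subgroup.subset_closure (by simp)) _)
  · have hfin := (model e).finite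
    have : Finite (TopologicalAbelianization (PCGroup e)) :=
      Finite.of_surjective π (QuotientGroup.mk'_surjective _)
    have hinj : Function.Injective fun p : ZMod 3 × ZMod 3 => π (F.pt p.1 p.2) := by
      rintro ⟨a, b⟩ ⟨c, d⟩ h
      have h1 := QuotientGroup.eq.1 h
      obtain ⟨h2, h3⟩ := (F.mem_closure_iff _).1 h1
      rw [F.χ_mul, F.χ_inv, F.χ_pt, F.χ_pt, neg_add_eq_zero] at h2
      rw [F.ψ_mul, F.ψ_inv, F.ψ_pt, F.ψ_pt, neg_add_eq_zero] at h3
      exact Prod.ext h2 h3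
    have := Nat.card_le_card_of_injective _ hinj
    rwa [Nat.card_prod, Nat.card_zmod] at this

theorem isSchurSigmaGroup (he : e = 0 ∨ e = 2) : IsSchurSigmaGroup 3 (PCGroup e) where
  isProP := isProP he
  generatorRank_eq_relationRank := by
    rw [(frame e).generatorRank_eq_two (isProP he),
      (frame e).relationRank_eq_two (cocyclesLift he)]
  finite_abelianization := by
    have := (model e).finite
    exact Finite.of_surjective _ (QuotientGroup.mk'_surjective _)
  exists_sigma := exists_sigma he

theorem satisfiesConditions (he : e = 0 ∨ e = 2) : SatisfiesConditions (PCGroup e) where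
  isSchurSigmaGroup := isSchurSigmaGroup he
  abelianization := nonempty_abelianization_mulEquiv e
  transferTargetType := hasTransferTargetType he
  transferKernelType := hasTransferKernelType he

theorem comm_mem_commutator {G : Type*} [Group G] {H : Subgroup G} {a b c : G} (ha : a ∈ H)
    (hb : b ∈ H) (h : a * b = b * a * c) : c ∈ ⁅H, H⁆ := by
  have := Subgroup.commutator_mem_commutator (inv_mem ha) (inv_mem hb)
  rw [commutatorElement_def, inv_inv, inv_inv, mul_assoc, h] at this
  convert this using 1
  group

/-- The first derived subgroup is `N_2`. The second contains `g_6 = [g_4, g_2] ≠ 1` and is contained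
in the abelian group `N_6`. -/
theorem hasDerivedLength (he : e = 0 ∨ e = 2) : HasDerivedLength (PCGroup e) 3 := by
  have H := model e
  have s1 : closedDerivedSeries (PCGroup e) 1 = chain (gen e) 2 := by
    have : closedDerivedSeries (PCGroup e) 1 = (commutator (PCGroup e)).topologicalClosure := rfl
    rw [this]
    ext g
    rw [(frame e).mem_closure_iff, mem_chain_two_iff]
  have s2 : closedDerivedSeries (PCGroup e) 2 = ⁅chain (gen e) 2, chain (gen e) 2⁆ := by
    rw [← s1]
    exact topologicalClosure_of_discrete _
  have s3 : closedDerivedSeries (PCGroup e) 3 =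
      ⁅⁅chain (gen e) 2, chain (gen e) 2⁆, ⁅chain (gen e) 2, chain (gen e) 2⁆⁆ := by
    rw [← s2]
    exact topologicalClosure_of_discrete _
  have g6 : gen e 6 ≠ 1 := by
    intro h
    refine (H.notMem_chain (card_eq he) (k := 6) (by norm_num)) ?_
    rw [h]
    exact one_mem _
  have h42 : gen e 4 * gen e 2 = gen e 2 * gen e 4 * gen e 6 := by
    simpa [pcData] using (sat_gen e).comm 2 4 (by norm_num)
  have m2 : gen e 6 ∈ closedDerivedSeries (PCGroup e) 2 := by
    rw [s2]
    exact comm_mem_commutator (mem_chain (by norm_num)) (mem_chain (by norm_num)) h42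
  have hne : ∀ {S : Subgroup (PCGroup e)}, gen e 6 ∈ S → S ≠ ⊥ := by
    rintro S hS rfl
    exact g6 hS
  refine ⟨?_, fun m hm => ?_⟩
  · rw [s3]
    have hle : ⁅chain (gen e) 2, chain (gen e) 2⁆ ≤ chain (gen e) 6 := by
      refine commutator_closure_le ?_
      have hg : ∀ j k, 2 ≤ j → j < k → (gen e k : PCGroup e ⧸ chain (gen e) 6) * gen e j =
          gen e j * gen e k := by
        intro j k hj hjk
        rw [← QuotientGroup.mk_mul, (sat_gen e).comm j k hjk, QuotientGroup.mk_mul,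
          (QuotientGroup.eq_one_iff (ev _ _)).2 (ev_mem_chain fun l hl => ?_), mul_one,
          QuotientGroup.mk_mul]
        rcases lt_or_ge k 8 with hk | hk
        · interval_cases k <;> interval_cases j <;> simp [pcData] at hl; exact hl.ge
        · rw [(pcData_bounded 0 e 0 0).cw k j hk] at hl
          simp at hl
      rintro _ ⟨k, hk, rfl⟩ _ ⟨l, hl, rfl⟩
      rcases lt_trichotomy k l with h | rfl | h
      · exact (hg k l hk h).symm
      · rfl
      · exact hg l k hl h
    rw [eq_bot_iff]
    refine (Subgroup.commutator_mono hle hle).trans ?_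
    have h8 : chain (gen e) 8 = ⊥ := H.chain_eq_bot le_rfl
    rw [← h8]
    refine commutator_closure_le ?_
    have h67 : gen e 7 * gen e 6 = gen e 6 * gen e 7 := by
      simpa [pcData] using (sat_gen e).comm 6 7 (by norm_num)
    rintro _ ⟨k, hk, rfl⟩ _ ⟨l, hl, rfl⟩
    rw [← QuotientGroup.mk_mul, ← QuotientGroup.mk_mul]
    congr 1
    have hk' : 6 ≤ k := hk
    have hl' : 6 ≤ l := hl
    by_cases hk8 : k < 8
    · by_cases hl8 : l < 8
      · interval_cases k <;> interval_cases l <;> simp [h67]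
      · simp [gen_of_le e (not_lt.1 hl8)]
    · simp [gen_of_le e (not_lt.1 hk8)]
  · interval_cases m
    · exact hne (Subgroup.mem_top _)
    · rw [s1]
      exact hne (mem_chain (by norm_num))
    · exact hne m2

end PCGroup

/-! ### `Γ_0` and `Γ_2` are not isomorphic. -/

/-- The action of a group by conjugation on the abelianization of a normal subgroup. -/
def conjAb {G : Type*} [Group G] (M : Subgroup G) [M.Normal] (g : G) :
    AddMonoid.End (Additive (Abelianization M)) :=
  MonoidHom.toAdditive (Abelianization.map (MulAut.conjNormal g⁻¹ : MulAut M).toMonoidHom)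

/-- The class of an element in the abelianization, written additively. -/
def abOf {G : Type*} [Group G] {M : Subgroup G} (m : M) : Additive (Abelianization M) :=
  Additive.ofMul (Abelianization.of m)

section conjAb
variable {G : Type*} [Group G] {M : Subgroup G}

theorem abOf_mul (a b : M) : abOf (a * b) = abOf a + abOf b := rfl

theorem abOf_eq_zero {m : M} : abOf m = 0 ↔ (m : G) ∈ ⁅M, M⁆ := by
  rw [← mem_commutator_subtype m.2]
  exact QuotientGroup.eq_one_iff m

variable [M.Normal]

theorem conjAb_abOf (g : G) (m : M) : conjAb M g (abOf m) =
    abOf ⟨g⁻¹ * m * g, by simpa using ‹M.Normal›.conj_mem m.1 m.2 g⁻¹⟩ := by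
  have : conjAb M g (abOf m) = abOf ((MulAut.conjNormal g⁻¹ : MulAut M) m) := rfl
  rw [this]
  congr 1
  exact Subtype.ext (by simp)

/-- The action is `m ↦ g⁻¹ m g`, so subtracting 1 gives the class of the commutator `[m, g]`;
iterating it produces the iterated commutators of the presentation. -/
theorem conjAb_sub_one {g : G} {m w : M} (h : (m : G) * g = g * m * w) :
    (conjAb M g - 1) (abOf m) = abOf w := by
  have : (conjAb M g - 1) (abOf m) = conjAb M g (abOf m) - abOf m := rfl
  rw [this, conjAb_abOf, sub_eq_iff_eq_add', ← abOf_mul]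
  congr 1
  refine Subtype.ext ?_
  change g⁻¹ * (m : G) * g = m * w
  rw [mul_assoc, h]
  group

/-- The order is reversed, since this is a right action. -/
theorem conjAb_mul (g k : G) : conjAb M (g * k) = conjAb M k * conjAb M g := by
  ext q
  obtain ⟨m, rfl⟩ : ∃ m : M, abOf m = q := QuotientGroup.mk_surjective _
  change conjAb M (g * k) (abOf m) = conjAb M k (conjAb M g (abOf m))
  rw [conjAb_abOf, conjAb_abOf, conjAb_abOf]
  congr 1
  refine Subtype.ext ?_
  simp [mul_assoc]

theorem conjAb_of_mem {g : G} (hg : g ∈ M) : conjAb M g = 1 := by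
  ext q
  obtain ⟨m, rfl⟩ : ∃ m : M, abOf m = q := QuotientGroup.mk_surjective _
  have h1 : (conjAb M g (abOf m)) = abOf ((⟨g, hg⟩ : M)⁻¹ * m * ⟨g, hg⟩) := conjAb_abOf g m
  change conjAb M g (abOf m) = abOf m
  rw [h1]
  refine congrArg Additive.ofMul ?_
  rw [map_mul, map_mul, map_inv, mul_comm, mul_inv_cancel_left]

end conjAb

/-- The operator which the relation for the cube of the first generator of `Γ_e` induces on the
abelianization of the first maximal subgroup. -/
def cubeOp {A : Type*} [AddCommGroup A] (e : ℕ) (D : AddMonoid.End A) : AddMonoid.End A :=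
  3 • 1 + D * D + 2 • (D * D * D) + e • (D * D * D * D)

theorem cubeOp_apply {A : Type*} [AddCommGroup A] (e : ℕ) (D : AddMonoid.End A) (a : A) :
    cubeOp e D a = 3 • a + D (D a) + 2 • D (D (D a)) + e • D (D (D (D a))) := rfl

namespace PCGroup

/-- With `D` the action of `h 1` minus 1, the commutator relations give `D[h 0] = -[h 2]`, `D[h 2] =
[h 4]`, `D[h 4] = [h 5]` and `D[h 5] = [h 7]`. Substituting these in `3[h 0] = [h 4] + 2[h 5] + e[h
7]` yields the claim. -/
theorem cubeOp_eq_zero {e : ℕ} {G : Type*} [Group G] {M : Subgroup G} [M.Normal] {h : ℕ → G}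
    (hs : (pcData 0 e 0 0).Sat h) {m0 m2 m4 m5 m7 : M} (h0 : (m0 : G) = h 0) (h2 : (m2 : G) = h 2)
    (h4 : (m4 : G) = h 4) (h5 : (m5 : G) = h 5) (h7 : (m7 : G) = h 7) :
    cubeOp e (conjAb M (h 1) - 1) (abOf m0) = 0 := by
  set D := conjAb M (h 1) - 1 with hD
  have e0 : D (abOf m0) = -abOf m2 := by
    refine conjAb_sub_one (w := m2⁻¹) ?_
    rw [Subgroup.coe_inv, h0, h2, eq_mul_inv_iff_mul_eq]
    simpa [pcData] using (hs.comm 0 1 (by norm_num)).symm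
  have e2 : D (abOf m2) = abOf m4 := conjAb_sub_one (by
    rw [h2, h4]; simpa [pcData] using hs.comm 1 2 (by norm_num))
  have e4 : D (abOf m4) = abOf m5 := conjAb_sub_one (by
    rw [h4, h5]; simpa [pcData] using hs.comm 1 4 (by norm_num))
  have e5 : D (abOf m5) = abOf m7 := conjAb_sub_one (by
    rw [h5, h7]; simpa [pcData] using hs.comm 1 5 (by norm_num))
  have hp : m0 ^ 3 = m4 * m5 ^ 2 * m7 ^ e := by
    refine Subtype.ext ?_
    push_cast
    rw [h0, h4, h5, h7, hs.pow]
    simp [pcData, pow_two, mul_assoc]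
  have hp' : 3 • abOf m0 = abOf m4 + 2 • abOf m5 + e • abOf m7 := by
    have : abOf (m0 ^ 3) = abOf (m4 * m5 ^ 2 * m7 ^ e) := by rw [hp]
    exact this
  rw [cubeOp_apply, hp', e0, map_neg, e2, map_neg, e4, map_neg, e5]
  simp only [smul_neg]
  abel

/-- The elements of the first maximal subgroup among the generators. -/
def lineGen (k : ℕ) : (frame 0).line 0 :=
  if h : k = 1 then 1 else ⟨gen 0 k, by
    rcases Nat.lt_or_ge k 2 with hk | hk
    · obtain rfl : k = 0 := by omega
      simpa [lineData] using rep_mem (e := 0) 0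
    · exact gen_mem_line 0 hk⟩

theorem coe_lineGen {k : ℕ} (h : k ≠ 1) : (lineGen k : PCGroup 0) = gen 0 k := by
  rw [lineGen, dif_neg h]

theorem conjAb_lineGen {k : ℕ} (h : 1 < k) {w : ℕ} (hw : w ≠ 1)
    (hkw : (pcData 0 0 0 0).cw k 1 = [w]) :
    (conjAb ((frame 0).line 0) (gen 0 1) - 1) (abOf (lineGen k)) = abOf (lineGen w) := by
  refine conjAb_sub_one ?_
  rw [coe_lineGen h.ne', coe_lineGen hw, (sat_gen 0).comm 1 k h, hkw]
  simp

theorem conjAb_lineGen_eq_zero {k : ℕ} (h : 1 < k)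
    (hkw : (pcData 0 0 0 0).cw k 1 = []) :
    (conjAb ((frame 0).line 0) (gen 0 1) - 1) (abOf (lineGen k)) = 0 := by
  refine conjAb_sub_one (w := 1) ?_
  rw [coe_lineGen h.ne', (sat_gen 0).comm 1 k h, hkw]
  simp

theorem conjAb_lineGen_zero :
    (conjAb ((frame 0).line 0) (gen 0 1) - 1) (abOf (lineGen 0)) = -abOf (lineGen 2) := by
  refine conjAb_sub_one (w := (lineGen 2)⁻¹) ?_
  rw [Subgroup.coe_inv, coe_lineGen (by norm_num), coe_lineGen (by norm_num),
    eq_mul_inv_iff_mul_eq]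
  simpa [pcData] using ((sat_gen 0).comm 0 1 (by norm_num)).symm

theorem three_smul_lineGen {k : ℕ} (h : k ≠ 1) {w : List ℕ} (hw : ∀ i ∈ w, i ≠ 1)
    (hkw : (pcData 0 0 0 0).pw k = w) :
    3 • abOf (lineGen k) = (w.map fun i => abOf (lineGen i)).sum := by
  have h1 : lineGen k ^ 3 = (w.map lineGen).prod := by
    refine Subtype.ext ?_
    rw [Subgroup.coe_pow, coe_lineGen h, (sat_gen 0).pow, hkw, Subgroup.val_list_prod,
      List.map_map, ev]
    congr 1
    exact List.map_congr_left fun i hi => (coe_lineGen (hw i hi)).symm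
  have h2 : ∀ l : List ℕ, abOf ((l.map lineGen).prod) =
      (l.map fun i => abOf (lineGen i)).sum := by
    intro l
    induction l with
    | nil => rfl
    | cons a l ih => rw [List.map_cons, List.prod_cons, abOf_mul, ih, List.map_cons,
        List.sum_cons]
  rw [← h2, ← h1]
  rfl

theorem abOf_lineGen_three : abOf (lineGen 3) = 0 ∧ abOf (lineGen 6) = 0 := by
  rw [abOf_eq_zero, abOf_eq_zero, coe_lineGen (by norm_num), coe_lineGen (by norm_num)]
  constructor
  · exact token_mem (e := 0) (Or.inl rfl) 0 (k := 2) le_rfl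
  · exact token_mem (e := 0) (Or.inl rfl) 0 (k := 5) (by norm_num)

theorem abOf_lineGen_seven : abOf (lineGen 7) ≠ 0 := by
  rw [Ne, abOf_eq_zero, coe_lineGen (by norm_num)]
  intro h
  replace h := commutator_le_derived (Or.inl rfl) 0 h
  have h9 : gen 0 3 ^ 9 = 1 := by
    have := (sat_gen 0).collect_eq (List.replicate 9 3)
    rw [show (pcData 0 0 0 0).collect (List.replicate 9 3) = [] by decide +kernel] at this
    simpa only [ev, List.map_replicate, List.prod_replicate, List.map_nil, List.prod_nil]
      using this
  have hz : ev (gen 0) (lineData 0).z = gen 0 3 := by simp [lineData]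
  obtain ⟨j, hj, n, hn, h⟩ := exists_of_mem_chainZ (q := 9) (by norm_num)
    (by rw [hz, h9]; exact one_mem _) h
  have hlead : ∀ k < 9, leadingLt 8 ((pcData 0 0 0 0).collect (List.replicate k 3 ++ [7])) = true := by
    decide +kernel
  refine (model 0).ev_notMem (card_eq (Or.inl rfl)) (hlead ((9 - j) % 9)
    (Nat.mod_lt _ (by norm_num))) ?_
  have hw : ev (gen 0) (List.replicate ((9 - j) % 9) 3 ++ [7]) =
      gen 0 3 ^ ((9 - j) % 9) * gen 0 7 := by simp [ev]
  rw [hw, h, hz, ← mul_assoc, ← pow_add]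
  have : gen 0 3 ^ ((9 - j) % 9 + j) = 1 := by
    rcases Nat.eq_zero_or_pos j with rfl | hj0
    · exact pow_zero _
    · rw [Nat.mod_eq_of_lt (by omega), Nat.sub_add_cancel hj.le, h9]
  rwa [this, one_mul]

theorem conjAb_sq_sub_one {G : Type*} [Group G] {M : Subgroup G} [M.Normal] (g : G)
    (a : Additive (Abelianization M)) :
    (conjAb M (g ^ 2) - 1) a =
      (conjAb M g - 1) ((conjAb M g - 1) a) + 2 • (conjAb M g - 1) a := by
  have h : ∀ k b, (conjAb M k - 1) b = conjAb M k b - b := fun _ _ => rfl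
  have h2 : conjAb M (g ^ 2) a = conjAb M g (conjAb M g a) := by rw [pow_two, conjAb_mul]; rfl
  rw [h, h g a, h g, h2, map_sub]
  abel

/-- `Γ_0` satisfies the identity with `e = 0`, so for `t = 1` the operator for `e = 2` contributes
`2D⁴[g_0] = -2[g_7] = [g_7]`. The case `t = 2` covers isomorphisms sending the second generator to
the other nontrivial coset of the line. -/
theorem cubeOp_conjAb_sub_one {t : ℕ} (ht : t = 1 ∨ t = 2) (k : ℕ) :
    cubeOp 2 (conjAb ((frame 0).line 0) (gen 0 1 ^ t) - 1) (abOf (lineGen k)) =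
      if k = 0 then abOf (lineGen 7) else 0 := by
  have d0 := conjAb_lineGen_zero
  have d2 := conjAb_lineGen (k := 2) (w := 4) (by norm_num) (by norm_num) rfl
  have d4 := conjAb_lineGen (k := 4) (w := 5) (by norm_num) (by norm_num) rfl
  have d5 := conjAb_lineGen (k := 5) (w := 7) (by norm_num) (by norm_num) rfl
  have d7 := conjAb_lineGen_eq_zero (k := 7) (by norm_num) rfl
  have p0 := three_smul_lineGen (k := 0) (w := [4, 5, 5]) (by norm_num) (by decide) rfl
  have p2 := three_smul_lineGen (k := 2) (w := [5, 5, 6, 7]) (by norm_num) (by decide) rfl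
  have p4 := three_smul_lineGen (k := 4) (w := [7, 7]) (by norm_num) (by decide) rfl
  have p5 := three_smul_lineGen (k := 5) (w := []) (by norm_num) (by decide) rfl
  have p7 := three_smul_lineGen (k := 7) (w := []) (by norm_num) (by decide) rfl
  obtain ⟨z3, z6⟩ := abOf_lineGen_three
  have z : ∀ k, k = 1 ∨ 8 ≤ k → abOf (lineGen k) = 0 := by
    intro k hk
    rw [show lineGen k = 1 from Subtype.ext ?_]
    · rfl
    · rcases hk with rfl | hk
      · rfl
      · rw [coe_lineGen (by omega), gen_of_le 0 hk]
        rfl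
  -- With `s = t - 1` this is `(1 + D)^t - 1 = s D² + (s + 1) D`.
  have hE : ∃ s : ℕ, (s = 0 ∨ s = 1) ∧ ∀ a, (conjAb ((frame 0).line 0) (gen 0 1 ^ t) - 1) a =
      s • (conjAb ((frame 0).line 0) (gen 0 1) - 1) ((conjAb ((frame 0).line 0) (gen 0 1) - 1) a) +
        (s + 1) • (conjAb ((frame 0).line 0) (gen 0 1) - 1) a := by
    rcases ht with rfl | rfl
    · exact ⟨0, Or.inl rfl, fun a => by simp⟩
    · exact ⟨1, Or.inr rfl, fun a => by rw [conjAb_sq_sub_one]; simp⟩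
  obtain ⟨s, hs, hE⟩ := hE
  generalize conjAb ((frame 0).line 0) (gen 0 1 ^ t) - 1 = E at *
  generalize conjAb ((frame 0).line 0) (gen 0 1) - 1 = D at *
  simp only [List.map_cons, List.map_nil, List.sum_cons, List.sum_nil, add_zero, z6, zero_add]
    at p0 p2 p4 p5 p7
  have e7 : E (abOf (lineGen 7)) = 0 := by rw [hE, d7]; simp
  have e5 : E (abOf (lineGen 5)) = (s + 1) • abOf (lineGen 7) := by rw [hE, d5, d7]; simp
  have e4 : E (abOf (lineGen 4)) = s • abOf (lineGen 7) + (s + 1) • abOf (lineGen 5) := by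
    rw [hE, d4, d5]
  have e2 : E (abOf (lineGen 2)) = s • abOf (lineGen 5) + (s + 1) • abOf (lineGen 4) := by
    rw [hE, d2, d4]
  have e0 : E (abOf (lineGen 0)) = -(s • abOf (lineGen 4) + (s + 1) • abOf (lineGen 2)) := by
    rw [hE, d0, map_neg, d2]
    simp only [smul_neg]
    abel
  rw [cubeOp_apply]
  have hk : k = 0 ∨ k = 2 ∨ k = 4 ∨ k = 5 ∨ k = 7 ∨ k ≠ 0 ∧ abOf (lineGen k) = 0 := by
    by_cases h1 : k = 1 ∨ 8 ≤ k
    · exact Or.inr (Or.inr (Or.inr (Or.inr (Or.inr ⟨by omega, z k h1⟩))))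
    · obtain rfl | rfl | h : k = 3 ∨ k = 6 ∨ (k = 0 ∨ k = 2 ∨ k = 4 ∨ k = 5 ∨ k = 7) := by omega
      · simp [z3]
      · simp [z6]
      · tauto
  rcases hk with rfl | rfl | rfl | rfl | rfl | ⟨hk0, hk⟩
  · rw [if_pos rfl, p0]
    simp only [e0, e2, e4, e5, e7, map_neg, map_add, map_nsmul, smul_zero, add_zero, map_zero]
    rcases hs with rfl | rfl
    · linear_combination (norm := module) (-1 : ℤ) • p7
    · linear_combination (norm := module) (-1 : ℤ) • p4 - (6 : ℤ) • p5 - (20 : ℤ) • p7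
  · rw [if_neg (by norm_num), p2]
    simp only [e2, e4, e5, e7, map_add, map_nsmul, smul_zero, add_zero, map_zero]
    rcases hs with rfl | rfl
    · linear_combination (norm := module) (1 : ℤ) • p5 + (1 : ℤ) • p7
    · linear_combination (norm := module) (2 : ℤ) • p5 + (7 : ℤ) • p7
  · rw [if_neg (by norm_num), p4]
    simp only [e4, e5, e7, map_add, map_nsmul, smul_zero, add_zero, map_zero]
    rcases hs with rfl | rfl
    · linear_combination (norm := module) (1 : ℤ) • p7
    · linear_combination (norm := module) (2 : ℤ) • p7
  · rw [if_neg (by norm_num), p5]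
    simp [e5, e7]
  · rw [if_neg (by norm_num), p7]
    simp [e7]
  · rw [hk, if_neg hk0]
    simp

theorem cubeOp_conjAb_sub_one_of_mem {t : ℕ} (ht : t = 1 ∨ t = 2) {m : (frame 0).line 0}
    (hm : (m : PCGroup 0) ∈ chain (gen 0) 2) :
    cubeOp 2 (conjAb ((frame 0).line 0) (gen 0 1 ^ t) - 1) (abOf m) = 0 := by
  have key : ∀ n ∈ chain (gen 0) 2, ∃ h : n ∈ (frame 0).line 0,
      cubeOp 2 (conjAb ((frame 0).line 0) (gen 0 1 ^ t) - 1)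
        (abOf (⟨n, h⟩ : (frame 0).line 0)) = 0 := by
    intro n hn
    induction hn using Subgroup.closure_induction with
    | mem n hn =>
      obtain ⟨k, hk, rfl⟩ := hn
      refine ⟨gen_mem_line 0 hk, ?_⟩
      have hk' : 2 ≤ k := hk
      have := cubeOp_conjAb_sub_one ht k
      rw [if_neg (by omega)] at this
      convert this using 2
      exact congrArg abOf (Subtype.ext (coe_lineGen (by omega)).symm)
    | one => exact ⟨one_mem _, map_zero _⟩
    | mul a b _ _ iha ihb =>
      obtain ⟨ha, ha'⟩ := iha
      obtain ⟨hb, hb'⟩ := ihb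
      refine ⟨mul_mem ha hb, ?_⟩
      have : abOf (⟨a * b, mul_mem ha hb⟩ : (frame 0).line 0) =
        abOf ⟨a, ha⟩ + abOf ⟨b, hb⟩ := rfl
      rw [this, map_add, ha', hb', add_zero]
    | inv a _ iha =>
      obtain ⟨ha, ha'⟩ := iha
      refine ⟨inv_mem ha, ?_⟩
      have : abOf (⟨a⁻¹, inv_mem ha⟩ : (frame 0).line 0) = -abOf ⟨a, ha⟩ := rfl
      rw [this, map_neg, ha', neg_zero]
  exact (key m hm).2

theorem card_ab_map {G H : Type*} [Group G] [Group H] [TopologicalSpace G] [TopologicalSpace H]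
    [IsTopologicalGroup G] [IsTopologicalGroup H] [DiscreteTopology G] [DiscreteTopology H]
    (f : G ≃* H) (M : Subgroup G) :
    Nat.card (TopologicalAbelianization (M.map f.toMonoidHom)) =
      Nat.card (TopologicalAbelianization M) := by
  have h1 : Nat.card (TopologicalAbelianization (M.map f.toMonoidHom)) =
      Nat.card (Abelianization (M.map f.toMonoidHom)) := by
    change (commutator _).topologicalClosure.index = (commutator _).index
    rw [topologicalClosure_of_discrete]
  have h2 : Nat.card (TopologicalAbelianization M) = Nat.card (Abelianization M) := by
    change (commutator _).topologicalClosure.index = (commutator _).index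
    rw [topologicalClosure_of_discrete]
  rw [h1, h2]
  exact Nat.card_congr (f.subgroupMap M).abelianizationCongr.symm.toEquiv

theorem card_abelianOfType (m n : ℕ) : Nat.card (AbelianOfType [m, n]) = m * n := by
  change Nat.card (∀ i : Fin 2, ZMod ([m, n].get i)) = m * n
  rw [Nat.card_pi, Fin.prod_univ_two, Nat.card_zmod, Nat.card_zmod]
  rfl

theorem card_ab {e : ℕ} (he : e = 0 ∨ e = 2) (i : Fin 4) :
    Nat.card (TopologicalAbelianization ((frame e).line i)) = if i = 0 then 243 else 27 := by
  obtain ⟨f⟩ := nonempty_ab_mulEquiv he i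
  rw [Nat.card_congr f.toEquiv, orders he]
  split
  · exact card_abelianOfType 9 27
  · exact card_abelianOfType 3 9

theorem map_line_zero (f : PCGroup 2 ≃* PCGroup 0) :
    ((frame 2).line 0).map f.toMonoidHom = (frame 0).line 0 := by
  obtain ⟨i, hi⟩ := (frame 0).exists_line (isProP (Or.inl rfl))
    (M := ((frame 2).line 0).map f.toMonoidHom) (isOpen_discrete _)
    ((OrderIso.isCoatom_iff f.mapSubgroup _).2 ((frame 2).isCoatom_line 0))
  have h1 := card_ab_map f ((frame 2).line 0)
  rw [hi, card_ab (Or.inl rfl), card_ab (Or.inr rfl), if_pos rfl] at h1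
  rw [hi]
  split at h1
  · subst i; rfl
  · norm_num at h1

theorem isEmpty_mulEquiv : IsEmpty (PCGroup 0 ≃* PCGroup 2) := by
  constructor
  intro f
  have hs : (pcData 0 2 0 0).Sat fun i => f.symm (gen 2 i) :=
    (sat_gen 2).map f.symm.toMonoidHom
  have hline := map_line_zero f.symm
  have hmem : ∀ g, f.symm g ∈ (frame 0).line 0 ↔ g ∈ (frame 2).line 0 := by
    intro g
    rw [← hline]
    exact Subgroup.mem_map_iff_mem f.symm.injective
  have h0 : gen 2 0 ∈ (frame 2).line 0 := by simpa [lineData] using rep_mem (e := 2) 0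
  have hk : ∀ {k}, 2 ≤ k → f.symm (gen 2 k) ∈ (frame 0).line 0 := fun hk =>
    (hmem _).2 (gen_mem_line 0 hk)
  have h1 : f.symm (gen 2 1) ∉ (frame 0).line 0 := by
    rw [hmem, Frame.mem_line, show gen 2 1 = (frame 2).y from rfl, (frame 2).χ_y, (frame 2).ψ_y]
    decide
  have hrel := cubeOp_eq_zero (M := (frame 0).line 0) hs (m0 := ⟨_, (hmem _).2 h0⟩)
    (m2 := ⟨_, hk (k := 2) (by norm_num)⟩) (m4 := ⟨_, hk (k := 4) (by norm_num)⟩)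
    (m5 := ⟨_, hk (k := 5) (by norm_num)⟩) (m7 := ⟨_, hk (k := 7) (by norm_num)⟩)
    rfl rfl rfl rfl rfl
  set F := frame 0 with hF
  set a := f.symm (gen 2 0)
  set b := f.symm (gen 2 1)
  have ha : F.ψ a = 0 := by simpa [Frame.mem_line, Frame.dir] using (hmem _).2 h0
  have hb : F.ψ b ≠ 0 := by simpa [Frame.mem_line, Frame.dir] using h1
  have hχ : F.χ a ≠ 0 := by
    intro h
    have h2 : a ∈ commutator (PCGroup 0) := chain_two_le 0 (mem_chain_two_iff.2 ⟨h, ha⟩)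
    have h3 : gen 2 0 ∈ commutator (PCGroup 2) := by
      have h4 : f.toMonoidHom a ∈ (commutator (PCGroup 0)).map f.toMonoidHom :=
        Subgroup.mem_map_of_mem _ h2
      rw [commutator_def, Subgroup.map_commutator] at h4
      have h5 : f.toMonoidHom a = gen 2 0 := f.apply_symm_apply _
      rw [h5] at h4
      exact Subgroup.commutator_mono le_top le_top h4
    have h6 := ((frame 2).mem_closure_iff (gen 2 0)).1
      (by rwa [topologicalClosure_of_discrete])
    have h7 := (frame 2).χ_x
    rw [show (frame 2).x = gen 2 0 from rfl, h6.1] at h7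
    exact absurd h7 (by decide)
  have ht : (F.ψ b).val = 1 ∨ (F.ψ b).val = 2 := by
    generalize F.ψ b = c at hb
    revert c
    decide
  -- Elements of the line act trivially on its abelianization, so only the coset of `b` matters.
  have hconj : conjAb (F.line 0) b = conjAb (F.line 0) (gen 0 1 ^ (F.ψ b).val) := by
    have hm : (gen 0 1 ^ (F.ψ b).val)⁻¹ * b ∈ F.line 0 := by
      have hy : F.ψ (gen 0 1) = 1 := F.ψ_y
      simp [Frame.mem_line, Frame.dir, F.ψ_mul, F.ψ_inv, F.ψ_pow, hy]
    have h2 := conjAb_mul (M := F.line 0) (gen 0 1 ^ (F.ψ b).val) ((gen 0 1 ^ (F.ψ b).val)⁻¹ * b)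
    rwa [mul_inv_cancel_left, conjAb_of_mem hm, one_mul] at h2
  rw [hconj] at hrel
  set t := (F.ψ b).val
  set s := (F.χ a).val with hs'
  have hn : (gen 0 0 ^ s)⁻¹ * a ∈ chain (gen 0) 2 := by
    have hx : F.χ (gen 0 0) = 1 := F.χ_x
    have hx' : F.ψ (gen 0 0) = 0 := F.ψ_x
    rw [mem_chain_two_iff]
    simp [← hF, F.ψ_mul, F.ψ_inv, F.ψ_pow, F.χ_mul, F.χ_inv, F.χ_pow, hx, hx', ha, s]
  have hnM : (gen 0 0 ^ s)⁻¹ * a ∈ F.line 0 := F.closure_le_line 0 ((F.mem_closure_iff _).2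
    (mem_chain_two_iff.1 hn))
  have hdec : abOf (⟨a, (hmem _).2 h0⟩ : F.line 0) = s • abOf (lineGen 0) +
      abOf ⟨(gen 0 0 ^ s)⁻¹ * a, hnM⟩ := by
    have : (⟨a, (hmem _).2 h0⟩ : F.line 0) = lineGen 0 ^ s * ⟨(gen 0 0 ^ s)⁻¹ * a, hnM⟩ := by
      refine Subtype.ext ?_
      rw [Subgroup.coe_mul, Subgroup.coe_pow, coe_lineGen (by norm_num), mul_inv_cancel_left]
    rw [this]
    rfl
  rw [hdec, map_add, map_nsmul, cubeOp_conjAb_sub_one ht, if_pos rfl,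
    cubeOp_conjAb_sub_one_of_mem ht hn, add_zero] at hrel
  have p7 := three_smul_lineGen (k := 7) (w := []) (by norm_num) (by decide) rfl
  simp only [List.map_nil, List.sum_nil] at p7
  have hs3 : s = 1 ∨ s = 2 := by
    rw [hs']
    generalize F.χ a = c at hχ
    revert c
    decide
  apply abOf_lineGen_seven
  rcases hs3 with h | h
  · rwa [h, one_smul] at hrel
  · rw [h] at hrel
    linear_combination (norm := module) p7 - hrel

end PCGroup

/-! ### Lifting homomorphisms through central extensions. -/

theorem nonempty_mulEquiv_of_pow_three {E : Type*} [Group E] [Finite E] {Z : Subgroup E}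
    (hc : Z ≤ Subgroup.center E) (h3 : ∀ z ∈ Z, z ^ 3 = 1) :
    ∃ n, Nonempty (Z ≃* Multiplicative (Fin n → ZMod 3)) := by
  let : CommGroup Z :=
    { (inferInstance : Group Z) with
      mul_comm := fun a b => Subtype.ext (Subgroup.mem_center_iff.1 (hc b.2) a) }
  let : Module (ZMod 3) (Additive Z) := AddCommGroup.zmodModule fun z =>
    congrArg Additive.ofMul (Subtype.ext (h3 z.toMul.1 z.toMul.2) : z.toMul ^ 3 = 1)
  have : Module.Finite (ZMod 3) (Additive Z) := Module.Finite.of_finite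
  let f : Additive Z ≃+ (Fin (Module.finrank (ZMod 3) (Additive Z)) → ZMod 3) :=
    (Module.finBasis (ZMod 3) (Additive Z)).equivFun.toAddEquiv
  exact ⟨_, ⟨AddEquiv.toMultiplicativeRight f⟩⟩

theorem continuous_of_isOpen_ker {G Q : Type*} [Group G] [TopologicalSpace G]
    [IsTopologicalGroup G] [Group Q] [TopologicalSpace Q] [DiscreteTopology Q] {φ : G →* Q}
    (h : IsOpen (φ.ker : Set G)) : Continuous φ := by
  refine continuous_of_continuousAt_one φ ?_
  refine ContinuousAt.congr (f := fun _ => (1 : Q)) continuousAt_const ?_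
  filter_upwards [h.mem_nhds φ.ker.one_mem] with g hg using (MonoidHom.mem_ker.1 hg).symm

/-- If all cocycles of `G` lift, then a homomorphism to a quotient of a finite group `E` by a
central elementary abelian subgroup `K` lifts to a homomorphism to a group which contains `E` and
in which it differs from `E` only by central elements with cubes in `K`. -/
theorem CocyclesLift.exists_lift.{u, v, w} {G : Type u} [Group G] [TopologicalSpace G] [IsTopologicalGroup G]
    (h : CocyclesLift G) {E : Type v} {Q : Type w} [Group E] [Finite E] [Group Q] {p : E →* Q}
    (hp : Function.Surjective p) (hc : p.ker ≤ Subgroup.center E)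
    (h3 : ∀ z ∈ p.ker, z ^ 3 = 1) {φ₀ : G →* Q} (hφ₀ : IsOpen (φ₀.ker : Set G)) :
    ∃ (W : Type w) (_ : Group W) (i : E →* W) (q : W →* Q) (φ : G →* W),
      Function.Injective i ∧ IsOpen (φ.ker : Set G) ∧ q.comp i = p ∧ q.comp φ = φ₀ ∧
      ∀ w, q w = 1 → w ∈ Subgroup.center W ∧ w ^ 3 ∈ p.ker.map i := by
  obtain ⟨n, ⟨κ⟩⟩ := nonempty_mulEquiv_of_pow_three hc h3
  -- A set-theoretic section; `f` is its factor set, with values in `(ℤ/3)^n`.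
  let t : Q → E := Function.surjInv hp
  have ht : ∀ x, p (t x) = x := Function.surjInv_eq hp
  have hmem : ∀ a : E, (t (p a))⁻¹ * a ∈ p.ker := fun a => by
    rw [MonoidHom.mem_ker, map_mul, map_inv, ht, inv_mul_cancel]
  let k : E → (Fin n → ZMod 3) := fun a => (κ ⟨_, hmem a⟩).toAdd
  have hk_mul : ∀ (a : E) (z : p.ker), k (a * z) = k a + (κ z).toAdd := by
    intro a z
    have hpa : p (a * z) = p a := by rw [map_mul, MonoidHom.mem_ker.1 z.2, mul_one]
    change (κ _).toAdd = (κ _ * κ _).toAdd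
    rw [← map_mul]
    congr 2
    refine Subtype.ext ?_
    change (t (p (a * z)))⁻¹ * (a * z) = (t (p a))⁻¹ * a * z
    rw [hpa, mul_assoc]
  let f : Q × Q → (Fin n → ZMod 3) := fun x => k (t x.1 * t x.2)
  have hk : ∀ a b, k (a * b) = k a + k b + f (p a, p b) := by
    intro a b
    have ha := Subgroup.mem_center_iff.1 (hc (hmem a))
    have h1 : a * b = t (p a) * t (p b) * ((⟨_, hmem a⟩ * ⟨_, hmem b⟩ : p.ker) : E) := by
      calc a * b = t (p a) * ((t (p a))⁻¹ * a * t (p b)) * ((t (p b))⁻¹ * b) := by group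
        _ = _ := by rw [← ha]; simp only [mul_assoc, Subgroup.coe_mul]
    rw [h1, hk_mul, map_mul]
    change k _ + (k a + k b) = k a + k b + k _
    rw [add_comm]
  have hf : IsTrivCocycle f := by
    intro x y z
    have h1 := hk (t x * t y) (t z)
    have h2 := hk (t x) (t y * t z)
    rw [mul_assoc, h2, hk (t x) (t y), hk (t y) (t z)] at h1
    simp only [map_mul, ht] at h1
    linear_combination h1
  -- `W` is the extension of `Q` by `(ℤ/9)^n` obtained by pushing the factor set of `E` along `ι`;
  -- since `ι` is injective, `E` embeds in it.
  let ι : (Fin n → ZMod 3) →+ (Fin n → ZMod 9) := zmodEmb.compLeft (Fin n)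
  have hι : Function.Injective ι := fun a b hab =>
    funext fun j => zmodEmb_injective (congrFun hab j)
  have hfι : IsTrivCocycle fun x => ι (f x) := hf.comp ι
  have hk1 : k 1 = -f (1, 1) := by
    have := hk 1 1
    rw [mul_one, map_one] at this
    linear_combination -this
  let i : E →* CocycleExt _ hfι :=
    { toFun := fun a => ⟨p a, ι (k a)⟩
      map_one' := by
        ext : 1
        · exact map_one p
        · exact (congrArg ι hk1).trans (map_neg ι _)
      map_mul' := fun a b => by
        ext : 1
        · exact map_mul p a b
        · exact (congrArg ι (hk a b)).trans (by rw [map_add, map_add]; rfl) }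
  let : TopologicalSpace Q := ⊥
  have : DiscreteTopology Q := ⟨rfl⟩
  have hcont := continuous_of_isOpen_ker hφ₀
  -- Pulled back to `G`, each coordinate of the factor set becomes a coboundary over `ℤ/9`. The
  -- cochains `s j` then serve, with a sign, as second coordinates of the lift.
  have hs : ∀ j : Fin n, ∃ s : G → ZMod 9, Continuous s ∧
      ∀ g h : G, zmodEmb (f (φ₀ g, φ₀ h) j) = s g + s h - s (g * h) := by
    intro j
    refine h (fun x => f (φ₀ x.1, φ₀ x.2) j) ⟨?_, fun a b c => ?_⟩
    · exact (continuous_of_discreteTopology (f := fun x : Q × Q => f x j)).comp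
        (hcont.prodMap hcont)
    · have := congrFun (hf (φ₀ a) (φ₀ b) (φ₀ c)) j
      simpa only [map_mul, Pi.sub_apply, Pi.add_apply, Pi.zero_apply] using this
  choose s hs_cont hs using hs
  have hs1 : ∀ j, s j 1 = zmodEmb (f (1, 1) j) := by
    intro j
    have := hs j 1 1
    rw [mul_one, map_one] at this
    rw [this, add_sub_cancel_right]
  let φ : G →* CocycleExt _ hfι :=
    { toFun := fun g => ⟨φ₀ g, fun j => -s j g⟩
      map_one' := by
        ext : 1
        · exact map_one φ₀
        · exact funext fun j => congrArg Neg.neg (hs1 j)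
      map_mul' := fun a b => by
        ext : 1
        · exact map_mul φ₀ a b
        · refine funext fun j => ?_
          change -s j (a * b) = -s j a + -s j b + zmodEmb (f (φ₀ a, φ₀ b) j)
          rw [hs]
          ring }
  refine ⟨_, inferInstance, i, CocycleExt.proj, φ, ?_, ?_, rfl, rfl, ?_⟩
  · refine (injective_iff_map_eq_one i).2 fun a ha => ?_
    have h1 : p a = 1 := congrArg CocycleExt.fst ha
    have h2 : ι (k a) = ι (k 1) := by
      rw [hk1, map_neg]
      exact congrArg CocycleExt.snd ha
    have h3 : k a = k 1 + (κ ⟨a, h1⟩).toAdd := by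
      rw [← hk_mul, one_mul]
    rw [hι h2, left_eq_add] at h3
    have h4 : (⟨a, h1⟩ : p.ker) = 1 := κ.injective (by rw [map_one]; exact h3)
    exact congrArg Subtype.val h4
  · have : (φ.ker : Set G) = {g | φ₀ g = 1} ∩ ⋂ j, {g | s j g = s j 1} := by
      ext g
      simp only [SetLike.mem_coe, MonoidHom.mem_ker, Set.mem_inter_iff, Set.mem_ofPred_eq,
        Set.mem_iInter]
      constructor
      · intro hg
        rw [← map_one φ] at hg
        exact ⟨(congrArg CocycleExt.fst hg).trans (map_one φ₀),
          fun j => neg_injective (congrFun (congrArg CocycleExt.snd hg) j)⟩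
      · rintro ⟨h1, h2⟩
        rw [← map_one φ]
        ext : 1
        · exact h1.trans (map_one φ₀).symm
        · exact funext fun j => congrArg Neg.neg (h2 j)
    rw [this]
    refine hφ₀.inter (isOpen_iInter_of_finite fun j => ?_)
    exact (isOpen_discrete {s j 1}).preimage (hs_cont j)
  · intro w hw
    obtain ⟨a, rfl⟩ : ∃ a, w = CocycleExt.incl a := by
      obtain ⟨a, ha⟩ := CocycleExt.exists_incl_of_proj_eq (x := w) (y := 1) (hw.trans (map_one _).symm)
      exact ⟨a, by rw [ha, one_mul]⟩
    refine ⟨Subgroup.mem_center_iff.2 fun g => CocycleExt.incl_central g a, ?_⟩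
    -- Three times an element of `ℤ/9` comes from `ℤ/3`, which puts the cube of a central factor
    -- into the image of the kernel of `p`.
    choose x hx using three_smul_eq
    let v : Fin n → ZMod 3 := fun j => x (a.toAdd j)
    let z := κ.symm (Multiplicative.ofAdd v)
    refine ⟨z, z.2, ?_⟩
    have hz : k (z : E) = k 1 + v := by
      have := hk_mul 1 z
      rwa [one_mul, show κ z = Multiplicative.ofAdd v from κ.apply_symm_apply _] at this
    have hz1 : p (z : E) = 1 := z.2
    rw [← map_pow]
    ext : 1
    · exact hz1
    · change ι (k z) = (a ^ 3).toAdd - ι (f (1, 1))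
      rw [hz, hk1, map_add, map_neg, neg_add_eq_sub]
      congr 1
      exact funext fun j => (hx (a.toAdd j)).symm

/-! ### Finite 3-groups with an abelian maximal subgroup. -/

/-- A nontrivial normal subgroup of a finite `p`-group meets the center nontrivially. -/
theorem IsPGroup.exists_mem_center {p : ℕ} [Fact p.Prime] {L : Type*} [Group L] [Finite L]
    (hL : IsPGroup p L) {K : Subgroup L} [K.Normal] (hK : K ≠ ⊥) :
    ∃ z ∈ K, z ∈ Subgroup.center L ∧ z ≠ 1 := by
  obtain ⟨n, hn⟩ := IsPGroup.iff_card.1 (hL.to_subgroup K)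
  have hdvd : p ∣ Nat.card K := by
    rw [hn]
    refine dvd_pow_self p ?_
    rintro rfl
    rw [pow_zero] at hn
    exact hK (Subgroup.card_eq_one.1 hn)
  have hfix : (1 : K) ∈ MulAction.fixedPoints (ConjAct L) K := fun g => smul_one g
  obtain ⟨z, hz, hz1⟩ :=
    (hL.of_equiv ConjAct.toConjAct).exists_fixed_point_of_prime_dvd_card_of_fixed_point K hdvd hfix
  refine ⟨z, z.2, Subgroup.mem_center_iff.2 fun g => ?_, fun h => hz1 (Subtype.ext h.symm)⟩
  have h1 := congrArg Subtype.val (hz (ConjAct.toConjAct g))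
  rw [ConjAct.Subgroup.val_conj_smul, ConjAct.smul_def, ConjAct.ofConjAct_toConjAct] at h1
  exact mul_inv_eq_iff_eq_mul.1 h1

theorem Subgroup.eq_top_of_index_prime {L : Type*} [Group L] {A S : Subgroup L} {p : ℕ}
    (hp : p.Prime) (hA : A.index = p) (hAS : A ≤ S) {n : L} (hn : n ∉ A) (hnS : n ∈ S) :
    S = ⊤ := by
  have h1 := Subgroup.index_dvd_of_le hAS
  rw [hA] at h1
  rcases (Nat.dvd_prime hp).1 h1 with h | h
  · exact Subgroup.index_eq_one.1 h
  · have h2 := Subgroup.relIndex_mul_index hAS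
    rw [hA, h] at h2
    have h3 : A.relIndex S = 1 := Nat.eq_of_mul_eq_mul_right hp.pos (by rw [h2, one_mul])
    exact absurd (Subgroup.relIndex_eq_one.1 h3 hnS) hn

/-- Since `A` is abelian, `δ a = [a, n]` is a homomorphism, and its image contains the commutator
subgroup because `L` is generated by `A` and `n`. The bound on the abelianization then gives `|ker
δ| ≤ 3`. This kernel contains `n ^ 3` and also a nontrivial central element of `K`, so it lies in
`K`. -/
theorem pow_three_mem_of_abelian_index_three {L : Type*} [Group L] [Finite L] (hL : IsPGroup 3 L)
    {A K : Subgroup L} [A.Normal] [K.Normal] (hA : ∀ a ∈ A, ∀ b ∈ A, a * b = b * a)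
    (hidx : A.index = 3) (hab : (commutator L).index ≤ 9) (hKA : K ≤ A) (hK : K ≠ ⊥) {n : L}
    (hn : n ∉ A) : n ^ 3 ∈ K := by
  have hn3 : n ^ 3 ∈ A := by
    have := A.pow_index_mem n
    rwa [hidx] at this
  have hconj : ∀ a ∈ A, n⁻¹ * a * n ∈ A := fun a ha => by
    simpa using ‹A.Normal›.conj_mem a ha n⁻¹
  let δ : A →* L :=
    { toFun := fun a => (a : L)⁻¹ * (n⁻¹ * a * n)
      map_one' := by simp
      map_mul' := fun a b => by
        have h1 := hA _ (hconj a a.2) _ (inv_mem b.2)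
        have h2 := hA _ (inv_mem a.2) _ (inv_mem b.2)
        calc ((a * b : A) : L)⁻¹ * (n⁻¹ * (a * b : A) * n)
            = (b : L)⁻¹ * (a : L)⁻¹ * (n⁻¹ * a * n) * (n⁻¹ * b * n) := by
              push_cast; group
          _ = _ := by rw [← h2, mul_assoc (a : L)⁻¹, ← h1]; simp only [mul_assoc] }
  have hδ : ∀ a, δ a = (a : L)⁻¹ * (n⁻¹ * a * n) := fun _ => rfl
  have hR : δ.range ≤ A := by
    rintro _ ⟨a, rfl⟩
    exact mul_mem (inv_mem a.2) (hconj a a.2)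
  have hRn : ∀ r ∈ δ.range, n⁻¹ * r * n ∈ δ.range := by
    rintro _ ⟨a, rfl⟩
    refine ⟨⟨_, hconj a a.2⟩, ?_⟩
    rw [hδ, hδ]
    simp [mul_assoc]
  have hnorm : δ.range.Normal := by
    rw [← Subgroup.normalizer_eq_top_iff]
    have hmem : ∀ g : L, (∀ r ∈ δ.range, g * r * g⁻¹ ∈ δ.range) →
        (∀ r ∈ δ.range, g⁻¹ * r * g ∈ δ.range) → g ∈ Subgroup.normalizer (δ.range : Set L) := by
      intro g h1 h2
      refine Subgroup.mem_normalizer_iff.2 fun r => ⟨h1 r, fun h => ?_⟩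
      simpa [mul_assoc] using h2 _ h
    refine Subgroup.eq_top_of_index_prime Nat.prime_three hidx ?_ hn ?_
    · intro a ha
      refine hmem a (fun r hr => ?_) fun r hr => ?_
      · rwa [hA a ha r (hR hr), mul_inv_cancel_right]
      · rwa [hA _ (inv_mem ha) r (hR hr), inv_mul_cancel_right]
    · refine hmem n (fun r hr => ?_) hRn
      have h2 : n * r * n⁻¹ = n⁻¹ * (n⁻¹ * r * n) * n := by
        have h3 := hA _ hn3 r (hR hr)
        have h4 : n * r * n⁻¹ = (n⁻¹ * n⁻¹) * (n ^ 3 * r) * n⁻¹ := by group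
        rw [h4, h3]
        simp only [pow_three, mul_assoc, mul_inv_cancel, mul_one]
      rw [h2]
      exact hRn _ (hRn r hr)
  have hcomm : commutator L ≤ δ.range := by
    have htop : Subgroup.closure (insert n (A : Set L)) = ⊤ :=
      Subgroup.eq_top_of_index_prime Nat.prime_three hidx
        (fun a ha => Subgroup.subset_closure (Or.inr ha)) hn
        (Subgroup.subset_closure (Or.inl rfl))
    have hna : ∀ a ∈ A, (n : L ⧸ δ.range) * a = a * n := by
      intro a ha
      rw [← QuotientGroup.mk_mul, ← QuotientGroup.mk_mul, QuotientGroup.eq]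
      refine ⟨⟨a, ha⟩, ?_⟩
      rw [hδ]
      group
    rw [commutator_def, ← htop]
    refine commutator_closure_le ?_
    rintro a (rfl | ha) b (rfl | hb)
    · rfl
    · exact hna b hb
    · exact (hna a ha).symm
    · rw [← QuotientGroup.mk_mul, hA a ha b hb, QuotientGroup.mk_mul]
  -- `|L| ≤ 9 |im δ|`, while `|L| = 3 |A| = 3 |ker δ| |im δ|`.
  have hcardC : Nat.card δ.ker ≤ 3 := by
    have h1 := δ.ker.card_mul_index
    rw [Subgroup.index_ker] at h1
    have h2 := A.card_mul_index
    have h3 := (commutator L).card_mul_index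
    have h4 := Subgroup.card_le_of_le hcomm
    have h5 : 0 < Nat.card δ.range := Nat.card_pos
    rw [hidx] at h2
    have h6 : Nat.card L ≤ Nat.card δ.range * 9 := h3 ▸ Nat.mul_le_mul h4 hab
    rw [← h2, ← h1] at h6
    nlinarith
  obtain ⟨z, hzK, hzc, hz1⟩ := hL.exists_mem_center hK
  have hzδ : (⟨z, hKA hzK⟩ : A) ∈ δ.ker := by
    rw [MonoidHom.mem_ker, hδ]
    have := Subgroup.mem_center_iff.1 hzc n
    rw [mul_assoc n⁻¹, ← this]
    simp
  have hnδ : (⟨n ^ 3, hn3⟩ : A) ∈ δ.ker := by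
    rw [MonoidHom.mem_ker, hδ]
    group
  have hle : Subgroup.zpowers (⟨z, hKA hzK⟩ : A) ≤ δ.ker := by
    rwa [Subgroup.zpowers_le]
  have h3 : 3 ∣ Nat.card (Subgroup.zpowers (⟨z, hKA hzK⟩ : A)) := by
    obtain ⟨m, hm⟩ := IsPGroup.iff_card.1 ((hL.to_subgroup A).to_subgroup
      (Subgroup.zpowers (⟨z, hKA hzK⟩ : A)))
    rw [hm]
    refine dvd_pow_self 3 ?_
    rintro rfl
    rw [pow_zero, Subgroup.card_eq_one, Subgroup.zpowers_eq_bot] at hm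
    exact hz1 (congrArg Subtype.val hm)
  have heq := Subgroup.eq_of_le_of_card_ge hle (hcardC.trans (Nat.le_of_dvd Nat.card_pos h3))
  rw [← heq] at hnδ
  obtain ⟨j, hj⟩ := Subgroup.mem_zpowers_iff.1 hnδ
  have h7 : z ^ j = n ^ 3 := by
    have := congrArg Subtype.val hj
    simpa using this
  rw [← h7]
  exact zpow_mem hzK j

/-- Commutators are not changed by central factors. -/
theorem commutator_le_of_central {W : Type*} [Group W] {A B : Subgroup W}
    (h : ∀ a ∈ A, ∃ b ∈ B, ∃ c ∈ Subgroup.center W, a = b * c) : ⁅A, A⁆ ≤ ⁅B, B⁆ := by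
  rw [Subgroup.commutator_le]
  intro a ha a' ha'
  obtain ⟨b, hb, c, hc, rfl⟩ := h a ha
  obtain ⟨b', hb', c', hc', rfl⟩ := h a' ha'
  have h1 := Subgroup.mem_center_iff.1 hc
  have h2 := Subgroup.mem_center_iff.1 hc'
  have : b * c * (b' * c') * (b * c)⁻¹ * (b' * c')⁻¹ = b * b' * b⁻¹ * b'⁻¹ := by
    calc b * c * (b' * c') * (b * c)⁻¹ * (b' * c')⁻¹
        = b * (c * (b' * c')) * c⁻¹ * b⁻¹ * c'⁻¹ * b'⁻¹ := by group
      _ = b * b' * (c' * b⁻¹) * c'⁻¹ * b'⁻¹ := by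
          rw [← h1]; simp only [mul_assoc, mul_inv_cancel_left]
      _ = _ := by rw [← h2]; simp only [mul_assoc, mul_inv_cancel_left]
  rw [commutatorElement_def, this]
  exact Subgroup.commutator_mem_commutator hb hb'

theorem Subgroup.eq_of_le_of_index_eq {G : Type*} [Group G] {A B : Subgroup G} (h : A ≤ B) (hi : A.index = B.index)
    (h0 : A.index ≠ 0) : A = B := by
  have h1 := Subgroup.relIndex_mul_index h
  rw [hi] at h1 h0
  have h2 : A.relIndex B = 1 :=
    Nat.eq_of_mul_eq_mul_right (Nat.pos_of_ne_zero h0) (by rw [h1, one_mul])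
  exact le_antisymm h (Subgroup.relIndex_eq_one.1 h2)

section closed
variable {G : Type*} [Group G] [TopologicalSpace G] [IsTopologicalGroup G]

theorem Subgroup.isClosed_of_le_of_isOpen {U S : Subgroup G} (hU : IsOpen (U : Set G))
    (h : U ≤ S) : IsClosed (S : Set G) :=
  Subgroup.isClosed_of_isOpen S (Subgroup.isOpen_mono h hU)

/-- Closures in `M` and in `G` agree because `M` is closed; so questions about `M^ab` can be asked
inside `G`. -/
theorem topologicalClosure_commutator_map {M : Subgroup G} (hM : IsClosed (M : Set G)) :
    (commutator M).topologicalClosure.map M.subtype = (⁅M, M⁆ : Subgroup G).topologicalClosure := by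
  apply SetLike.coe_injective
  rw [Subgroup.coe_map, Subgroup.topologicalClosure_coe, Subgroup.topologicalClosure_coe,
    ← Subgroup.map_subtype_commutator, Subgroup.coe_map]
  exact (hM.isClosedEmbedding_subtypeVal.closure_image_eq _).symm

end closed

/-! ### Covers: comparing `G` with `Γ_0` inside a common group. -/

namespace Frame
variable {G : Type*} [Group G] [TopologicalSpace G] [IsTopologicalGroup G] (F : Frame G)

/-- The closed commutator subgroup of a line. -/
def derivedLine (i : Fin 4) : Subgroup G := (⁅F.line i, F.line i⁆ : Subgroup G).topologicalClosure

instance (i : Fin 4) : (F.derivedLine i).Normal := Subgroup.is_normal_topologicalClosure _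

theorem derivedLine_le (i : Fin 4) : F.derivedLine i ≤ F.line i :=
  Subgroup.topologicalClosure_minimal _ (Subgroup.commutator_le_left _ _)
    (Subgroup.isClosed_of_isOpen _ (F.isOpen_line i))

theorem map_subtype_derivedLine (i : Fin 4) :
    (commutator (F.line i)).topologicalClosure.map (F.line i).subtype = F.derivedLine i :=
  topologicalClosure_commutator_map (Subgroup.isClosed_of_isOpen _ (F.isOpen_line i))

theorem cubeTrivial_iff_mem {i : Fin 4} {n : G} : F.CubeTrivial i n ↔ n ^ 3 ∈ F.derivedLine i := by
  rw [← map_subtype_derivedLine, Subgroup.mem_map]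
  constructor
  · exact fun h => ⟨_, h, rfl⟩
  · rintro ⟨a, ha, h⟩
    rw [CubeTrivial]
    convert ha
    exact h.symm

theorem index_derivedLine (i : Fin 4) :
    (F.derivedLine i).index = Nat.card (TopologicalAbelianization (F.line i)) * 3 := by
  rw [← map_subtype_derivedLine, Subgroup.index_map_subtype, index_line]
  rfl

theorem index_derivedLine_ne_zero {i : Fin 4}
    (hm : Nat.card (TopologicalAbelianization (F.line i)) =
      Nat.card (TopologicalAbelianization ((PCGroup.frame 0).line i))) :
    (F.derivedLine i).index ≠ 0 := by
  rw [index_derivedLine, hm, PCGroup.card_ab (Or.inl rfl)]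
  split <;> norm_num

/-- A homomorphism to a group which extends a quotient `Γ₀ / N_k`, together with a homomorphism of
`Γ₀` with kernel `N_l` to the same group; the two differ by central elements. -/
structure Cover (F : Frame G) (k l : ℕ) (W : Type*) [Group W] where
  j : PCGroup 0 →* W
  q : W →* PCGroup 0 ⧸ chain (PCGroup.gen 0) k
  φ : G →* W
  ker_j : j.ker = chain (PCGroup.gen 0) l
  isOpen_ker : IsOpen (φ.ker : Set G)
  q_j : ∀ γ, q (j γ) = γ
  q_x : q (φ F.x) = PCGroup.gen 0 0
  q_y : q (φ F.y) = PCGroup.gen 0 1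
  central : ∀ w, q w = 1 → w ∈ Subgroup.center W
  cube : ∀ w, q w = 1 → w ^ 3 ∈ (chain (PCGroup.gen 0) k).map j

/-- This is `CocyclesLift.exists_lift` for the extension `Γ_0/N_l → Γ_0/N_k`; the last two
hypotheses say that its kernel is central and of exponent 3. -/
theorem exists_cover (hL : CocyclesLift G) {k l : ℕ} (hkl : k ≤ l)
    {φ₀ : G →* PCGroup 0 ⧸ chain (PCGroup.gen 0) k} (hφ₀ : IsOpen (φ₀.ker : Set G))
    (hx : φ₀ F.x = PCGroup.gen 0 0) (hy : φ₀ F.y = PCGroup.gen 0 1)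
    (hc : ∀ n ∈ chain (PCGroup.gen 0) k, ∀ γ, n⁻¹ * γ⁻¹ * n * γ ∈ chain (PCGroup.gen 0) l)
    (h3 : ∀ n ∈ chain (PCGroup.gen 0) k, n ^ 3 ∈ chain (PCGroup.gen 0) l) :
    ∃ (W : Type) (_ : Group W), Nonempty (F.Cover k l W) := by
  have := (PCGroup.model 0).finite
  let p : PCGroup 0 ⧸ chain (PCGroup.gen 0) l →* PCGroup 0 ⧸ chain (PCGroup.gen 0) k :=
    QuotientGroup.map _ _ (MonoidHom.id _) (chain_anti hkl)
  have hpmk : ∀ γ : PCGroup 0, p γ = γ := fun γ => rfl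
  have hker : ∀ z ∈ p.ker, ∃ n ∈ chain (PCGroup.gen 0) k, (n : PCGroup 0 ⧸ _) = z := by
    intro z hz
    obtain ⟨n, rfl⟩ := QuotientGroup.mk_surjective z
    exact ⟨n, (QuotientGroup.eq_one_iff n).1 ((hpmk n).symm.trans hz), rfl⟩
  obtain ⟨W, _, i, q, φ, hi, hφ, hqi, hqφ, hq⟩ := hL.exists_lift (p := p) (φ₀ := φ₀)
    (fun z => by
      obtain ⟨n, rfl⟩ := QuotientGroup.mk_surjective z
      exact ⟨n, rfl⟩)
    (fun z hz => by
      obtain ⟨n, hn, rfl⟩ := hker z hz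
      refine Subgroup.mem_center_iff.2 fun g => ?_
      obtain ⟨γ, rfl⟩ := QuotientGroup.mk_surjective g
      rw [← QuotientGroup.mk_mul, ← QuotientGroup.mk_mul, QuotientGroup.eq]
      convert hc n hn γ using 1
      group)
    (fun z hz => by
      obtain ⟨n, hn, rfl⟩ := hker z hz
      rw [← QuotientGroup.mk_pow, QuotientGroup.eq_one_iff]
      exact h3 n hn) hφ₀
  have hqi' : ∀ z, q (i z) = p z := fun z => DFunLike.congr_fun hqi z
  have hqφ' : ∀ g, q (φ g) = φ₀ g := fun g => DFunLike.congr_fun hqφ g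
  refine ⟨W, _, ⟨⟨i.comp (QuotientGroup.mk' _), q, φ, ?_, hφ, fun γ => (hqi' _).trans (hpmk γ),
    (hqφ' _).trans hx, (hqφ' _).trans hy, fun w hw => (hq w hw).1, fun w hw => ?_⟩⟩⟩
  · ext γ
    rw [MonoidHom.mem_ker, MonoidHom.comp_apply, ← map_one i, hi.eq_iff]
    exact QuotientGroup.eq_one_iff γ
  · obtain ⟨z, hz, h⟩ := (hq w hw).2
    obtain ⟨n, hn, rfl⟩ := hker z hz
    exact ⟨n, hn, h⟩

namespace Cover
variable {F} {k l : ℕ} {W : Type*} [Group W] (C : F.Cover k l W)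

theorem isOpen_comap (S : Subgroup W) : IsOpen (S.comap C.φ : Set G) :=
  Subgroup.isOpen_mono (fun g hg => by
    rw [Subgroup.mem_comap, MonoidHom.mem_ker.1 hg]; exact one_mem S) C.isOpen_ker

theorem isClosed_comap (S : Subgroup W) : IsClosed (S.comap C.φ : Set G) :=
  Subgroup.isClosed_of_isOpen _ (C.isOpen_comap S)

/-- The coordinates are those in `Γ₀`. -/
theorem coord_eq (hk : 2 ≤ k) {g : G} {γ : PCGroup 0} (h : C.q (C.φ g) = γ) :
    F.χ g = (PCGroup.frame 0).χ γ ∧ F.ψ g = (PCGroup.frame 0).ψ γ := by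
  have key : ∀ (s : PCGroup 0 →* Multiplicative (ZMod 3)),
      (∀ n ∈ chain (PCGroup.gen 0) 2, s n = 1) →
      (s γ).toAdd = F.χ g * (s (PCGroup.gen 0 0)).toAdd + F.ψ g * (s (PCGroup.gen 0 1)).toAdd := by
    intro s hs
    let s' : PCGroup 0 ⧸ chain (PCGroup.gen 0) k →* Multiplicative (ZMod 3) :=
      QuotientGroup.lift _ s fun n hn => hs n (chain_anti hk hn)
    have hcont : Continuous fun g => (s' (C.q (C.φ g))).toAdd := by
      let : TopologicalSpace W := ⊥
      have : DiscreteTopology W := ⟨rfl⟩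
      exact (continuous_of_discreteTopology (f := fun w : W => (s' (C.q w)).toAdd)).comp
        (continuous_of_isOpen_ker C.isOpen_ker)
    have h1 := F.eq_add (s := fun g => (s' (C.q (C.φ g))).toAdd)
      (fun a b => by rw [map_mul, map_mul, map_mul, toAdd_mul]) hcont g
    simp only [h, C.q_x, C.q_y] at h1
    refine h1.trans ?_
    rw [nsmul_eq_mul, nsmul_eq_mul, ZMod.natCast_zmod_val, ZMod.natCast_zmod_val]
    rfl
  constructor
  · have := key (PCGroup.character 0 1 0) fun n hn => PCGroup.character_of_mem hn
    rw [PCGroup.character_gen, PCGroup.character_gen] at this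
    have h2 : (PCGroup.character 0 1 0 γ).toAdd = F.χ g := by simpa using this
    exact h2.symm
  · have := key (PCGroup.character 0 0 1) fun n hn => PCGroup.character_of_mem hn
    rw [PCGroup.character_gen, PCGroup.character_gen] at this
    have h2 : (PCGroup.character 0 0 1 γ).toAdd = F.ψ g := by simpa using this
    exact h2.symm

theorem mem_line_iff (hk : 2 ≤ k) {g : G} {γ : PCGroup 0} (h : C.q (C.φ g) = γ) {i : Fin 4} :
    g ∈ F.line i ↔ γ ∈ (PCGroup.frame 0).line i := by
  rw [mem_line, mem_line, (C.coord_eq hk h).1, (C.coord_eq hk h).2]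

theorem exists_q_eq (γ : PCGroup 0) : ∃ g, C.q (C.φ g) = γ := by
  have key : (C.q.comp C.φ).range.comap (QuotientGroup.mk' (chain (PCGroup.gen 0) k)) = ⊤ :=
    (PCGroup.frame 0).closure_pair (PCGroup.isProP (Or.inl rfl)) (isClosed_discrete _)
      ⟨F.x, C.q_x⟩ ⟨F.y, C.q_y⟩
  obtain ⟨g, hg⟩ : γ ∈ (C.q.comp C.φ).range.comap
      (QuotientGroup.mk' (chain (PCGroup.gen 0) k)) := by
    rw [key]; trivial
  exact ⟨g, hg⟩

theorem exists_central {g : G} {γ : PCGroup 0} (h : C.q (C.φ g) = γ) :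
    ∃ c, C.q c = 1 ∧ C.φ g = C.j γ * c := by
  refine ⟨(C.j γ)⁻¹ * C.φ g, ?_, by rw [mul_inv_cancel_left]⟩
  rw [map_mul, map_inv, C.q_j, h, inv_mul_cancel]

/-- Elements of `G` and `Γ_0` over the same element of `Γ_0/N_k` differ in `W` by a central factor,
which commutators do not see. -/
theorem commutator_map_eq {A : Subgroup G} {B : Subgroup (PCGroup 0)}
    (hAB : ∀ (g : G) (γ : PCGroup 0), C.q (C.φ g) = γ → (g ∈ A ↔ γ ∈ B)) :
    (⁅A, A⁆ : Subgroup G).map C.φ = (⁅B, B⁆ : Subgroup (PCGroup 0)).map C.j := by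
  rw [Subgroup.map_commutator, Subgroup.map_commutator]
  apply le_antisymm
  · refine commutator_le_of_central ?_
    rintro _ ⟨g, hg, rfl⟩
    obtain ⟨γ, hγ⟩ := QuotientGroup.mk_surjective (C.q (C.φ g))
    obtain ⟨c, hc, h⟩ := C.exists_central hγ.symm
    exact ⟨_, ⟨γ, (hAB g γ hγ.symm).1 hg, rfl⟩, c, C.central c hc, h⟩
  · refine commutator_le_of_central ?_
    rintro _ ⟨γ, hγ, rfl⟩
    obtain ⟨g, hg⟩ := C.exists_q_eq γ
    obtain ⟨c, hc, h⟩ := C.exists_central hg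
    exact ⟨_, ⟨g, (hAB g γ hg).2 hγ, rfl⟩, c⁻¹, inv_mem (C.central c hc),
      by rw [h, mul_inv_cancel_right]⟩

theorem commutator_eq_chain : commutator (PCGroup 0) = chain (PCGroup.gen 0) 2 := by
  refine le_antisymm (fun γ hγ => ?_) (PCGroup.chain_two_le 0)
  rw [PCGroup.mem_chain_two_iff, ← Frame.mem_closure_iff]
  exact Subgroup.le_topologicalClosure _ hγ

theorem map_commutator : (commutator G).map C.φ = (chain (PCGroup.gen 0) 2).map C.j := by
  rw [← commutator_eq_chain]
  exact C.commutator_map_eq fun g γ _ => ⟨fun _ => trivial, fun _ => trivial⟩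

theorem map_mem_of_mem_closure {g : G} (hg : g ∈ (commutator G).topologicalClosure) :
    C.φ g ∈ (chain (PCGroup.gen 0) 2).map C.j := by
  have : (commutator G).topologicalClosure ≤ ((chain (PCGroup.gen 0) 2).map C.j).comap C.φ := by
    refine Subgroup.topologicalClosure_minimal _ ?_ (C.isClosed_comap _)
    rw [← C.map_commutator]
    exact Subgroup.le_comap_map _ _
  exact this hg

/-- An element of `G` lying over `1` has zero coordinates, hence lies in the closed commutator
subgroup, whose image in `W` is that of `N_2`. So the image of `G` contains no central elements over
`1` beyond those of `Γ_0`, and `card_range` follows. -/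
theorem range_inf_ker (hk : 2 ≤ k) :
    C.φ.range ⊓ C.q.ker = (chain (PCGroup.gen 0) k).map C.j := by
  apply le_antisymm
  · rintro _ ⟨⟨g, rfl⟩, hg⟩
    have h1 : C.q (C.φ g) = (1 : PCGroup 0) := hg
    have h2 := C.coord_eq hk h1
    rw [(PCGroup.frame 0).χ_one, (PCGroup.frame 0).ψ_one] at h2
    obtain ⟨γ, -, h⟩ := C.map_mem_of_mem_closure ((F.mem_closure_iff g).2 h2)
    refine ⟨γ, ?_, h⟩
    rw [← h, C.q_j] at h1
    exact (QuotientGroup.eq_one_iff γ).1 h1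
  · rintro _ ⟨γ, hγ, rfl⟩
    refine ⟨?_, (C.q_j γ).trans ((QuotientGroup.eq_one_iff γ).2 hγ)⟩
    have : C.j γ ∈ (commutator G).map C.φ := by
      rw [C.map_commutator]
      exact ⟨γ, chain_anti hk hγ, rfl⟩
    obtain ⟨g, -, hg⟩ := this
    exact ⟨g, hg⟩

theorem card_eq_of_map_eq {W Q : Type*} [Group W] [Group Q] (q : W →* Q) {A B : Subgroup W}
    (h : A ⊓ q.ker = B ⊓ q.ker) (hm : A.map q = B.map q) : Nat.card A = Nat.card B := by
  have key : ∀ A : Subgroup W, Nat.card A = Nat.card (A ⊓ q.ker : Subgroup W) * Nat.card (A.map q) := by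
    intro A
    have h1 := Subgroup.relIndex_mul_relIndex ⊥ (A ⊓ q.ker) A bot_le inf_le_left
    rw [Subgroup.relIndex_bot_left, Subgroup.relIndex_bot_left, Subgroup.inf_relIndex_left,
      Subgroup.relIndex_ker] at h1
    exact h1.symm
  rw [key A, key B, h, hm]

theorem card_range (hk : 2 ≤ k) : Nat.card C.φ.range = Nat.card C.j.range := by
  refine card_eq_of_map_eq C.q ?_ ?_
  · rw [C.range_inf_ker hk]
    apply le_antisymm
    · rintro _ ⟨γ, hγ, rfl⟩
      exact ⟨⟨γ, rfl⟩, (C.q_j γ).trans ((QuotientGroup.eq_one_iff γ).2 hγ)⟩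
    · rintro _ ⟨⟨γ, rfl⟩, hγ⟩
      exact ⟨γ, (QuotientGroup.eq_one_iff γ).1 ((C.q_j γ).symm.trans hγ), rfl⟩
  · ext z
    obtain ⟨γ, rfl⟩ := QuotientGroup.mk_surjective z
    obtain ⟨g, hg⟩ := C.exists_q_eq γ
    exact ⟨fun _ => ⟨_, ⟨γ, rfl⟩, C.q_j γ⟩, fun _ => ⟨_, ⟨g, rfl⟩, hg⟩⟩

/-- The image in the cover of the commutator subgroup of a line. -/
def J (C : F.Cover k l W) (i : Fin 4) : Subgroup W :=
  (⁅(PCGroup.frame 0).line i, (PCGroup.frame 0).line i⁆ : Subgroup (PCGroup 0)).map C.j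

theorem map_commutator_line (hk : 2 ≤ k) (i : Fin 4) :
    (⁅F.line i, F.line i⁆ : Subgroup G).map C.φ = C.J i :=
  C.commutator_map_eq fun _ _ h => C.mem_line_iff hk h

theorem derivedLine_le_comap (hk : 2 ≤ k) (i : Fin 4) : F.derivedLine i ≤ (C.J i).comap C.φ := by
  refine Subgroup.topologicalClosure_minimal _ ?_ (C.isClosed_comap _)
  rw [← C.map_commutator_line hk]
  exact Subgroup.le_comap_map _ _

/-- Both indices are that of `J` in the image of `G`, respectively of `Γ_0`, and the two images have
the same order. -/
theorem index_comap_J (hk : 2 ≤ k) (i : Fin 4) : ((C.J i).comap C.φ).index =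
    (⁅(PCGroup.frame 0).line i, (PCGroup.frame 0).line i⁆ ⊔ chain (PCGroup.gen 0) l).index := by
  have : (C.J i).comap C.j =
      ⁅(PCGroup.frame 0).line i, (PCGroup.frame 0).line i⁆ ⊔ chain (PCGroup.gen 0) l := by
    rw [J, Subgroup.comap_map_eq, C.ker_j]
  rw [← this, Subgroup.index_comap, Subgroup.index_comap]
  have hφ : C.J i ≤ C.φ.range := by
    rw [← C.map_commutator_line hk]
    exact Subgroup.map_le_range _ _
  have hj : C.J i ≤ C.j.range := Subgroup.map_le_range _ _
  have h1 := Subgroup.relIndex_mul_relIndex ⊥ _ _ bot_le hφ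
  have h2 := Subgroup.relIndex_mul_relIndex ⊥ _ _ bot_le hj
  rw [Subgroup.relIndex_bot_left, Subgroup.relIndex_bot_left] at h1 h2
  rw [C.card_range hk, ← h2] at h1
  have := (PCGroup.model 0).finite
  have : Finite C.j.range := Finite.of_surjective _ C.j.rangeRestrict_surjective
  have : Finite (C.J i) := Finite.of_injective _ (Subgroup.inclusion_injective hj)
  exact Nat.eq_of_mul_eq_mul_left Nat.card_pos h1

theorem index_commutator_line (i : Fin 4) :
    (⁅(PCGroup.frame 0).line i, (PCGroup.frame 0).line i⁆ : Subgroup (PCGroup 0)).index =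
      Nat.card (TopologicalAbelianization ((PCGroup.frame 0).line i)) * 3 := by
  rw [← index_derivedLine, derivedLine, topologicalClosure_of_discrete]

/-- If the abelianization of the line is no larger than that of its image in `Γ₀ / N_l`, then
cubes can be compared in the cover. -/
theorem cubeTrivial_iff (hk : 2 ≤ k) {i : Fin 4}
    (hm : Nat.card (TopologicalAbelianization (F.line i)) =
      Nat.card (TopologicalAbelianization ((PCGroup.frame 0).line i)))
    (hl : chain (PCGroup.gen 0) l ≤ ⁅(PCGroup.frame 0).line i, (PCGroup.frame 0).line i⁆) {n : G} :
    F.CubeTrivial i n ↔ C.φ n ^ 3 ∈ C.J i := by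
  -- One inclusion always holds, and under `hl` the indices are equal.
  have h1 : F.derivedLine i = (C.J i).comap C.φ := by
    refine Subgroup.eq_of_le_of_index_eq (C.derivedLine_le_comap hk i) ?_ (F.index_derivedLine_ne_zero hm)
    rw [C.index_comap_J hk, sup_of_le_left hl, index_commutator_line, index_derivedLine, hm]
  rw [cubeTrivial_iff_mem, h1, Subgroup.mem_comap, map_pow]

/-- If the abelianization of the line is larger than that of its image in `Γ₀ / N_l`, then the
cubes of all elements outside of the line are trivial in the latter. -/
theorem pow_three_mem (hG : IsProP 3 G) (h9 : (commutator G).topologicalClosure.index = 9)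
    (hk : 2 ≤ k) {i : Fin 4}
    (hm : Nat.card (TopologicalAbelianization (F.line i)) =
      Nat.card (TopologicalAbelianization ((PCGroup.frame 0).line i)))
    (hl : ¬ chain (PCGroup.gen 0) l ≤ ⁅(PCGroup.frame 0).line i, (PCGroup.frame 0).line i⁆) {n : G}
    (hn : n ∉ F.line i) : C.φ n ^ 3 ∈ C.J i := by
  set D := F.derivedLine i with hD
  set K := (C.J i).comap C.φ with hK
  have hD0 : D.index ≠ 0 := F.index_derivedLine_ne_zero hm
  have hfin : D.FiniteIndex := ⟨hD0⟩
  have hDo : IsOpen (D : Set G) :=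
    Subgroup.isOpen_of_isClosed_of_finiteIndex D (Subgroup.isClosed_topologicalClosure _)
  have hDK : D ≤ K := C.derivedLine_le_comap hk i
  have hKn : K.Normal := by
    rw [hK, ← C.map_commutator_line hk, Subgroup.comap_map_eq]
    infer_instance
  have hKM : K ≤ F.line i := by
    rw [hK, ← C.map_commutator_line hk, Subgroup.comap_map_eq]
    refine sup_le (Subgroup.commutator_le_left _ _) fun g hg => ?_
    refine (C.mem_line_iff hk (γ := 1) ?_).2 (one_mem _)
    rw [MonoidHom.mem_ker.1 hg, map_one]
    rfl
  have hDM := F.derivedLine_le i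
  have hmk := QuotientGroup.mk'_surjective D
  have : Finite (G ⧸ D) := Subgroup.finite_quotient_of_finiteIndex
  have : ((F.line i).map (QuotientGroup.mk' D)).Normal := Subgroup.Normal.map inferInstance _ hmk
  have : (K.map (QuotientGroup.mk' D)).Normal := Subgroup.Normal.map hKn _ hmk
  have hmem : ∀ {S : Subgroup G}, D ≤ S → ∀ {g : G},
      (g : G ⧸ D) ∈ S.map (QuotientGroup.mk' D) ↔ g ∈ S := by
    intro S hS g
    have h1 : g ∈ (S.map (QuotientGroup.mk' D)).comap (QuotientGroup.mk' D) ↔ g ∈ S := by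
      rw [Subgroup.comap_map_eq, QuotientGroup.ker_mk', sup_of_le_left hS]
    exact h1
  have h3 := pow_three_mem_of_abelian_index_three (hG.isPGroup_quotient hDo)
    (A := (F.line i).map (QuotientGroup.mk' D)) (K := K.map (QuotientGroup.mk' D))
    (n := (n : G ⧸ D)) ?_ ?_ ?_ (Subgroup.map_mono hKM) ?_ ?_
  · rw [← QuotientGroup.mk_pow, hmem hDK, hK, Subgroup.mem_comap, map_pow] at h3
    exact h3
  · rintro _ ⟨a, ha, rfl⟩ _ ⟨b, hb, rfl⟩
    rw [← map_mul, ← map_mul]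
    refine QuotientGroup.eq.2 (Subgroup.le_topologicalClosure _ ?_)
    have := Subgroup.commutator_mem_commutator (inv_mem hb) (inv_mem ha)
    rw [commutatorElement_def] at this
    convert this using 1
    group
  · rw [Subgroup.index_map_eq _ hmk (by rwa [QuotientGroup.ker_mk']), index_line]
  · have h4 : (commutator G).topologicalClosure ≤ (commutator (G ⧸ D)).comap (QuotientGroup.mk' D) := by
      refine Subgroup.topologicalClosure_minimal _ ?_ ?_
      · rw [← Subgroup.map_le_iff_le_comap, commutator_def, Subgroup.map_commutator]
        exact Subgroup.commutator_mono le_top le_top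
      · refine Subgroup.isClosed_of_le_of_isOpen hDo fun g hg => ?_
        rw [Subgroup.mem_comap, QuotientGroup.mk'_apply, (QuotientGroup.eq_one_iff g).2 hg]
        exact one_mem _
    have h5 := Subgroup.index_dvd_of_le h4
    rw [h9, Subgroup.index_comap_of_surjective _ hmk] at h5
    exact Nat.le_of_dvd (by norm_num) h5
  -- If the preimage of `J` were no larger than the commutator subgroup of the line, comparison of
  -- indices in `Γ_0` would give `N_l ≤ M'`, against `hl`.
  · intro hbot
    apply hl
    have h6 : K ≤ D := by
      intro g hg
      have := (hmem hDK).2 hg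
      rw [hbot, Subgroup.mem_bot] at this
      exact (QuotientGroup.eq_one_iff g).1 this
    have h7 := C.index_comap_J hk i
    rw [← hK, le_antisymm h6 hDK, hD, index_derivedLine, hm, ← index_commutator_line] at h7
    have h8 := Subgroup.eq_of_le_of_index_eq (G := PCGroup 0) le_sup_left h7 (by
      rw [index_commutator_line, ← hm, ← index_derivedLine]
      exact hD0)
    rw [h8]
    exact le_sup_right
  · rwa [hmem hDM]

end Cover
end Frame

/-! ### Generators of a cover and the exponents of their cubes. -/

namespace Frame
variable {G : Type*} [Group G] [TopologicalSpace G] [IsTopologicalGroup G] {F : Frame G}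

/-- Compatible homomorphism to the quotient of `Γ₀` by a term of the chain. -/
def IsStage (F : Frame G) (k : ℕ) : Prop :=
  ∃ φ₀ : G →* PCGroup 0 ⧸ chain (PCGroup.gen 0) k, IsOpen (φ₀.ker : Set G) ∧
    φ₀ F.x = PCGroup.gen 0 0 ∧ φ₀ F.y = PCGroup.gen 0 1

namespace Cover
variable {k l : ℕ} {W : Type*} [Group W] (C : F.Cover k l W)

/-- The elements of the cover which correspond to the generators. -/
def gens (C : F.Cover k l W) (i : ℕ) : W :=
  if i = 0 then C.φ F.x else if i = 1 then C.φ F.y else C.j (PCGroup.gen 0 i)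

theorem gens_of_le {i : ℕ} (hi : 2 ≤ i) : C.gens i = C.j (PCGroup.gen 0 i) := by
  rw [gens, if_neg (by omega), if_neg (by omega)]

theorem gens_eq_one {i : ℕ} (hi : 8 ≤ i) : C.gens i = 1 := by
  rw [C.gens_of_le (by omega), PCGroup.gen_of_le 0 hi, map_one]

theorem ev_gens {w : List ℕ} (hw : ∀ i ∈ w, 2 ≤ i) : ev C.gens w = C.j (ev (PCGroup.gen 0) w) := by
  rw [map_ev]
  exact ev_congr fun i hi => C.gens_of_le (hw i hi)

theorem q_gens (i : ℕ) : C.q (C.gens i) = PCGroup.gen 0 i := by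
  rw [gens]
  split_ifs with h0 h1
  · rw [h0, C.q_x]
  · rw [h1, C.q_y]
  · exact C.q_j _

/-- The central factor by which a generator of the cover differs from that of `Γ₀`. -/
def twist (C : F.Cover k l W) (i : ℕ) : W := (C.j (PCGroup.gen 0 i))⁻¹ * C.gens i

theorem q_twist (i : ℕ) : C.q (C.twist i) = 1 := by
  rw [twist, map_mul, map_inv, C.q_gens, C.q_j, inv_mul_cancel]

theorem gens_eq (i : ℕ) : C.gens i = C.j (PCGroup.gen 0 i) * C.twist i := by
  rw [twist, mul_inv_cancel_left]

theorem twist_central (i : ℕ) (w : W) : w * C.twist i = C.twist i * w :=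
  Subgroup.mem_center_iff.1 (C.central _ (C.q_twist i)) w

theorem twist_of_le {i : ℕ} (hi : 2 ≤ i) : C.twist i = 1 := by
  rw [twist, C.gens_of_le hi, inv_mul_cancel]

theorem gens_pow_three (i : ℕ) :
    C.gens i ^ 3 = C.j (PCGroup.gen 0 i ^ 3) * C.twist i ^ 3 := by
  have h : Commute (C.j (PCGroup.gen 0 i)) (C.twist i) := C.twist_central i _
  rw [gens_eq, h.mul_pow, map_pow]

theorem gens_comm {i m : ℕ} (h : i < m) :
    C.gens m * C.gens i = C.gens i * C.gens m * ev C.gens ((pcData 0 0 0 0).cw m i) := by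
  have := (((PCGroup.sat_gen 0).map C.j).satTail.twist (c := C.twist)
    (fun i k hk => two_le_of_mem_pw hk) (fun j i k hk => two_le_of_mem_cw hk)
    (fun i x => C.twist_central i x) (fun i hi => C.twist_of_le hi)).comm i m h
  rw [if_neg (by omega), mul_one] at this
  rw [show C.gens = fun i => C.j (PCGroup.gen 0 i) * C.twist i from funext C.gens_eq]
  exact this

theorem sat_gens {a b c d : ℕ}
    (h0 : C.gens 0 ^ 3 = C.j (ev (PCGroup.gen 0) ((pcData a b c d).pw 0)))
    (h1 : C.gens 1 ^ 3 = C.j (ev (PCGroup.gen 0) ((pcData a b c d).pw 1))) :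
    (pcData a b c d).Sat C.gens := by
  constructor
  · intro i
    rw [C.ev_gens fun k hk => two_le_of_mem_pw hk]
    rcases i with _ | _ | i
    · exact h0
    · exact h1
    · rw [C.gens_of_le (by omega), ← map_pow, (PCGroup.sat_gen 0).pow]
      rcases i with _ | _ | _ | i <;> rfl
  · exact fun i m h => C.gens_comm h

theorem range_le (hG : IsProP 3 G) {S : Subgroup W} (h0 : C.gens 0 ∈ S) (h1 : C.gens 1 ∈ S) :
    C.φ.range ≤ S := by
  have h := F.closure_pair hG (C.isClosed_comap S) h0 h1
  rintro _ ⟨g, rfl⟩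
  have : g ∈ S.comap C.φ := by rw [h]; trivial
  exact this

/-- When both twists have trivial cube, the generators of the cover satisfy the relations of `Γ_0`.
The resulting map `θ` agrees with `j` on `N_2` and is compatible with `q`, so its kernel is `N_l`,
and its image contains that of `G`. -/
theorem isStage (hG : IsProP 3 G) (hk : 2 ≤ k) (hkl : k ≤ l) (h0 : C.twist 0 ^ 3 = 1)
    (h1 : C.twist 1 ^ 3 = 1) : F.IsStage l := by
  have hsat : (pcData 0 0 0 0).Sat C.gens := C.sat_gens
    (by rw [C.gens_pow_three, h0, mul_one, (PCGroup.sat_gen 0).pow])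
    (by rw [C.gens_pow_three, h1, mul_one, (PCGroup.sat_gen 0).pow])
  let θ : PCGroup 0 →* W := PCGroup.lift (fun i hi => C.gens_eq_one hi) hsat
  have hθ : ∀ i, θ (PCGroup.gen 0 i) = C.gens i := PCGroup.lift_gen _ _
  have hqθ : C.q.comp θ = QuotientGroup.mk' _ :=
    PCGroup.hom_ext fun i => (congrArg C.q (hθ i)).trans (C.q_gens i)
  have hθj : ∀ n ∈ chain (PCGroup.gen 0) 2, θ n = C.j n := by
    intro n hn
    have : chain (PCGroup.gen 0) 2 ≤ MonoidHom.eqLocus θ C.j := by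
      rw [chain, Subgroup.closure_le]
      rintro _ ⟨i, hi, rfl⟩
      exact (hθ i).trans (C.gens_of_le hi)
    exact this hn
  have hker : θ.ker = chain (PCGroup.gen 0) l := by
    ext γ
    constructor
    · intro hγ
      have h2 : (γ : PCGroup 0 ⧸ chain (PCGroup.gen 0) k) = 1 := by
        have := DFunLike.congr_fun hqθ γ
        rw [MonoidHom.comp_apply, MonoidHom.mem_ker.1 hγ, map_one] at this
        exact this.symm
      have h3 := chain_anti hk ((QuotientGroup.eq_one_iff γ).1 h2)
      rw [← C.ker_j, MonoidHom.mem_ker, ← hθj γ h3]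
      exact hγ
    · intro hγ
      rw [MonoidHom.mem_ker, hθj γ (chain_anti (hk.trans hkl) hγ), ← MonoidHom.mem_ker, C.ker_j]
      exact hγ
  have hrange : ∀ g, C.φ g ∈ θ.range := fun g =>
    C.range_le hG (S := θ.range) ⟨_, hθ 0⟩ ⟨_, hθ 1⟩ ⟨g, rfl⟩
  let e : PCGroup 0 ⧸ chain (PCGroup.gen 0) l ≃* θ.range :=
    (QuotientGroup.quotientMulEquivOfEq hker.symm).trans (QuotientGroup.quotientKerEquivRange θ)
  have he : ∀ γ : PCGroup 0, (e γ : W) = θ γ := fun γ => rfl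
  refine ⟨e.symm.toMonoidHom.comp (C.φ.codRestrict θ.range hrange), ?_, ?_, ?_⟩
  · refine Subgroup.isOpen_mono (fun g hg => ?_) C.isOpen_ker
    have : C.φ.codRestrict θ.range hrange g = 1 := Subtype.ext hg
    rw [MonoidHom.mem_ker, MonoidHom.comp_apply, this, map_one]
  · exact e.symm_apply_eq.2 (Subtype.ext ((he _).trans (hθ 0)).symm)
  · exact e.symm_apply_eq.2 (Subtype.ext ((he _).trans (hθ 1)).symm)

/-- The word for the cube of the generator of a line, with given tails. -/
def cubeWord (k a b c d : ℕ) (i : Fin 4) : List ℕ :=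
  (List.replicate 3 (PCGroup.lineData i).rep).flatten ++
    ((List.replicate (dir i).1.val (List.replicate a k ++ List.replicate b (k + 1))).flatten ++
      (List.replicate (dir i).2.val (List.replicate c k ++ List.replicate d (k + 1))).flatten)

theorem exists_word {B : ℕ} (hB : l ≤ k + 1 ∧ B = 1 ∨ l ≤ k + 2 ∧ B = 3) {n : W}
    (hn : n ∈ (chain (PCGroup.gen 0) k).map C.j) : ∃ a < 3, ∃ b < B,
      n = C.j (ev (PCGroup.gen 0) (List.replicate a k ++ List.replicate b (k + 1))) := by
  obtain ⟨γ, hγ, rfl⟩ := hn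
  obtain ⟨a, ha, n, hn, rfl⟩ := (PCGroup.model 0).exists_pow_mul hγ
  have hker : ∀ n ∈ chain (PCGroup.gen 0) l, C.j n = 1 := fun n hn => by
    rwa [← C.ker_j] at hn
  rcases hB with ⟨hl, rfl⟩ | ⟨hl, rfl⟩
  · refine ⟨a, ha, 0, by norm_num, ?_⟩
    rw [map_mul, hker n (chain_anti hl hn)]
    simp [ev]
  · obtain ⟨b, hb, n', hn', rfl⟩ := (PCGroup.model 0).exists_pow_mul hn
    refine ⟨a, ha, b, hb, ?_⟩
    rw [map_mul, map_mul, hker n' (chain_anti hl hn')]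
    simp [ev]

theorem map_pt (i : Fin 4) : C.φ (F.pt (dir i).1 (dir i).2) ^ 3 =
    C.j (ev (PCGroup.gen 0) (List.replicate 3 (PCGroup.lineData i).rep).flatten) *
      ((C.twist 0 ^ 3) ^ (dir i).1.val * (C.twist 1 ^ 3) ^ (dir i).2.val) := by
  have h0 : C.φ F.x = C.j (PCGroup.gen 0 0) * C.twist 0 := C.gens_eq 0
  have h1 : C.φ F.y = C.j (PCGroup.gen 0 1) * C.twist 1 := C.gens_eq 1
  have c0 : ∀ w, Commute w (C.twist 0) := C.twist_central 0
  have c1 : ∀ w, Commute w (C.twist 1) := C.twist_central 1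
  rw [PCGroup.ev_flatten_replicate, PCGroup.ev_rep]
  simp only [pt, map_mul, map_pow, h0, h1]
  rw [(c0 _).mul_pow, (c1 _).mul_pow]
  generalize (dir i).1.val = m
  generalize (dir i).2.val = n
  have h2 : C.j (PCGroup.gen 0 0) ^ m * C.twist 0 ^ m * (C.j (PCGroup.gen 0 1) ^ n * C.twist 1 ^ n) =
      C.j (PCGroup.gen 0 0) ^ m * C.j (PCGroup.gen 0 1) ^ n * (C.twist 0 ^ m * C.twist 1 ^ n) := by
    rw [mul_assoc, ← mul_assoc (C.twist 0 ^ m), ← ((c0 (C.j (PCGroup.gen 0 1) ^ n)).pow_right m).eq]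
    simp only [mul_assoc]
  have h3 : Commute (C.j (PCGroup.gen 0 0) ^ m * C.j (PCGroup.gen 0 1) ^ n)
      (C.twist 0 ^ m * C.twist 1 ^ n) := ((c0 _).pow_right m).mul_right ((c1 _).pow_right n)
  have h4 : Commute (C.twist 0 ^ m) (C.twist 1 ^ n) := (c1 _).pow_right n
  rw [h2, h3.mul_pow, h4.mul_pow, ← pow_mul, ← pow_mul, ← pow_mul, ← pow_mul, mul_comm m 3,
    mul_comm n 3]
  rfl

/-- The cubes of the generators of the lines in the cover. -/
theorem exists_cubeWord {B : ℕ} (hB : l ≤ k + 1 ∧ B = 1 ∨ l ≤ k + 2 ∧ B = 3) :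
    ∃ a < 3, ∃ b < B, ∃ c < 3, ∃ d < B,
      C.twist 0 ^ 3 =
        C.j (ev (PCGroup.gen 0) (List.replicate a k ++ List.replicate b (k + 1))) ∧
      C.twist 1 ^ 3 =
        C.j (ev (PCGroup.gen 0) (List.replicate c k ++ List.replicate d (k + 1))) ∧
      ∀ i, C.φ (F.pt (dir i).1 (dir i).2) ^ 3 =
        C.j (ev (PCGroup.gen 0) (cubeWord k a b c d i)) := by
  obtain ⟨a, ha, b, hb, h0⟩ := C.exists_word hB (C.cube _ (C.q_twist 0))
  obtain ⟨c, hc, d, hd, h1⟩ := C.exists_word hB (C.cube _ (C.q_twist 1))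
  refine ⟨a, ha, b, hb, c, hc, d, hd, h0, h1, fun i => ?_⟩
  rw [map_pt, h0, h1, cubeWord]
  generalize List.replicate a k ++ List.replicate b (k + 1) = u
  generalize List.replicate c k ++ List.replicate d (k + 1) = v
  rw [ev_append, ev_append, map_mul, map_mul, PCGroup.ev_flatten_replicate _ (dir i).1.val,
    PCGroup.ev_flatten_replicate _ (dir i).2.val, map_pow, map_pow]

end Cover
end Frame

/-! ### Membership in the commutator subgroups of the lines of `Γ_0`, decided by collection. -/

namespace PCGroup

/-- The order of the abelianization is known, so the inclusion `commutator_le_derived` is an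
equality by counting. -/
theorem commutator_line_eq_derived (i : Fin 4) :
    ⁅(frame 0).line i, (frame 0).line i⁆ = derived 0 i := by
  have := (model 0).finite
  have h1 := card_derived_le (Or.inl rfl : (0 = 0 ∨ 0 = 2)) i
  have h2 := (⁅(frame 0).line i, (frame 0).line i⁆ : Subgroup (PCGroup 0)).card_mul_index
  rw [Frame.Cover.index_commutator_line, card_ab (Or.inl rfl), card_eq (Or.inl rfl)] at h2
  have h3 : ∀ i : Fin 4, (lineWords 0 i).ord * (lineWords 0 i).ord₂ =
      if i = 0 then 243 else 27 := by decide
  rw [h3] at h1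
  refine Subgroup.eq_of_le_of_card_ge (commutator_le_derived (Or.inl rfl) i) ?_
  split_ifs at h1 h2 <;> omega

/-- A necessary condition for an element to lie in the commutator subgroup of a line modulo
`N_l`. -/
def memTest (l : ℕ) (i : Fin 4) (w : List ℕ) : Bool :=
  (List.range 9).any fun t => !leadingLt l ((pcData 0 0 0 0).collect
    ((List.replicate t (lineData i).z).flatten ++ w))

theorem memTest_of_mem {l : ℕ} {i : Fin 4} (hl : l ≤ (lineData i).m) {w : List ℕ}
    (hw : ev (gen 0) w ∈ ⁅(frame 0).line i, (frame 0).line i⁆ ⊔ chain (gen 0) l) :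
    memTest l i w = true := by
  have h9 : ev (gen 0) (lineData i).z ^ 9 = 1 := by
    have := (sat_gen 0).collect_eq (List.replicate 9 (lineData i).z).flatten
    rwa [(check_z (Or.inl rfl) i).2.1, ev_flatten_replicate] at this
  rw [commutator_line_eq_derived, Subgroup.mem_sup_of_normal_right] at hw
  obtain ⟨y, hy, n, hn, hyn⟩ := hw
  obtain ⟨s, hs, n', hn', rfl⟩ := exists_of_mem_chainZ (q := 9) (by norm_num)
    (by rw [h9]; exact one_mem _) hy
  simp only [memTest, List.any_eq_true, List.mem_range, Bool.not_eq_true']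
  refine ⟨(9 - s) % 9, Nat.mod_lt _ (by norm_num), Bool.eq_false_iff.2 fun hlt => ?_⟩
  refine (model 0).ev_notMem (card_eq (Or.inl rfl)) hlt ?_
  have hz : ev (gen 0) (lineData i).z ^ ((9 - s) % 9 + s) = 1 := by
    rcases Nat.eq_zero_or_pos s with rfl | hs0
    · exact pow_zero _
    · rw [Nat.mod_eq_of_lt (by omega), Nat.sub_add_cancel hs.le, h9]
  rw [ev_append, ev_flatten_replicate, ← hyn, mul_assoc _ n', ← mul_assoc, ← pow_add, hz, one_mul]
  exact mul_mem (chain_anti hl hn') hn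

theorem not_chain_le {l k : ℕ} {i : Fin 4} (hk : memTest (lineData i).m i [k] = false)
    (hl : l ≤ k) : ¬ chain (gen 0) l ≤ ⁅(frame 0).line i, (frame 0).line i⁆ := by
  intro h
  have h1 : ev (gen 0) [k] ∈ ⁅(frame 0).line i, (frame 0).line i⁆ ⊔
      chain (gen 0) (lineData i).m := by
    refine Subgroup.mem_sup_left (h ?_)
    rw [ev_cons, ev_nil, mul_one]
    exact mem_chain hl
  rw [memTest_of_mem le_rfl h1] at hk
  exact Bool.noConfusion hk

theorem not_chain_le_zero {l : ℕ} (hl : l ≤ 7) :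
    ¬ chain (gen 0) l ≤ ⁅(frame 0).line 0, (frame 0).line 0⁆ :=
  not_chain_le (k := 7) (by decide +kernel) hl

theorem not_chain_le_one {l : ℕ} (hl : l ≤ 3) :
    ¬ chain (gen 0) l ≤ ⁅(frame 0).line 1, (frame 0).line 1⁆ :=
  not_chain_le (k := 3) (by decide +kernel) hl

theorem chain_five_le {i : Fin 4} (hi : i ≠ 0) :
    chain (gen 0) 5 ≤ ⁅(frame 0).line i, (frame 0).line i⁆ := by
  have h : ∀ i : Fin 4, i ≠ 0 → (lineData i).m = 5 := by decide
  rw [commutator_line_eq_derived, ← h i hi]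
  exact chain_le_derived i

theorem mem_of_collect {l t : ℕ} {i : Fin 4} {w : List ℕ}
    (h : ((pcData 0 0 0 0).collect ((List.replicate t (lineData i).z).flatten ++ w)).all
      (fun k => Nat.ble l k) = true) :
    ev (gen 0) w ∈ ⁅(frame 0).line i, (frame 0).line i⁆ ⊔ chain (gen 0) l := by
  have h1 := (model 0).ev_mem h
  rw [ev_append, ev_flatten_replicate] at h1
  have h2 : ev (gen 0) (lineData i).z ^ t ∈
      ⁅(frame 0).line i, (frame 0).line i⁆ ⊔ chain (gen 0) l := by
    rw [commutator_line_eq_derived]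
    exact Subgroup.mem_sup_left (pow_mem (z_mem_derived i) t)
  exact (Subgroup.mul_mem_cancel_left _ h2).1 (Subgroup.mem_sup_right h1)

/-- A sufficient condition for `N_k / N_l` to be central and elementary abelian. -/
theorem central_of_check {k l : ℕ}
    (hc : (List.range 8).all (fun i => (List.range i).all fun m =>
      Nat.blt i k || ((pcData 0 0 0 0).cw i m).all fun r => Nat.ble l r) = true)
    (hp : (List.range 8).all (fun i =>
      Nat.blt i k || ((pcData 0 0 0 0).pw i).all fun r => Nat.ble l r) = true) :
    (∀ n ∈ chain (gen 0) k, ∀ γ, n⁻¹ * γ⁻¹ * n * γ ∈ chain (gen 0) l) ∧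
      ∀ n ∈ chain (gen 0) k, n ^ 3 ∈ chain (gen 0) l := by
  simp only [List.all_eq_true, List.mem_range, Bool.or_eq_true, Nat.blt_eq, Nat.ble_eq] at hc hp
  have hev : ∀ w : List ℕ, (∀ r ∈ w, l ≤ r) → ((ev (gen 0) w : PCGroup 0) :
      PCGroup 0 ⧸ chain (gen 0) l) = 1 := fun w hw =>
    (QuotientGroup.eq_one_iff _).2 (ev_mem_chain hw)
  have hcw : ∀ i m, m < i → k ≤ i → ((ev (gen 0) ((pcData 0 0 0 0).cw i m) : PCGroup 0) :
      PCGroup 0 ⧸ chain (gen 0) l) = 1 := by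
    intro i m hmi hki
    rcases lt_or_ge i 8 with hi | hi
    · exact hev _ ((hc i hi m hmi).resolve_left (by omega))
    · rw [(pcData_bounded 0 0 0 0).cw i m hi]
      rfl
  have hgen : ∀ i, k ≤ i → ∀ m, (gen 0 m : PCGroup 0 ⧸ chain (gen 0) l) * gen 0 i =
      gen 0 i * gen 0 m := by
    intro i hi m
    rcases lt_trichotomy i m with h | rfl | h
    · rw [← QuotientGroup.mk_mul, (sat_gen 0).comm i m h, QuotientGroup.mk_mul,
        hcw m i h (hi.trans h.le), mul_one, QuotientGroup.mk_mul]
    · rfl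
    · rw [eq_comm, ← QuotientGroup.mk_mul, (sat_gen 0).comm m i h, QuotientGroup.mk_mul,
        hcw i m h hi, mul_one, QuotientGroup.mk_mul]
  have hcen : ∀ n ∈ chain (gen 0) k, ∀ γ : PCGroup 0,
      (γ : PCGroup 0 ⧸ chain (gen 0) l) * n = n * γ := by
    intro n hn γ
    have hγ : γ ∈ Subgroup.closure (Set.range (gen 0)) := by rw [closure_gen]; trivial
    induction hn using Subgroup.closure_induction with
    | mem n hn =>
      obtain ⟨i, hi, rfl⟩ := hn
      induction hγ using Subgroup.closure_induction with
      | mem γ hγ =>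
        obtain ⟨m, rfl⟩ := hγ
        exact hgen i hi m
      | one => exact (one_mul _).trans (mul_one _).symm
      | mul a b _ _ ha hb =>
        exact (Commute.mul_left (show Commute _ _ from ha) (show Commute _ _ from hb)).eq
      | inv a _ ha => exact (Commute.inv_left (show Commute _ _ from ha)).eq
    | one => exact (mul_one _).trans (one_mul _).symm
    | mul a b _ _ ha hb =>
      exact (Commute.mul_right (show Commute _ _ from ha) (show Commute _ _ from hb)).eq
    | inv a _ ha => exact (Commute.inv_right (show Commute _ _ from ha)).eq
  refine ⟨fun n hn γ => ?_, fun n hn => ?_⟩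
  · have := hcen n hn γ
    rw [← QuotientGroup.mk_mul, ← QuotientGroup.mk_mul, QuotientGroup.eq] at this
    convert this using 1
    group
  · rw [← QuotientGroup.eq_one_iff, QuotientGroup.mk_pow]
    induction hn using Subgroup.closure_induction with
    | mem n hn =>
      obtain ⟨i, hi, rfl⟩ := hn
      have hi' : k ≤ i := hi
      rw [← QuotientGroup.mk_pow, (sat_gen 0).pow]
      rcases lt_or_ge i 8 with h8 | h8
      · exact hev _ ((hp i h8).resolve_left (by omega))
      · rw [(pcData_bounded 0 0 0 0).pw i h8]
        rfl
    | one => exact one_pow 3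
    | mul a b ha _ iha ihb =>
      have : Commute (a : PCGroup 0 ⧸ chain (gen 0) l) b := (hcen a ha b).symm
      rw [QuotientGroup.mk_mul, this.mul_pow, iha, ihb, one_mul]
    | inv a _ ih => rw [QuotientGroup.mk_inv, inv_pow, ih, inv_one]

end PCGroup

/-! ### Climbing from `N_2` to `N_6` by means of the transfer data. -/

namespace Frame
variable {G : Type*} [Group G] [TopologicalSpace G] [IsTopologicalGroup G] {F : Frame G}

namespace Cover
variable {k l : ℕ} {W : Type*} [Group W] (C : F.Cover k l W)

theorem j_mem_J_iff {i : Fin 4} {γ : PCGroup 0} : C.j γ ∈ C.J i ↔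
    γ ∈ ⁅(PCGroup.frame 0).line i, (PCGroup.frame 0).line i⁆ ⊔ chain (PCGroup.gen 0) l := by
  rw [← C.ker_j, ← Subgroup.comap_map_eq]
  rfl

end Cover

theorem x_eq_pt : F.x = F.pt (dir 0).1 (dir 0).2 := by
  simp [pt, dir, ZMod.val_one]

theorem y_eq_pt : F.y = F.pt (dir 1).1 (dir 1).2 := by
  simp [pt, dir, ZMod.val_one]

theorem pt_notMem_line {i m : Fin 4} (h : i ≠ m) : F.pt (dir m).1 (dir m).2 ∉ F.line i :=
  fun hm => h (F.pt_mem_line.1 hm)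

/-- `Γ_0/N_2` is elementary abelian, so the two coordinates of the frame define the map. -/
theorem isStage_two : F.IsStage 2 := by
  have hcomm : ∀ a b : PCGroup 0, (a : PCGroup 0 ⧸ chain (PCGroup.gen 0) 2) * b = b * a := by
    intro a b
    rw [← QuotientGroup.mk_mul, ← QuotientGroup.mk_mul, QuotientGroup.eq,
      ← Cover.commutator_eq_chain]
    have := Subgroup.commutator_mem_commutator (G := PCGroup 0)
      (Subgroup.mem_top b⁻¹) (Subgroup.mem_top a⁻¹)
    rw [commutatorElement_def] at this
    rw [commutator_def]
    convert this using 1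
    group
  have hcube : ∀ i, (PCGroup.gen 0 i : PCGroup 0 ⧸ chain (PCGroup.gen 0) 2) ^ 3 = 1 := by
    intro i
    rw [← QuotientGroup.mk_pow, QuotientGroup.eq_one_iff, (PCGroup.sat_gen 0).pow]
    exact ev_mem_chain fun k hk => two_le_of_mem_pw hk
  have hval : ∀ (i : ℕ) (s t : ZMod 3),
      (PCGroup.gen 0 i : PCGroup 0 ⧸ chain (PCGroup.gen 0) 2) ^ (s + t).val =
        (PCGroup.gen 0 i : PCGroup 0 ⧸ chain (PCGroup.gen 0) 2) ^ s.val *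
        (PCGroup.gen 0 i : PCGroup 0 ⧸ chain (PCGroup.gen 0) 2) ^ t.val := by
    intro i s t
    rw [ZMod.val_add, ← pow_add]
    exact (pow_eq_pow_mod _ (hcube i)).symm
  let φ₀ : G →* PCGroup 0 ⧸ chain (PCGroup.gen 0) 2 := MonoidHom.mk'
    (fun g => (PCGroup.gen 0 0 : PCGroup 0 ⧸ chain (PCGroup.gen 0) 2) ^ (F.χ g).val *
      (PCGroup.gen 0 1 : PCGroup 0 ⧸ chain (PCGroup.gen 0) 2) ^ (F.ψ g).val) (by
      intro a b
      rw [F.χ_mul, F.ψ_mul, hval, hval]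
      have h1 : Commute ((PCGroup.gen 0 0 : PCGroup 0 ⧸ chain (PCGroup.gen 0) 2) ^ (F.χ b).val)
          ((PCGroup.gen 0 1 : PCGroup 0 ⧸ chain (PCGroup.gen 0) 2) ^ (F.ψ a).val) :=
        Commute.pow_pow (hcomm _ _) _ _
      simp only [mul_assoc]
      rw [← mul_assoc _ _ ((PCGroup.gen 0 1 : PCGroup 0 ⧸ chain (PCGroup.gen 0) 2) ^ (F.ψ b).val),
        h1.eq]
      simp only [mul_assoc])
  have hφ₀ : ∀ g, φ₀ g = (PCGroup.gen 0 0 : PCGroup 0 ⧸ chain (PCGroup.gen 0) 2) ^ (F.χ g).val *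
      (PCGroup.gen 0 1 : PCGroup 0 ⧸ chain (PCGroup.gen 0) 2) ^ (F.ψ g).val := fun _ => rfl
  refine ⟨φ₀, ?_, ?_, ?_⟩
  · refine Subgroup.isOpen_mono (H₁ := F.line 0 ⊓ F.line 1) ?_ ((F.isOpen_line 0).inter (F.isOpen_line 1))
    rintro g ⟨h0, h1⟩
    have h0' : F.ψ g = 0 := by simpa [mem_line, dir] using h0
    have h1' : F.χ g = 0 := by simpa [mem_line, dir, eq_comm] using h1
    rw [MonoidHom.mem_ker, hφ₀, h0', h1']
    simp
  · rw [hφ₀, F.χ_x, F.ψ_x]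
    simp [ZMod.val_one]
  · rw [hφ₀, F.χ_y, F.ψ_y]
    simp [ZMod.val_one]

end Frame

namespace Frame

/-- The kernel type `(1,4,3,1)`, with labels starting at `0`. -/
def kernelLabel : Fin 4 → Fin 4 := ![0, 3, 2, 0]

variable {G : Type*} [Group G] [TopologicalSpace G] [IsTopologicalGroup G]

/-- A frame of a group which satisfies the conditions of the classification, adapted to the
transfer target type; `τ` is the transfer kernel type. -/
structure IsAdapted (F : Frame G) (τ : Fin 4 → Fin 4) : Prop where
  isProP : IsProP 3 G
  cocyclesLift : CocyclesLift G
  index_closure : (commutator G).topologicalClosure.index = 9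
  card_ab : ∀ i, Nat.card (TopologicalAbelianization (F.line i)) =
    Nat.card (TopologicalAbelianization ((PCGroup.frame 0).line i))
  cubeTrivial_iff : ∀ i m, i ≠ m → (F.CubeTrivial i (F.pt (dir m).1 (dir m).2) ↔ τ i = m)
  exists_perm : ∃ π : Fin 4 → Fin 4, Function.Injective π ∧ (∀ i, τ (π i) = π (kernelLabel i)) ∧
    (π 1 = 1 ∨ π 1 = 0)

namespace IsAdapted
variable {F : Frame G} {τ : Fin 4 → Fin 4}

theorem exists_cover (A : F.IsAdapted τ) {k l : ℕ} (h : F.IsStage k) (hkl : k ≤ l)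
    (hc : (List.range 8).all (fun i => (List.range i).all fun m =>
      Nat.blt i k || ((pcData 0 0 0 0).cw i m).all fun r => Nat.ble l r) = true)
    (hp : (List.range 8).all (fun i =>
      Nat.blt i k || ((pcData 0 0 0 0).pw i).all fun r => Nat.ble l r) = true) :
    ∃ (W : Type) (_ : Group W), Nonempty (F.Cover k l W) := by
  obtain ⟨φ₀, hφ₀, hx, hy⟩ := h
  obtain ⟨h1, h2⟩ := PCGroup.central_of_check hc hp
  exact F.exists_cover A.cocyclesLift hkl hφ₀ hx hy h1 h2

theorem isStage_three (A : F.IsAdapted τ) : F.IsStage 3 := by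
  obtain ⟨W, _, ⟨C⟩⟩ := A.exists_cover (k := 2) (l := 3) isStage_two (by norm_num)
    (by decide +kernel) (by decide +kernel)
  have hJ : ∀ i : Fin 4, i = 0 ∨ i = 1 → ∀ w ∈ C.J i, w = 1 := by
    rintro i hi _ ⟨γ, hγ, rfl⟩
    rw [← MonoidHom.mem_ker, C.ker_j]
    have hle : PCGroup.derived 0 i ≤ chain (PCGroup.gen 0) 3 := by
      intro γ hγ
      have hz : ev (PCGroup.gen 0) (PCGroup.lineData i).z ∈ chain (PCGroup.gen 0) 3 := by
        refine ev_mem_chain ?_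
        rcases hi with rfl | rfl <;> decide
      obtain ⟨n, hn⟩ := Subgroup.mem_zpowers_iff.1 hγ
      have hm : 3 ≤ (PCGroup.lineData i).m := by rcases hi with rfl | rfl <;> decide
      rw [QuotientGroup.mk'_apply, ← QuotientGroup.mk_zpow, QuotientGroup.eq] at hn
      exact (Subgroup.mul_mem_cancel_left _ (inv_mem (zpow_mem hz n))).1 (chain_anti hm hn)
    rw [SetLike.mem_coe, PCGroup.commutator_line_eq_derived] at hγ
    exact hle hγ
  have h3 : ∀ i, C.gens i ^ 3 = 1 → i < 2 → C.twist i ^ 3 = 1 := by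
    intro i hi h2
    rw [C.gens_pow_three] at hi
    have : C.j (PCGroup.gen 0 i ^ 3) = 1 := by
      rw [← MonoidHom.mem_ker, C.ker_j, (PCGroup.sat_gen 0).pow]
      refine ev_mem_chain ?_
      interval_cases i <;> decide
    rwa [this, one_mul] at hi
  refine C.isStage A.isProP le_rfl (by norm_num) (h3 0 (hJ 1 (Or.inr rfl) _ ?_) (by norm_num))
    (h3 1 (hJ 0 (Or.inl rfl) _ ?_) (by norm_num))
  · refine C.pow_three_mem A.isProP A.index_closure le_rfl (A.card_ab 1)
      (PCGroup.not_chain_le_one le_rfl) ?_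
    rw [x_eq_pt]
    exact F.pt_notMem_line (by decide)
  · refine C.pow_three_mem A.isProP A.index_closure le_rfl (A.card_ab 0)
      (PCGroup.not_chain_le_zero (by norm_num)) ?_
    rw [y_eq_pt]
    exact F.pt_notMem_line (by decide)

end IsAdapted
end Frame

namespace PCGroup
open Frame Cover

/-- The exponents modulo `N_5` of the cube of the generator of a line, with given tails. -/
def cubeCoord (a b c d : ℕ) (i : Fin 4) : ℕ × ℕ :=
  ((![0, 1, 2, 1] i + (dir i).1.val * a + (dir i).2.val * c) % 3,
    (![1, 0, 0, 0] i + (dir i).1.val * b + (dir i).2.val * d) % 3)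

theorem cubeCoord_lt (a b c d : ℕ) (i : Fin 4) :
    (cubeCoord a b c d i).1 < 3 ∧ (cubeCoord a b c d i).2 < 3 :=
  ⟨Nat.mod_lt _ (by norm_num), Nat.mod_lt _ (by norm_num)⟩

theorem collect_cubeWord : ∀ a < 3, ∀ b < 3, ∀ c < 3, ∀ d < 3, ∀ i : Fin 4,
    ((pcData 0 0 0 0).collect (cubeWord 3 a b c d i)).filter (Nat.blt · 5) =
      List.replicate (cubeCoord a b c d i).1 3 ++ List.replicate (cubeCoord a b c d i).2 4 := by
  decide +kernel

/-- For `i ≠ 0`, the group `M_i' N_5 / N_5` is spanned in the coordinates `g_3`, `g_4` by the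
direction of line `i` itself, so membership is vanishing of a determinant mod 3. -/
theorem check_coord : ∀ i : Fin 4, i ≠ 0 → ∀ p < 3, ∀ q < 3,
    if (dir i).1.val * q % 3 = (dir i).2.val * p % 3 then ∃ t < 3,
      ((pcData 0 0 0 0).collect ((List.replicate t (lineData i).z).flatten ++
        (List.replicate p 3 ++ List.replicate q 4))).all (fun k => Nat.ble 5 k) = true
    else memTest 5 i (List.replicate p 3 ++ List.replicate q 4) = false := by
  decide +kernel

theorem mem_sup_chain_five_iff {i : Fin 4} (hi : i ≠ 0) {p q : ℕ} (hp : p < 3) (hq : q < 3) :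
    ev (gen 0) (List.replicate p 3 ++ List.replicate q 4) ∈
      ⁅(frame 0).line i, (frame 0).line i⁆ ⊔ chain (gen 0) 5 ↔
    (dir i).1.val * q % 3 = (dir i).2.val * p % 3 := by
  have h := check_coord i hi p hp q hq
  have h5 : ∀ i : Fin 4, 5 ≤ (lineData i).m := by decide
  split_ifs at h with hc
  · obtain ⟨t, -, ht⟩ := h
    exact iff_of_true (mem_of_collect ht) hc
  · refine iff_of_false (fun hm => ?_) hc
    rw [memTest_of_mem (h5 i) hm] at h
    exact Bool.noConfusion h

theorem memTest_five_zero : ∀ p < 3, ∀ q < 3, q ≠ 0 →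
    memTest 5 0 (List.replicate p 3 ++ List.replicate q 4) = false := by
  decide +kernel

set_option synthInstance.maxHeartbeats 400000 in
set_option synthInstance.maxSize 20000 in
theorem tails_of_kernelType : ∀ p₁ : Fin 4, p₁ = 1 ∨ p₁ = 0 → ∀ p₀ : Fin 4, p₀ ≠ p₁ →
    ∀ p₂ : Fin 4, p₂ ≠ p₀ ∧ p₂ ≠ p₁ → ∀ p₃ : Fin 4, p₃ ≠ p₀ ∧ p₃ ≠ p₁ ∧ p₃ ≠ p₂ →
    ∀ a < 3, ∀ b < 3, ∀ c < 3, ∀ d < 3, (∀ m, m ≠ 0 → (cubeCoord a b c d m).2 = 0) →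
    (∀ i : Fin 4, ![p₀, p₁, p₂, p₃] i ≠ 0 → ∀ m, ![p₀, p₁, p₂, p₃] i ≠ m →
      ((dir (![p₀, p₁, p₂, p₃] i)).1.val * (cubeCoord a b c d m).2 % 3 =
        (dir (![p₀, p₁, p₂, p₃] i)).2.val * (cubeCoord a b c d m).1 % 3 ↔
          ![p₀, p₁, p₂, p₃] (kernelLabel i) = m)) →
    (a = 0 ∧ b = 0 ∧ c = 0 ∧ d = 0) ∧ p₃ = 0 ∧ (p₀ = 2 ∨ p₀ = 3) := by
  decide +kernel

end PCGroup

namespace Frame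
variable {G : Type*} [Group G] [TopologicalSpace G] [IsTopologicalGroup G]
namespace IsAdapted
variable {F : Frame G} {τ : Fin 4 → Fin 4}

theorem isStage_five (A : F.IsAdapted τ) : F.IsStage 5 ∧ (τ 0 = 2 ∨ τ 0 = 3) := by
  obtain ⟨W, _, ⟨C⟩⟩ := A.exists_cover (k := 3) (l := 5) A.isStage_three (by norm_num)
    (by decide +kernel) (by decide +kernel)
  obtain ⟨a, ha, b, hb, c, hc, d, hd, h0, h1, hw⟩ :=
    C.exists_cubeWord (Or.inr ⟨le_rfl, rfl⟩)
  obtain ⟨π, hπ, hτ, hπ1⟩ := A.exists_perm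
  have hne : ∀ i j, i ≠ j → π i ≠ π j := fun i j h e => h (hπ e)
  have hcoord : ∀ m, C.j (ev (PCGroup.gen 0) (Cover.cubeWord 3 a b c d m)) =
      C.j (ev (PCGroup.gen 0) (List.replicate (PCGroup.cubeCoord a b c d m).1 3 ++
        List.replicate (PCGroup.cubeCoord a b c d m).2 4)) := by
    intro m
    rw [← PCGroup.collect_cubeWord a ha b hb c hc d hd m, (PCGroup.sat_gen 0).collect_eq,
      map_ev, map_ev, ev_filter]
    intro i hi
    rw [← MonoidHom.mem_ker, C.ker_j]
    refine mem_chain ?_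
    by_contra hlt
    simp only [Nat.blt_eq, Bool.eq_false_iff, ne_eq] at hi
    omega
  have hπv : ![π 0, π 1, π 2, π 3] = π := by
    funext i
    fin_cases i <;> rfl
  have hpolar : ∀ m, m ≠ 0 → (PCGroup.cubeCoord a b c d m).2 = 0 := by
    intro m hm
    by_contra h
    have h1 := C.pow_three_mem A.isProP A.index_closure (by norm_num) (A.card_ab 0)
      (PCGroup.not_chain_le_zero (by norm_num)) (F.pt_notMem_line hm.symm)
    rw [hw, hcoord, C.j_mem_J_iff] at h1
    have h2 := PCGroup.memTest_of_mem (by decide) h1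
    rw [PCGroup.memTest_five_zero _ (PCGroup.cubeCoord_lt a b c d m).1 _
      (PCGroup.cubeCoord_lt a b c d m).2 h] at h2
    exact Bool.noConfusion h2
  obtain ⟨⟨rfl, rfl, rfl, rfl⟩, h3, h2⟩ := PCGroup.tails_of_kernelType (π 1) hπ1 (π 0)
    (hne _ _ (by decide)) (π 2) ⟨hne _ _ (by decide), hne _ _ (by decide)⟩ (π 3)
    ⟨hne _ _ (by decide), hne _ _ (by decide), hne _ _ (by decide)⟩ a ha b hb c hc d hd hpolar (by
      rw [hπv]
      intro i hi m hm
      rw [← hτ, ← A.cubeTrivial_iff _ _ hm, C.cubeTrivial_iff (by norm_num) (A.card_ab _)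
        (PCGroup.chain_five_le hi), hw, hcoord, C.j_mem_J_iff,
        PCGroup.mem_sup_chain_five_iff hi (PCGroup.cubeCoord_lt a b c d m).1
          (PCGroup.cubeCoord_lt a b c d m).2])
  refine ⟨C.isStage A.isProP (by norm_num) (by norm_num) ?_ ?_, ?_⟩
  · rw [h0]; simp [ev]
  · rw [h1]; simp [ev]
  · rw [← h3, hτ]
    exact h2

end IsAdapted

end Frame

theorem PCData.Sat.mem_of_pair {a b c d : ℕ} {T : Type*} [Group T] {h : ℕ → T}
    (H : (pcData a b c d).Sat h) {S : Subgroup T} (h0 : h 0 ∈ S) (h1 : h 1 ∈ S) {i : ℕ}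
    (hi : i < 8) : h i ∈ S := by
  have key : ∀ i j k, i < j → (pcData a b c d).cw j i = [k] → h i ∈ S → h j ∈ S → h k ∈ S := by
    intro i j k hij hk hi hj
    have := H.comm i j hij
    rw [hk, ev_cons, ev_nil, mul_one, ← inv_mul_eq_iff_eq_mul] at this
    rw [← this]
    exact mul_mem (inv_mem (mul_mem hi hj)) (mul_mem hj hi)
  have h2 := key 0 1 2 (by norm_num) rfl h0 h1
  have h3 := key 0 2 3 (by norm_num) rfl h0 h2
  have h4 := key 1 2 4 (by norm_num) rfl h1 h2
  have h6 := key 0 4 6 (by norm_num) rfl h0 h4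
  have h5 := key 1 4 5 (by norm_num) rfl h1 h4
  have h7 := key 1 5 7 (by norm_num) rfl h1 h5
  interval_cases i <;> assumption

namespace PCGroup
open Frame Cover

theorem memTest_six_zero : ∀ a < 3, ∀ c < 3, memTest 6 0 (cubeWord 5 a 0 c 0 1) = true →
    memTest 6 0 (cubeWord 5 a 0 c 0 2) = true → a = 0 ∧ c = 0 := by
  decide +kernel

theorem memTest_eight_zero : ∀ a < 3, ∀ c < 3, ∀ d < 2,
    memTest 8 0 (cubeWord 6 a 1 c d 2) = false ∧ memTest 8 0 (cubeWord 6 a 1 c d 3) = false := by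
  decide +kernel

theorem collect_cubeWord_one : ∀ a < 3, ∀ b < 3, ∀ c < 3, ∃ t < 9,
    ((pcData 0 0 0 0).collect ((List.replicate t (lineData 0).z).flatten ++
      cubeWord 6 a b c 2 1)).all (fun k => Nat.ble 8 k) = true := by
  decide +kernel

end PCGroup

namespace Frame
variable {G : Type*} [Group G] [TopologicalSpace G] [IsTopologicalGroup G]
namespace IsAdapted
variable {F : Frame G} {τ : Fin 4 → Fin 4}

theorem isStage_six (A : F.IsAdapted τ) : F.IsStage 6 := by
  obtain ⟨W, _, ⟨C⟩⟩ := A.exists_cover (k := 5) (l := 6) A.isStage_five.1 (by norm_num)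
    (by decide +kernel) (by decide +kernel)
  obtain ⟨a, ha, b, hb, c, hc, d, hd, h0, h1, hw⟩ :=
    C.exists_cubeWord (B := 1) (Or.inl ⟨le_rfl, rfl⟩)
  obtain rfl : b = 0 := by omega
  obtain rfl : d = 0 := by omega
  have hpolar : ∀ m, 0 ≠ m →
      PCGroup.memTest 6 0 (Cover.cubeWord 5 a 0 c 0 m) = true := by
    intro m hm
    have h := C.pow_three_mem A.isProP A.index_closure (by norm_num) (A.card_ab 0)
      (PCGroup.not_chain_le_zero (by norm_num)) (F.pt_notMem_line hm)
    rw [hw, C.j_mem_J_iff] at h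
    exact PCGroup.memTest_of_mem (by decide) h
  obtain ⟨rfl, rfl⟩ := PCGroup.memTest_six_zero a ha c hc (hpolar 1 (by decide))
    (hpolar 2 (by decide))
  refine C.isStage A.isProP (by norm_num) (by norm_num) ?_ ?_
  · rw [h0]; simp [ev]
  · rw [h1]; simp [ev]

theorem exists_model (A : F.IsAdapted τ) : ∃ a < 3, ∃ b, (b = 0 ∨ b = 2) ∧ ∃ c < 3, ∃ d < 2,
    ∃ (T : Type) (_ : Group T) (φ : G →* T) (h : ℕ → T), Function.Surjective φ ∧
      IsOpen (φ.ker : Set G) ∧ PCModel a b c d h ∧ Nat.card T = 3 ^ 8 := by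
  obtain ⟨W, _, ⟨C⟩⟩ := A.exists_cover (k := 6) (l := 8) A.isStage_six (by norm_num)
    (by decide +kernel) (by decide +kernel)
  obtain ⟨a, ha, b, hb, c, hc, d, hd, h0, h1, hw⟩ :=
    C.exists_cubeWord (Or.inr ⟨le_rfl, rfl⟩)
  have hbot : chain (PCGroup.gen 0) 8 = ⊥ := (PCGroup.model 0).chain_eq_bot le_rfl
  have hiff : ∀ m, 0 ≠ m → (τ 0 = m ↔ ev (PCGroup.gen 0) (Cover.cubeWord 6 a b c d m) ∈
      ⁅(PCGroup.frame 0).line 0, (PCGroup.frame 0).line 0⁆ ⊔ chain (PCGroup.gen 0) 8) := by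
    intro m hm
    rw [← A.cubeTrivial_iff _ _ hm, C.cubeTrivial_iff (by norm_num) (A.card_ab _)
      (by rw [hbot]; exact bot_le), hw, C.j_mem_J_iff]
  have hτ := A.isStage_five.2
  have hd2 : d ≠ 2 := by
    rintro rfl
    obtain ⟨t, -, ht⟩ := PCGroup.collect_cubeWord_one a ha b hb c hc
    have := (hiff 1 (by decide)).2 (PCGroup.mem_of_collect ht)
    rw [this] at hτ
    revert hτ
    decide
  have hb1 : b ≠ 1 := by
    rintro rfl
    have htest : PCGroup.memTest 8 0 (Cover.cubeWord 6 a 1 c d (τ 0)) = true :=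
      PCGroup.memTest_of_mem (by decide)
        ((hiff (τ 0) (by rcases hτ with h | h <;> rw [h] <;> decide)).1 rfl)
    obtain ⟨h2, h3⟩ := PCGroup.memTest_eight_zero a ha c hc d (by omega)
    rcases hτ with h | h <;> rw [h] at htest
    · rw [h2] at htest
      exact Bool.noConfusion htest
    · rw [h3] at htest
      exact Bool.noConfusion htest
  have hsat : (pcData a b c d).Sat C.gens := C.sat_gens
    (by rw [C.gens_pow_three, h0, (PCGroup.sat_gen 0).pow, ← map_mul, ← ev_append]; rfl)
    (by rw [C.gens_pow_three, h1, (PCGroup.sat_gen 0).pow, ← map_mul, ← ev_append]; rfl)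
  have hmem : ∀ i, C.gens i ∈ C.φ.range := by
    intro i
    rcases lt_or_ge i 8 with hi | hi
    · exact hsat.mem_of_pair (S := C.φ.range) ⟨F.x, rfl⟩ ⟨F.y, rfl⟩ hi
    · rw [C.gens_eq_one hi]
      exact one_mem _
  refine ⟨a, ha, b, by omega, c, hc, d, by omega, C.φ.range, inferInstance, C.φ.rangeRestrict,
    fun i => ⟨C.gens i, hmem i⟩, C.φ.rangeRestrict_surjective, ?_, ⟨?_, ?_, ?_⟩, ?_⟩
  · rw [MonoidHom.ker_rangeRestrict]
    exact C.isOpen_ker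
  · exact Sat.of_map (φ := C.φ.range.subtype) (Subgroup.subtype_injective _) hsat
  · exact fun i hi => Subtype.ext (C.gens_eq_one hi)
  · refine eq_top_iff.2 fun t _ => ?_
    have hle := C.range_le A.isProP
      (S := (Subgroup.closure (Set.range fun i => (⟨C.gens i, hmem i⟩ : C.φ.range))).map
        C.φ.range.subtype)
      (Subgroup.mem_map.2 ⟨_, Subgroup.subset_closure ⟨0, rfl⟩, rfl⟩)
      (Subgroup.mem_map.2 ⟨_, Subgroup.subset_closure ⟨1, rfl⟩, rfl⟩)
    obtain ⟨s, hs, hst⟩ := hle t.2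
    rwa [← show s = t from Subtype.ext hst]
  · have hinj : Function.Injective C.j := by
      rw [← MonoidHom.ker_eq_bot_iff, C.ker_j, hbot]
    rw [C.card_range (by norm_num), ← PCGroup.card_eq (Or.inl rfl : (0 = 0 ∨ 0 = 2))]
    exact Nat.card_congr (MonoidHom.ofInjective hinj).toEquiv.symm

end IsAdapted
end Frame

/-! ### Removing the remaining parameters. -/

/-- A change of generators which removes the parameters `a`, `c`, `d` from `pcData a b c d`. -/
def substWord (a c d : ℕ) (i : ℕ) : List ℕ :=
  if d = 0 then
    match i with
    | 1 => [1] ++ (List.replicate c 3 ++ List.replicate (2 * a % 3) 4)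
    | 4 => [4] ++ List.replicate a 6
    | i => if i < 8 then [i] else []
  else
    match i with
    | 0 => [0]
    | 1 => [1, 1] ++ (List.replicate ((2 + 2 * c) % 3) 3 ++ List.replicate ((1 + a) % 3) 4)
    | 2 => [2, 2, 4] ++ List.replicate (2 * a % 3) 6
    | 3 => [3, 3, 6]
    | 4 => [4, 5] ++ List.replicate a 6
    | 7 => [7]
    | i => if i < 8 then [i, i] else []

theorem checkSubst_substWord : ∀ a < 3, ∀ b < 3, b ≠ 1 → ∀ c < 3, ∀ d < 2,
    (pcData a b c d).checkSubst (pcData 0 b 0 0) (substWord a c d) = true := by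
  decide +kernel

-- The `i`-th new generator is the first or second power of the old one times later letters; this
-- makes the substitution surjective.
set_option synthInstance.maxSize 20000 in
theorem substWord_triangular : ∀ a < 3, ∀ c < 3, ∀ d < 2, ∀ i < 8, ∃ s < 2,
    (substWord a c d i).take (s + 1) = List.replicate (s + 1) i ∧
      ∀ k ∈ (substWord a c d i).drop (s + 1), i < k := by
  decide +kernel

theorem substWord_of_le {a c d i : ℕ} (hi : 8 ≤ i) : substWord a c d i = [] := by
  obtain ⟨k, rfl⟩ := Nat.exists_eq_add_of_le' hi
  change (if d = 0 then (if k + 8 < 8 then [k + 8] else [])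
    else (if k + 8 < 8 then [k + 8, k + 8] else [])) = []
  simp

/-- A group of order `3 ^ 8` with generators satisfying `pcData a b c d` is `Γ_b`. -/
theorem PCModel.nonempty_mulEquiv {a b c d : ℕ} {T : Type*} [Group T] {h : ℕ → T}
    (H : PCModel a b c d h) (hT : Nat.card T = 3 ^ 8) (ha : a < 3) (hb : b = 0 ∨ b = 2)
    (hc : c < 3) (hd : d < 2) : Nonempty (PCGroup b ≃* T) := by
  have hsat : (pcData 0 b 0 0).Sat fun i => ev h (substWord a c d i) :=
    H.sat.subst (pcData_bounded 0 b 0 0) (fun i hi => substWord_of_le hi)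
      (checkSubst_substWord a ha b (by omega) (by omega) c hc d hd)
  let θ : PCGroup b →* T := PCGroup.lift (fun i hi => by rw [substWord_of_le hi, ev_nil]) hsat
  have hθ : ∀ i, ev h (substWord a c d i) ∈ θ.range := fun i => ⟨_, PCGroup.lift_gen _ _ i⟩
  have hchain : ∀ n ≤ 8, chain h (8 - n) ≤ θ.range := by
    intro n hn
    induction n with
    | zero =>
      rw [H.chain_eq_bot le_rfl]
      exact bot_le
    | succ n ih =>
      have ih := ih (by omega)
      obtain ⟨s, hs, h1, h2⟩ := substWord_triangular a ha c hc d hd (8 - (n + 1)) (by omega)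
      have hk : 8 - n = 8 - (n + 1) + 1 := by omega
      rw [hk] at ih
      generalize 8 - (n + 1) = k at *
      -- Descending induction: the later letters are already in the image. Either `h k` or its
      -- square remains, and in the second case `h k ^ 3 ∈ N_{k+1}` recovers `h k`.
      have hpow : h k ^ (s + 1) ∈ θ.range := by
        have h3 := hθ k
        rw [← List.take_append_drop (s + 1) (substWord a c d k), h1, ev_append, ev_replicate] at h3
        exact (Subgroup.mul_mem_cancel_right _ (ih (ev_mem_chain h2))).1 h3
      have hmem : h k ∈ θ.range := by
        interval_cases s
        · simpa using hpow
        · have h3 := mul_mem (ih (H.pow_three_mem k)) (inv_mem hpow)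
          rwa [pow_succ' (h k) 2, mul_inv_cancel_right] at h3
      rw [chain, Subgroup.closure_le]
      rintro _ ⟨i, hi, rfl⟩
      rcases eq_or_lt_of_le (Set.mem_Ici.1 hi) with rfl | hi
      · exact hmem
      · exact ih (mem_chain hi)
  have hsurj : Function.Surjective θ := by
    rw [← MonoidHom.range_eq_top, eq_top_iff, ← H.chain_zero]
    exact hchain 8 le_rfl
  have := (PCGroup.model b).finite
  have hbij : Function.Bijective θ := by
    have := Nat.finite_of_card_ne_zero (hT.trans_ne (by norm_num))
    exact (Nat.bijective_iff_surjective_and_card θ).2 ⟨hsurj, (PCGroup.card_eq hb).trans hT.symm⟩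
  exact ⟨MulEquiv.ofBijective θ hbij⟩

/-! ### Injectivity of the map onto `Γ_b`. -/

section cover

/-- Two homomorphisms that differ by central elements agree on commutators. -/
theorem commutator_le_eqLocus_of_central {E W : Type*} [Group E] [Group W] {i j : E →* W}
    (h : ∀ e, (j e)⁻¹ * i e ∈ Subgroup.center W) : commutator E ≤ i.eqLocus j := by
  rw [commutator_def, Subgroup.commutator_le]
  rintro a - b -
  have key : ∀ a, ∃ c ∈ Subgroup.center W, i a = j a * c := fun a =>
    ⟨_, h a, (mul_inv_cancel_left _ _).symm⟩
  obtain ⟨c, hc, h1⟩ := key a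
  obtain ⟨d, hd, h2⟩ := key b
  change i (a * b * a⁻¹ * b⁻¹) = j (a * b * a⁻¹ * b⁻¹)
  simp only [map_mul, map_inv, h1, h2]
  calc j a * c * (j b * d) * (j a * c)⁻¹ * (j b * d)⁻¹
      = j a * (c * (j b * d)) * c⁻¹ * (j a)⁻¹ * d⁻¹ * (j b)⁻¹ := by group
    _ = j a * j b * (d * (j a)⁻¹) * d⁻¹ * (j b)⁻¹ := by
        rw [← Subgroup.mem_center_iff.1 hc]; simp only [mul_assoc, mul_inv_cancel_left]
    _ = _ := by
        rw [← Subgroup.mem_center_iff.1 hd]; simp only [mul_assoc, mul_inv_cancel_left]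

theorem IsPGroup.exists_mem_center_pow {p : ℕ} [Fact p.Prime] {L : Type*} [Group L] [Finite L]
    (hL : IsPGroup p L) {K : Subgroup L} [K.Normal] (hK : K ≠ ⊥) :
    ∃ z ∈ K, z ∈ Subgroup.center L ∧ z ≠ 1 ∧ z ^ p = 1 := by
  obtain ⟨z, hz, hzc, hz1⟩ := hL.exists_mem_center hK
  obtain ⟨n, hn⟩ := IsPGroup.iff_orderOf.1 hL z
  have h0 : n ≠ 0 := by
    rintro rfl
    exact hz1 (orderOf_eq_one_iff.1 (by simpa using hn))
  refine ⟨z ^ p ^ (n - 1), pow_mem hz _, pow_mem hzc _, fun h => ?_, ?_⟩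
  · have h1 := orderOf_dvd_of_pow_eq_one h
    rw [hn, Nat.pow_dvd_pow_iff_le_right (Fact.out : p.Prime).one_lt] at h1
    omega
  · rw [← pow_mul, ← pow_succ, Nat.sub_add_cancel (Nat.pos_of_ne_zero h0), ← hn, pow_orderOf_eq_one]

variable {G : Type*} [Group G] [TopologicalSpace G] [IsTopologicalGroup G]

/-- A nontrivial open normal subgroup of a pro-`p` group contains an open normal subgroup such
that the quotient is central of order `p`. -/
theorem IsProP.exists_normal_lt {p : ℕ} [Fact p.Prime] (hG : IsProP p G) {R : Subgroup G}
    [R.Normal] (hR : IsOpen (R : Set G)) (hne : R ≠ ⊥) :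
    ∃ (V : Subgroup G) (_ : V.Normal) (w : G ⧸ V), IsOpen (V : Set G) ∧ V ≤ R ∧ w ≠ 1 ∧
      w ^ p = 1 ∧ w ∈ Subgroup.center (G ⧸ V) ∧
      R.map (QuotientGroup.mk' V) = Subgroup.zpowers w := by
  have := hG.compact
  have := hG.totallyDisconnected
  let S : Set (Subgroup G) := {V | V.Normal ∧ IsOpen (V : Set G) ∧ V < R}
  have hS : S.Nonempty := by
    obtain ⟨⟨r, hr⟩, hr1⟩ := Subgroup.ne_bot_iff_exists_ne_one.1 hne
    · obtain ⟨U, hU⟩ := ProfiniteGrp.exist_openNormalSubgroup_sub_open_nhds_of_one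
        (isOpen_compl_singleton (x := r)) (fun h => hr1 (Subtype.ext h.symm))
      refine ⟨R ⊓ U.toSubgroup, inferInstance, hR.inter U.isOpen', lt_of_le_of_ne inf_le_left ?_⟩
      intro h
      have : r ∈ R ⊓ U.toSubgroup := by rw [h]; exact hr
      exact hU this.2 rfl
  -- `V` of least index, that is, maximal among the open normal subgroups properly inside `R`; if `R
  -- / V` were larger than `⟨w⟩`, the preimage of `⟨w⟩` would contradict this.
  obtain ⟨V, ⟨hVn, hVo, hVR⟩, hmin⟩ :=
    WellFounded.has_min (measure fun V : Subgroup G => V.index).wf S hS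
  have hVf := hG.finiteIndex hVo
  have hfin : Finite (G ⧸ V) := Subgroup.finite_quotient_of_finiteIndex
  let π := QuotientGroup.mk' V
  have hK : R.map π ≠ ⊥ := by
    intro h
    rw [Subgroup.map_eq_bot_iff, QuotientGroup.ker_mk'] at h
    exact hVR.not_ge h
  have hKn : (R.map π).Normal := Subgroup.Normal.map ‹_› π (QuotientGroup.mk'_surjective V)
  obtain ⟨w, hwR, hwc, hw1, hwp⟩ := (hG.isPGroup_quotient hVo).exists_mem_center_pow hK
  refine ⟨V, hVn, w, hVo, hVR.le, hw1, hwp, hwc, ?_⟩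
  have hle : Subgroup.zpowers w ≤ R.map π := (Subgroup.zpowers_le).2 hwR
  by_contra hne'
  have hn : (Subgroup.zpowers w).Normal := by
    refine ⟨fun x hx g => ?_⟩
    have : x ∈ Subgroup.center (G ⧸ V) := (Subgroup.zpowers_le).2 hwc hx
    rw [Subgroup.mem_center_iff.1 this g, mul_inv_cancel_right]
    exact hx
  have hcm : (R.map π).comap π = R := by
    rw [Subgroup.comap_map_eq, QuotientGroup.ker_mk', sup_of_le_left hVR.le]
  have hVZ : V ≤ (Subgroup.zpowers w).comap π := by
    intro g hg
    rw [Subgroup.mem_comap, show π g = 1 from (QuotientGroup.eq_one_iff g).2 hg]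
    exact one_mem _
  have hlt : V < (Subgroup.zpowers w).comap π := by
    refine lt_of_le_of_ne hVZ fun h => hw1 ?_
    obtain ⟨g, rfl⟩ := QuotientGroup.mk'_surjective V w
    have : g ∈ V := by
      rw [h]
      exact Subgroup.mem_zpowers _
    exact (QuotientGroup.eq_one_iff g).2 this
  refine hmin ((Subgroup.zpowers w).comap π) ⟨hn.comap π, isOpen_of_le' hVZ hVo, ?_⟩ ?_
  · refine lt_of_le_of_ne (hcm ▸ Subgroup.comap_mono hle) fun h => hne' ?_
    rw [← Subgroup.map_comap_eq_self_of_surjective (QuotientGroup.mk'_surjective V)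
      (Subgroup.zpowers w)]
    exact (congrArg (Subgroup.map π) h).symm
  · have h1 := Subgroup.relIndex_mul_index hVZ
    have h2 : V.relIndex ((Subgroup.zpowers w).comap π) ≠ 1 := by
      rw [ne_eq, Subgroup.relIndex_eq_one]
      exact hlt.not_ge
    have h3 : V.index ≠ 0 := hVf.index_ne_zero
    change ((Subgroup.zpowers w).comap π).index < V.index
    rw [← h1] at h3 ⊢
    have h4 := left_ne_zero_of_mul h3
    have h5 := right_ne_zero_of_mul h3
    exact lt_mul_of_one_lt_left (Nat.pos_of_ne_zero h5) (by omega)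

/-- A surjection of a pro-`3` group onto a group for which all mod-`3` cocycles lift modulo `9` is
injective, provided that the abelianizations have the same order. -/
theorem IsProP.injective_of_cocyclesLift {Γ : Type*} [Group Γ] [TopologicalSpace Γ]
    [IsTopologicalGroup Γ] [DiscreteTopology Γ] (hG : IsProP 3 G) (hL : CocyclesLift Γ)
    (h9 : (commutator G).topologicalClosure.index = (commutator Γ).index)
    (h0 : (commutator Γ).index ≠ 0) {f : G →* Γ}
    (hf : Function.Surjective f) (ho : IsOpen (f.ker : Set G)) : Function.Injective f := by
  have : Fact (Nat.Prime 3) := ⟨Nat.prime_three⟩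
  rw [← MonoidHom.ker_eq_bot_iff]
  by_contra hne
  obtain ⟨V, hVn, w, hVo, hVR, hw1, hw3, hwc, hR⟩ := hG.exists_normal_lt ho hne
  have hVf := hG.finiteIndex hVo
  have hfin : Finite (G ⧸ V) := Subgroup.finite_quotient_of_finiteIndex
  let p : G ⧸ V →* Γ := QuotientGroup.lift V f hVR
  have hp : Function.Surjective p := QuotientGroup.lift_surjective_of_surjective V f hf hVR
  have hker : p.ker = Subgroup.zpowers w := by
    rw [← hR]
    exact QuotientGroup.ker_lift V f hVR
  -- The abelianization of `G / V` lies between those of `G` and `Γ`, whose orders agree. Hence the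
  -- kernel of `p` is contained in the commutator subgroup.
  have hcomm : (commutator Γ).comap p = commutator (G ⧸ V) := by
    have hle : commutator (G ⧸ V) ≤ (commutator Γ).comap p := by
      rw [commutator_def, Subgroup.commutator_le]
      intro a _ b _
      rw [Subgroup.mem_comap, map_commutatorElement]
      exact Subgroup.commutator_mem_commutator trivial trivial
    have hle' : (commutator G).topologicalClosure ≤
        (commutator (G ⧸ V)).comap (QuotientGroup.mk' V) := by
      refine Subgroup.topologicalClosure_minimal _ ?_ (Subgroup.isClosed_of_le_of_isOpen hVo ?_)
      · rw [commutator_def, Subgroup.commutator_le]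
        intro a _ b _
        rw [Subgroup.mem_comap, map_commutatorElement]
        exact Subgroup.commutator_mem_commutator trivial trivial
      · intro g hg
        rw [Subgroup.mem_comap, show QuotientGroup.mk' V g = 1 from (QuotientGroup.eq_one_iff g).2 hg]
        exact one_mem _
    have h1 := Subgroup.index_dvd_of_le hle'
    rw [Subgroup.index_comap_of_surjective _ (QuotientGroup.mk'_surjective V), h9] at h1
    have h2 := Subgroup.index_dvd_of_le hle
    rw [Subgroup.index_comap_of_surjective _ hp] at h2
    refine (Subgroup.eq_of_le_of_index_eq hle ?_ (fun h => h0 ?_)).symm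
    · rw [Subgroup.index_comap_of_surjective _ hp]
      exact Nat.dvd_antisymm h1 h2
    · rw [h] at h1
      exact zero_dvd_iff.1 h1
  obtain ⟨W, _, i, q, φ, hi, -, hqi, hqφ, hc⟩ := hL.exists_lift hp
    (by rw [hker, Subgroup.zpowers_le]; exact hwc)
    (by
      rw [hker]
      rintro _ ⟨n, rfl⟩
      change (w ^ n) ^ 3 = 1
      rw [← zpow_natCast, zpow_comm, zpow_natCast, hw3, one_zpow])
    (φ₀ := MonoidHom.id Γ) (isOpen_discrete _)
  have hloc := commutator_le_eqLocus_of_central (i := i) (j := φ.comp p) (fun e => (hc _ (by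
    have h1 := DFunLike.congr_fun hqi e
    have h2 := DFunLike.congr_fun hqφ (p e)
    rw [MonoidHom.comp_apply] at h1 h2
    rw [map_mul, map_inv, MonoidHom.comp_apply, h1, h2]
    exact inv_mul_cancel _)).1)
  have hpw : p w = 1 := by
    rw [← MonoidHom.mem_ker, hker]
    exact Subgroup.mem_zpowers w
  have hw : w ∈ commutator (G ⧸ V) := by
    rw [← hcomm, Subgroup.mem_comap, hpw]
    exact one_mem _
  have : i w = φ (p w) := hloc hw
  rw [hpw, map_one, ← map_one i] at this
  exact hw1 (hi this)

theorem index_closure_commutator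
    (h : Nonempty (TopologicalAbelianization G ≃* AbelianOfType [3, 3])) :
    (commutator G).topologicalClosure.index = 9 := by
  obtain ⟨e⟩ := h
  rw [Subgroup.index_eq_card]
  exact (Nat.card_congr e.toEquiv).trans (PCGroup.card_abelianOfType 3 3)

end cover

/-! ### Adapted frames and the conclusion. -/

namespace Frame
variable {G : Type*} [Group G] [TopologicalSpace G] [IsTopologicalGroup G]

theorem IsAdapted.nonempty_continuousMulEquiv {F : Frame G} {τ : Fin 4 → Fin 4} (A : F.IsAdapted τ) :
    ∃ b, (b = 0 ∨ b = 2) ∧ Nonempty (G ≃ₜ* PCGroup b) := by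
  obtain ⟨a, ha, b, hb, c, hc, d, hd, T, _, φ, h, hφ, hφo, H, hT⟩ := A.exists_model
  obtain ⟨θ⟩ := H.nonempty_mulEquiv hT ha hb hc hd
  let f : G →* PCGroup b := θ.symm.toMonoidHom.comp φ
  have hker : f.ker = φ.ker := by
    ext g
    exact θ.symm.map_eq_one_iff
  have hf : Function.Surjective f := θ.symm.surjective.comp hφ
  have ho : IsOpen (f.ker : Set G) := by
    rw [hker]
    exact hφo
  have h9 : (commutator (PCGroup b)).index = 9 := by
    rw [← index_closure_commutator (PCGroup.nonempty_abelianization_mulEquiv b),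
      topologicalClosure_of_discrete]
  have hinj := A.isProP.injective_of_cocyclesLift (PCGroup.cocyclesLift hb)
    (A.index_closure.trans h9.symm) (by rw [h9]; norm_num) hf ho
  have hbot : IsOpen ({1} : Set G) := by
    have := (MonoidHom.ker_eq_bot_iff f).2 hinj
    rw [this] at ho
    exact ho
  -- The kernel is open and trivial, so `G` is discrete and the algebraic isomorphism is
  -- topological.
  have : DiscreteTopology G := discreteTopology_of_isOpen_singleton_one hbot
  refine ⟨b, hb, ⟨{ MulEquiv.ofBijective f ⟨hinj, hf⟩ with
    continuous_toFun := continuous_of_discreteTopology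
    continuous_invFun := continuous_of_discreteTopology }⟩⟩

theorem exists_isAdapted (hG : SatisfiesConditions G) :
    ∃ (F : Frame G) (τ : Fin 4 → Fin 4), F.IsAdapted τ := by
  have hP := hG.isSchurSigmaGroup.isProP
  obtain ⟨F₀⟩ := exists_of_abelianization hG.abelianization
  have hL : CocyclesLift G := F₀.cocyclesLift (by
    rw [← hG.isSchurSigmaGroup.generatorRank_eq_relationRank, F₀.generatorRank_eq_two hP])
  obtain ⟨M, hM⟩ := hG.transferTargetType
  obtain ⟨M', hM'⟩ := hG.transferKernelType
  let i₀ := (F₀.maximal hP).symm (M 3)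
  let i₁ := (F₀.maximal hP).symm (M' 1)
  obtain ⟨j, hj, hij⟩ : ∃ j, i₀ ≠ j ∧ (i₁ ≠ i₀ → j = i₁) := by
    by_cases h : i₁ = i₀
    · obtain ⟨j, hj⟩ := exists_ne i₀
      exact ⟨j, hj.symm, fun h' => (h' h).elim⟩
    · exact ⟨i₁, Ne.symm h, fun _ => rfl⟩
  obtain ⟨F, hF0, hF1⟩ := F₀.exists_adapted hj
  have hline : ∀ (N : MaximalOpenSubgroup G) k, N.toSubgroup = F.line k →
      (F.maximal hP).symm N = k := by
    intro N k h
    rw [Equiv.symm_apply_eq]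
    obtain ⟨N, _, _, _⟩ := N
    simp only at h
    subst h
    rfl
  have hi₀ : F₀.line i₀ = (M 3).toSubgroup :=
    congrArg MaximalOpenSubgroup.toSubgroup ((F₀.maximal hP).apply_symm_apply (M 3))
  have hi₁ : F₀.line i₁ = (M' 1).toSubgroup :=
    congrArg MaximalOpenSubgroup.toSubgroup ((F₀.maximal hP).apply_symm_apply (M' 1))
  let σ : Fin 4 ≃ Fin 4 := M.trans (F.maximal hP).symm
  let π : Fin 4 ≃ Fin 4 := M'.trans (F.maximal hP).symm
  have hσ : ∀ k, F.maximal hP (σ k) = M k := fun k => Equiv.apply_symm_apply _ _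
  have hπ : ∀ k, F.maximal hP (π k) = M' k := fun k => Equiv.apply_symm_apply _ _
  have hσ3 : σ 3 = 0 := hline _ _ (hi₀.symm.trans hF0.symm)
  have hcard : ∀ k, Nat.card (TopologicalAbelianization (F.line (σ k))) =
      if σ k = 0 then 243 else 27 := by
    intro k
    obtain ⟨e⟩ := hM k
    have h1 : ∀ N, N = M k → Nat.card N.Ab =
        Nat.card (AbelianOfType (![[3, 9], [3, 9], [3, 9], [9, 27]] k)) := by
      rintro _ rfl
      exact Nat.card_congr e.toEquiv
    have h2 : σ k = 0 ↔ k = 3 := by rw [← hσ3, σ.injective.eq_iff]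
    rw [if_congr h2 rfl rfl]
    refine (h1 _ (hσ k)).trans ?_
    fin_cases k
    · exact PCGroup.card_abelianOfType 3 9
    · exact PCGroup.card_abelianOfType 3 9
    · exact PCGroup.card_abelianOfType 3 9
    · exact PCGroup.card_abelianOfType 9 27
  have hker : ∀ k, (F.maximal hP (π k)).transfer.ker =
      (F.maximal hP (π (kernelLabel k))).image := by
    intro k
    rw [hπ, hπ, hM' k]
    fin_cases k <;> rfl
  refine ⟨F, fun i => π (kernelLabel (π.symm i)), hP, hL,
    index_closure_commutator hG.abelianization, fun i => ?_, fun i m him => ?_,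
    π, π.injective, fun i => by rw [π.symm_apply_apply], ?_⟩
  · obtain ⟨k, rfl⟩ := σ.surjective i
    rw [hcard, PCGroup.card_ab (Or.inl rfl)]
  · obtain ⟨k, rfl⟩ := π.surjective i
    rw [π.symm_apply_apply, ← F.mem_ker_transfer_iff hP (F.pt_notMem_line him), hker,
      F.mk_mem_image hP, pt_mem_line]
  · by_cases h : i₁ = i₀
    · exact Or.inr (hline _ _ (by rw [hF0, ← hi₁, h]))
    · exact Or.inl (hline _ _ (by rw [hF1, ← hi₁, hij h]))

end Frame

theorem theorem4p1 :
    (∀ e : ℕ, e = 0 ∨ e = 2 →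
      Nat.card (PCGroup e) = 3 ^ 8 ∧ HasDerivedLength (PCGroup e) 3 ∧
        SatisfiesConditions (PCGroup e)) ∧
    IsEmpty (PCGroup 0 ≃* PCGroup 2) ∧
    ∀ (G : Type*) [Group G] [TopologicalSpace G] [IsTopologicalGroup G],
      SatisfiesConditions G → Nonempty (G ≃ₜ* PCGroup 0) ∨ Nonempty (G ≃ₜ* PCGroup 2) := by
  refine ⟨fun e he => ⟨PCGroup.card_eq he, PCGroup.hasDerivedLength he,
    PCGroup.satisfiesConditions he⟩, PCGroup.isEmpty_mulEquiv, fun G _ _ _ hG => ?_⟩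
  obtain ⟨F, τ, A⟩ := Frame.exists_isAdapted hG
  obtain ⟨b, rfl | rfl, h⟩ := A.nonempty_continuousMulEquiv
  · exact Or.inl h
  · exact Or.inr h
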